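/- Let $d\ge 3$ and let $M$ be an oriented smooth $d$-dimensional manifold (Hausdorff, $\sigma$-compact, without boundary) with a smooth metric of signature $(\sigma,+1,\dots,+1)$, $\sigma=\pm1$, and Hodge star $(*\omega)_J=\frac1{k!}\,\epsilon^{i_1\dots i_k}{}_J\,\omega_{i_1\dots i_k}$ on $k$-forms. Let $e\neq 0$ be real. Let $(\mathfrak h,\mathfrak g;\alpha,\vartriangleright)$ be a finite-dimensional real differential crossed module: $\alpha:\mathfrak h\to\mathfrak g$ is a Lie algebra map and $\vartriangleright$ is an action of $\mathfrak g$ on $\mathfrak h$ by derivations with $\alpha(X\vartriangleright Y)=[X,\alpha(Y)]$ and $\alpha(Y)\vartriangleright Y'=[Y,Y']$. Let $\langle\,,\rangle$ be non-degenerate symmetric bilinear forms on $\mathfrak g$ and on $\mathfrak h$ that are invariant: $\langle[X,X'],X''\rangle=-\langle X',[X,X'']\rangle$ and $\langle X\vartriangleright Y,Y'\rangle=-\langle Y,X\vartriangleright Y'\rangle$. Define $\alpha^*:\mathfrak g\to\mathfrak h$ and a bilinear map $s:\mathfrak h\times\mathfrak h\to\mathfrak g$ by $\langle Y,\alpha^*(X)\rangle=\langle\alpha(Y),X\rangle$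 and $\langle s(Y,Y'),X\rangle=-\langle Y,X\vartriangleright Y'\rangle$. For Lie-algebra-valued forms let $\wedge^{[,]}$, $\wedge^{\vartriangleright}$, $\overline\sigma(\cdot,\cdot)$ and $\langle\cdot,\cdot\rangle$ be the wedge products induced by the bilinear maps $[\,,]$, $\vartriangleright$, $s$ and $\langle\,,\rangle$, respectively; $\alpha$ and $\alpha^*$ act on the values of forms. For smooth forms $A\in\Lambda^1(M,\mathfrak g)$, $B\in\Lambda^2(M,\mathfrak h)$, $\overline B\in\Lambda^{d-2}(M,\mathfrak g)$, $\overline C\in\Lambda^{d-3}(M,\mathfrak h)$ put $\mathcal F=dA+\tfrac12A\wedge^{[,]}A-\alpha(B)$ (with $\tfrac12A\wedge^{[,]}A=A\wedge A$ for matrix Lie algebras) and $\mathcal G=dB+A\wedge^{\vartriangleright}B$, and consider the actions $$S_{2BFYM}=\int\langle\overline B,\mathcal F\rangle+e^2\langle\overline B,*\overline B\rangle+\langle\overline C,\mathcal G\rangle+e^2\langle\overline C,*\overline C\rangle,\qquad S_{2YM}=-\frac{\sigma}{4e^2}\int\langle\mathcal F,*\mathcal F\rangle+\langle\mathcal G,*\mathcal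 G\rangle .$$ A solution of either theory is a smooth critical point of its action: for every compact $D\subset M$, the first variation of the action over $D$ vanishes for all smooth variations of the fields that vanish outside $D$. Then: 1. $(A,B,\overline B,\overline C)$ is a critical point of $S_{2BFYM}$ if and only if $$\mathcal F+2e^2*\overline B=0,\quad \mathcal G+2e^2*\overline C=0,\quad d\overline B+A\wedge^{[,]}\overline B=(-1)^{d+1}\,\overline\sigma(\overline C,B),\quad d\overline C+A\wedge^{\vartriangleright}\overline C=(-1)^d\alpha^*(\overline B).$$ 2. These equations force $\overline B=-\frac{\sigma}{2e^2}*\mathcal F$ and $\overline C=(-1)^d\frac{\sigma}{2e^2}*\mathcal G$. 3. If $\overline B,\overline C$ have the values in 2, then the equations in 1 are equivalent to the 2-form Yang–Mills equations $$d{*\mathcal F}+A\wedge^{[,]}{*\mathcal F}=\overline\sigma(*\mathcal G,B),\qquad d{*\mathcal G}+A\wedge^{\vartriangleright}{*\mathcal G}=-\alpha^*(*\mathcal F),$$ and the integrand of $S_{2BFYM}$ is equal to that of $S_{2YM}$; hence the two actions agree over $M$ and over every closed subset of $M$. 4. $(A,B)$ is a critical point of $S_{2YM}$ if and only if it satisfies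 the 2-form Yang–Mills equations. 5. The map $(A,B,\overline B,\overline C)\mapsto(A,B)$ is a bijection from the solutions of the 2BFYM theory onto the solutions of the 2YM theory. In this sense the two theories are classically equivalent. -/

import Mathlib

noncomputable section

namespace HigherGauge

open scoped Manifold ContDiff

/-! ### Differential crossed modules and invariant forms -/

/-- A differential crossed module `(𝔥, 𝔤; α, ▷)`: a Lie algebra map `α : 𝔥 → 𝔤` and an action of
`𝔤` on `𝔥` by derivations, with `α (X ▷ Y) = [X, α Y]` and `α Y ▷ Y' = [Y, Y']`. -/
structure DifferentialCrossedModule (𝔤 𝔥 : Type*) [LieRing 𝔤] [LieAlgebra ℝ 𝔤]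
    [LieRing 𝔥] [LieAlgebra ℝ 𝔥] where
  α : 𝔥 →ₗ⁅ℝ⁆ 𝔤
  act : 𝔤 →ₗ⁅ℝ⁆ LieDerivation ℝ 𝔥 𝔥
  equivariant : ∀ (X : 𝔤) (Y : 𝔥), α (act X Y) = ⁅X, α Y⁆
  peiffer : ∀ Y Y' : 𝔥, act (α Y) Y' = ⁅Y, Y'⁆

namespace DifferentialCrossedModule

variable {𝔤 𝔥 : Type*} [LieRing 𝔤] [LieAlgebra ℝ 𝔤] [LieRing 𝔥] [LieAlgebra ℝ 𝔥]

/-- The action `(X, Y) ↦ X ▷ Y` as a bilinear map. -/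
def actBilin (X : DifferentialCrossedModule 𝔤 𝔥) : 𝔤 →ₗ[ℝ] 𝔥 →ₗ[ℝ] 𝔥 :=
  LinearMap.mk₂ ℝ (fun x y => X.act x y) (by simp) (by simp) (by simp) (by simp)

/-- Invariant non-degenerate symmetric bilinear forms on `𝔤` and `𝔥`. -/
structure InvariantForms (X : DifferentialCrossedModule 𝔤 𝔥) where
  formG : LinearMap.BilinForm ℝ 𝔤
  formH : LinearMap.BilinForm ℝ 𝔥
  symmG : formG.IsSymm
  symmH : formH.IsSymm
  nondegenerateG : formG.Nondegenerate
  nondegenerateH : formH.Nondegenerate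
  invariantG : ∀ x x' x'' : 𝔤, formG ⁅x, x'⁆ x'' = -formG x' ⁅x, x''⁆
  invariantH : ∀ (x : 𝔤) (y y' : 𝔥), formH (X.act x y) y' = -formH y (X.act x y')

namespace InvariantForms

variable {X : DifferentialCrossedModule 𝔤 𝔥}

/-- The bilinear map `σ : 𝔥 × 𝔥 → 𝔤` determined by `⟨σ(Y, Y'), x⟩ = -⟨Y, x ▷ Y'⟩`. -/
def sigma [FiniteDimensional ℝ 𝔤] (κ : X.InvariantForms) : 𝔥 →ₗ[ℝ] 𝔥 →ₗ[ℝ] 𝔤 :=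
  LinearMap.mk₂ ℝ
    (fun y y' => (κ.formG.toDual κ.nondegenerateG).symm (-(κ.formH y ∘ₗ X.actBilin.flip y')))
    (fun y₁ y₂ y' => by
      rw [← map_add, map_add, LinearMap.add_comp, neg_add])
    (fun c y y' => by
      rw [← map_smul, map_smul, LinearMap.smul_comp, smul_neg])
    (fun y y₁ y₂ => by
      rw [← map_add, map_add, LinearMap.comp_add, neg_add])
    (fun c y y' => by
      rw [← map_smul, map_smul, LinearMap.comp_smul, smul_neg])

theorem formG_sigma [FiniteDimensional ℝ 𝔤] (κ : X.InvariantForms) (y y' : 𝔥) (x : 𝔤) :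
    κ.formG (κ.sigma y y') x = -κ.formH y (X.act x y') := by
  simp [sigma, actBilin]

/-- The map `α* : 𝔤 → 𝔥` determined by `⟨Y, α*(x)⟩ = ⟨α(Y), x⟩`. -/
def alphaStar [FiniteDimensional ℝ 𝔥] (κ : X.InvariantForms) : 𝔤 →ₗ[ℝ] 𝔥 :=
  (κ.formH.toDual κ.nondegenerateH).symm.toLinearMap ∘ₗ
    (κ.formG ∘ₗ (X.α : 𝔥 →ₗ[ℝ] 𝔤)).flip

theorem formH_alphaStar [FiniteDimensional ℝ 𝔥] (κ : X.InvariantForms) (y : 𝔥) (x : 𝔤) :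
    κ.formH y (κ.alphaStar x) = κ.formG (X.α y) x := by
  rw [← κ.symmH.eq]
  simp [alphaStar]

end InvariantForms

end DifferentialCrossedModule

/-! ### Vector-valued differential forms on a manifold -/

/-- Algebraic alternating forms on `ℝᵈ` are continuous. -/
def toContinuousForm {d k : ℕ} (f : EuclideanSpace ℝ (Fin d) [⋀^Fin k]→ₗ[ℝ] ℝ) :
    EuclideanSpace ℝ (Fin d) [⋀^Fin k]→L[ℝ] ℝ where
  toMultilinearMap := f.toMultilinearMap
  map_eq_zero_of_eq' := f.map_eq_zero_of_eq'
  cont := by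
    have h : ∀ v : Fin k → EuclideanSpace ℝ (Fin d), f v =
        ∑ r : Fin k → Fin d, (∏ i, v i (r i)) • f (fun i => EuclideanSpace.single (r i) 1) := by
      intro v
      have hv : v = fun i => ∑ j, v i j • EuclideanSpace.single j (1 : ℝ) := by
        funext i
        have hs := (EuclideanSpace.basisFun (Fin d) ℝ).sum_repr (v i)
        simp only [EuclideanSpace.basisFun_apply, EuclideanSpace.basisFun_repr] at hs
        exact hs.symm
      conv_lhs => rw [hv]
      rw [← AlternatingMap.coe_multilinearMap, MultilinearMap.map_sum]
      exact Finset.sum_congr rfl fun r _ => MultilinearMap.map_smul_univ _ _ _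
    change Continuous fun v : Fin k → EuclideanSpace ℝ (Fin d) => f v
    rw [funext h]
    fun_prop

section Forms

variable (d : ℕ) (M : Type*) [TopologicalSpace M] [ChartedSpace (EuclideanSpace ℝ (Fin d)) M]

/-- `W`-valued differential `k`-forms on the `d`-dimensional manifold `M`, with no regularity
condition; see `IsSmoothForm`. -/
abbrev DForm (k : ℕ) (W : Type*) [AddCommGroup W] [Module ℝ W] : Type _ :=
  (x : M) → TangentSpace (𝓡 d) x [⋀^Fin k]→ₗ[ℝ] W

/-- The atlas of `M` is oriented: all coordinate changes have positive Jacobian determinant.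
The manifold is then oriented by declaring the charts of the atlas to be positive. -/
class OrientedAtlas : Prop where
  det_pos : ∀ e ∈ atlas (EuclideanSpace ℝ (Fin d)) M, ∀ e' ∈ atlas (EuclideanSpace ℝ (Fin d)) M,
    ∀ y ∈ (e.symm.trans e').source, 0 < (fderiv ℝ (e' ∘ e.symm) y).det

variable {d M}
variable {U V W : Type*} [AddCommGroup U] [Module ℝ U] [AddCommGroup V] [Module ℝ V]
  [AddCommGroup W] [Module ℝ W]

/-- The derivative at `y` of the inverse of the chart at `x₀`. -/
def chartSymmDeriv (x₀ : M) (y : EuclideanSpace ℝ (Fin d)) :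
    EuclideanSpace ℝ (Fin d) →ₗ[ℝ] TangentSpace (𝓡 d) ((extChartAt (𝓡 d) x₀).symm y) :=
  let D : EuclideanSpace ℝ (Fin d) →L[ℝ] TangentSpace (𝓡 d) ((extChartAt (𝓡 d) x₀).symm y) :=
    mfderiv 𝓘(ℝ, EuclideanSpace ℝ (Fin d)) (𝓡 d) (extChartAt (𝓡 d) x₀).symm y
  (D : EuclideanSpace ℝ (Fin d) →ₗ[ℝ] TangentSpace (𝓡 d) ((extChartAt (𝓡 d) x₀).symm y))

/-- The derivative at `x` of the chart at `x`. -/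
def chartDeriv (x : M) : TangentSpace (𝓡 d) x →ₗ[ℝ] EuclideanSpace ℝ (Fin d) :=
  let D : TangentSpace (𝓡 d) x →L[ℝ] EuclideanSpace ℝ (Fin d) :=
    mfderiv (𝓡 d) 𝓘(ℝ, EuclideanSpace ℝ (Fin d)) (extChartAt (𝓡 d) x) x
  (D : TangentSpace (𝓡 d) x →ₗ[ℝ] EuclideanSpace ℝ (Fin d))

/-- The expression of a form in the chart at `x₀`: its pullback by the inverse chart. -/
def localRep {k : ℕ} (x₀ : M) (θ : DForm d M k W) (y : EuclideanSpace ℝ (Fin d)) :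
    EuclideanSpace ℝ (Fin d) [⋀^Fin k]→ₗ[ℝ] W :=
  (θ ((extChartAt (𝓡 d) x₀).symm y)).compLinearMap (chartSymmDeriv x₀ y)

/-- A form is smooth if all its coefficients (with respect to linear functionals on `W`) are
smooth in all charts. -/
def IsSmoothForm {k : ℕ} (θ : DForm d M k W) : Prop :=
  ∀ (x₀ : M) (v : Fin k → EuclideanSpace ℝ (Fin d)) (φ : Module.Dual ℝ W),
    ContDiffOn ℝ ∞ (fun y => φ (localRep x₀ θ y v)) (extChartAt (𝓡 d) x₀).target

/-- The exterior derivative of a real-valued form, computed at each point in the chart there. -/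
def extDScalar {k : ℕ} (θ : DForm d M k ℝ) : DForm d M (k + 1) ℝ := fun x =>
  (extDeriv (fun y => toContinuousForm (localRep x θ y))
      (extChartAt (𝓡 d) x x)).toAlternatingMap.compLinearMap (chartDeriv x)

/-- The exterior derivative `d(∑ θᵃ wₐ) = ∑ dθᵃ wₐ` of a vector-valued form. -/
def extD [FiniteDimensional ℝ W] {k m : ℕ} (h : k + 1 = m) (θ : DForm d M k W) :
    DForm d M m W := fun x =>
  ∑ a, (LinearMap.toSpanSingleton ℝ W (Module.finBasis ℝ W a)).compAlternatingMap
    ((extDScalar (fun z => ((Module.finBasis ℝ W).coord a).compAlternatingMap (θ z)) x).domDomCongr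
      (finCongr h))

/-- The wedge product of vector-valued forms induced by a bilinear map `β : U × V → W`:
`(∑ θᵃ uₐ) ∧^β (∑ ηᵇ v_b) = ∑ θᵃ ∧ ηᵇ β(uₐ, v_b)`. -/
def wedge (β : U →ₗ[ℝ] V →ₗ[ℝ] W) {k l m : ℕ} (h : k + l = m) (θ : DForm d M k U)
    (η : DForm d M l V) : DForm d M m W := fun x =>
  ((TensorProduct.lift β).compAlternatingMap ((θ x).domCoprod (η x))).domDomCongr
    (finSumFinEquiv.trans (finCongr h))

/-- A linear map applied to the values of a form. -/
def mapForm (L : U →ₗ[ℝ] W) {k : ℕ} (θ : DForm d M k U) : DForm d M k W := fun x =>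
  L.compAlternatingMap (θ x)

/-! ### Integration on oriented manifolds -/

variable (d M) in
/-- A smooth partition of unity subordinate to the charts. -/
def chartPartition [IsManifold (𝓡 d) ∞ M] [T2Space M] [SigmaCompactSpace M] :
    SmoothPartitionOfUnity M (𝓡 d) M Set.univ :=
  Classical.choose (SmoothPartitionOfUnity.exists_isSubordinate_chartAt_source (𝓡 d) M)

/-- The integral `∫_D θ` of a top-degree form (`M` being oriented by its atlas): the sum over the
charts of the Lebesgue integrals of the coefficient of `ρᵢ θ`. -/
def integral [IsManifold (𝓡 d) ∞ M] [T2Space M] [SigmaCompactSpace M] [OrientedAtlas d M]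
    (D : Set M) (θ : DForm d M d ℝ) : ℝ :=
  ∑' i : M, ∫ y in (extChartAt (𝓡 d) i).target ∩ (extChartAt (𝓡 d) i).symm ⁻¹' D,
    chartPartition d M i ((extChartAt (𝓡 d) i).symm y) *
      localRep i θ y (fun j => EuclideanSpace.single j 1)

/-! ### Metrics and the Hodge star -/

variable (d M) in
/-- A smooth metric of signature `(σ, +1, …, +1)` on `M`. -/
structure Metric (σ : ℝ) where
  form : (x : M) → LinearMap.BilinForm ℝ (TangentSpace (𝓡 d) x)
  symm : ∀ x, (form x).IsSymm
  signature : ∀ x, ∃ b : Module.Basis (Fin d) ℝ (TangentSpace (𝓡 d) x), ∀ i j,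
    form x (b i) (b j) = if i = j then (if (i : ℕ) = 0 then σ else 1) else 0
  smooth : ∀ (x₀ : M) (v w : EuclideanSpace ℝ (Fin d)),
    ContDiffOn ℝ ∞ (fun y => form ((extChartAt (𝓡 d) x₀).symm y)
      (chartSymmDeriv x₀ y v) (chartSymmDeriv x₀ y w))
      (extChartAt (𝓡 d) x₀).target

/-- The coordinate frame at `x` of the chart at `x` (in Mathlib, tangent vectors at `x` are
expressed in this chart). -/
def frame (x : M) (i : Fin d) : TangentSpace (𝓡 d) x :=
  (EuclideanSpace.single i 1 : EuclideanSpace ℝ (Fin d))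

/-- The matrix `g_{ij}` of the metric in the coordinate frame. -/
def Metric.gram {σ : ℝ} (g : Metric d M σ) (x : M) : Matrix (Fin d) (Fin d) ℝ :=
  Matrix.of fun i j => g.form x (frame x i) (frame x j)

/-- The volume form `√|det g| dx¹ ∧ ⋯ ∧ dxᵈ`, that is, the tensor `ε_{i₁ … i_d}`. -/
def Metric.vol {σ : ℝ} (g : Metric d M σ) [OrientedAtlas d M] (x : M) :
    TangentSpace (𝓡 d) x [⋀^Fin d]→ₗ[ℝ] ℝ :=
  √|(g.gram x).det| • (EuclideanSpace.basisFun (Fin d) ℝ).toBasis.det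

/-- The alternating form `v ↦ f(u₁, …, u_k, v₁, …, v_m)`. -/
def fixFirst {E : Type*} [AddCommGroup E] [Module ℝ E] {k m n : ℕ} (h : k + m = n)
    (f : E [⋀^Fin n]→ₗ[ℝ] ℝ) (u : Fin k → E) : E [⋀^Fin m]→ₗ[ℝ] ℝ where
  toFun v := f.domDomCongr (finSumFinEquiv.trans (finCongr h)).symm (Sum.elim u v)
  map_update_add' v i x y := by
    classical
    simp only [← Sum.update_elim_inr]
    convert AlternatingMap.map_update_add _ _ _ _ _
  map_update_smul' v i c x := by
    classical
    simp only [← Sum.update_elim_inr]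
    convert AlternatingMap.map_update_smul _ _ _ _ _
  map_eq_zero_of_eq' v i j hv hij :=
    AlternatingMap.map_eq_zero_of_eq _ _ (i := Sum.inr i) (j := Sum.inr j) hv (by simpa using hij)

/-- The Hodge star: `(*θ)_J = (1/k!) ε^{i₁ … i_k}_J θ_{i₁ … i_k}`, indices being raised with the
inverse metric. -/
def hodge {σ : ℝ} (g : Metric d M σ) [OrientedAtlas d M] {k m : ℕ} (h : k + m = d)
    (θ : DForm d M k W) : DForm d M m W := fun x =>
  (Nat.factorial k : ℝ)⁻¹ • ∑ i : Fin k → Fin d, ∑ j : Fin k → Fin d,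
    (∏ a, (g.gram x)⁻¹ (i a) (j a)) •
      (LinearMap.toSpanSingleton ℝ W (θ x (fun a => frame x (i a)))).compAlternatingMap
        (fixFirst h (g.vol x) (fun a => frame x (j a)))

end Forms

/-! ### The 2BFYM and 2YM theories -/

section Theories

variable {d q : ℕ} {M : Type*} [TopologicalSpace M] [ChartedSpace (EuclideanSpace ℝ (Fin d)) M]
  {𝔤 𝔥 : Type*} [LieRing 𝔤] [LieAlgebra ℝ 𝔤] [FiniteDimensional ℝ 𝔤]
  [LieRing 𝔥] [LieAlgebra ℝ 𝔥] [FiniteDimensional ℝ 𝔥]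

/-- The bracket `[ , ]` as a bilinear map. -/
def bracket (L : Type*) [LieRing L] [LieAlgebra ℝ L] : L →ₗ[ℝ] L →ₗ[ℝ] L :=
  (LieAlgebra.ad ℝ L : L →ₗ[ℝ] Module.End ℝ L)

/-- The fake curvature `𝓕 = dA + A ∧ A - α(B)`, where `A ∧ A = ½ A ∧^[,] A`. -/
def curvF (X : DifferentialCrossedModule 𝔤 𝔥) (A : DForm d M 1 𝔤) (B : DForm d M 2 𝔥) :
    DForm d M 2 𝔤 :=
  extD rfl A + (1 / 2 : ℝ) • wedge (bracket 𝔤) rfl A A - mapForm (X.α : 𝔥 →ₗ[ℝ] 𝔤) B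

/-- The 2-curvature `𝓖 = dB + A ∧^▷ B`. -/
def curvG (X : DifferentialCrossedModule 𝔤 𝔥) (A : DForm d M 1 𝔤) (B : DForm d M 2 𝔥) :
    DForm d M 3 𝔥 :=
  extD rfl B + wedge X.actBilin rfl A B

variable {X : DifferentialCrossedModule 𝔤 𝔥} (κ : X.InvariantForms) {σ : ℝ}
  (g : Metric d M σ) [OrientedAtlas d M] (e : ℝ)

/-- The 2BFYM Lagrangian `⟨B̄, 𝓕⟩ + e² ⟨B̄, *B̄⟩ + ⟨C̄, 𝓖⟩ + e² ⟨C̄, *C̄⟩`; here `q = d - 3`. -/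
def lagrangian2BFYM (hd : q + 3 = d) (A : DForm d M 1 𝔤) (B : DForm d M 2 𝔥)
    (Bbar : DForm d M (q + 1) 𝔤) (Cbar : DForm d M q 𝔥) : DForm d M d ℝ :=
  wedge κ.formG (by omega) Bbar (curvF X A B)
    + e ^ 2 • wedge κ.formG (by omega) Bbar (hodge g (m := 2) (by omega) Bbar)
    + wedge κ.formH (by omega) Cbar (curvG X A B)
    + e ^ 2 • wedge κ.formH (by omega) Cbar (hodge g (m := 3) (by omega) Cbar)

/-- The 2YM Lagrangian `-(σ / 4e²) (⟨𝓕, *𝓕⟩ + ⟨𝓖, *𝓖⟩)`. -/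
def lagrangian2YM (hd : q + 3 = d) (A : DForm d M 1 𝔤) (B : DForm d M 2 𝔥) : DForm d M d ℝ :=
  (-(σ / (4 * e ^ 2))) •
    (wedge κ.formG (by omega) (curvF X A B) (hodge g (m := q + 1) (by omega) (curvF X A B))
      + wedge κ.formH (by omega) (curvG X A B) (hodge g (m := q) (by omega) (curvG X A B)))

/-- The equations of motion of the 2BFYM theory. -/
def FieldEquations2BFYM (hd : q + 3 = d) (A : DForm d M 1 𝔤) (B : DForm d M 2 𝔥)
    (Bbar : DForm d M (q + 1) 𝔤) (Cbar : DForm d M q 𝔥) : Prop :=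
  curvF X A B + (2 * e ^ 2) • hodge g (m := 2) (by omega) Bbar = 0 ∧
  curvG X A B + (2 * e ^ 2) • hodge g (m := 3) (by omega) Cbar = 0 ∧
  extD (m := q + 2) rfl Bbar + wedge (bracket 𝔤) (by omega) A Bbar
    = (-1 : ℝ) ^ (d + 1) • wedge κ.sigma rfl Cbar B ∧
  extD (m := q + 1) rfl Cbar + wedge X.actBilin (by omega) A Cbar
    = (-1 : ℝ) ^ d • mapForm κ.alphaStar Bbar

/-- The 2-form Yang–Mills field equations. -/
def FieldEquations2YM (hd : q + 3 = d) (A : DForm d M 1 𝔤) (B : DForm d M 2 𝔥) : Prop :=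
  let starF : DForm d M (q + 1) 𝔤 := hodge g (by omega) (curvF X A B)
  let starG : DForm d M q 𝔥 := hodge g (by omega) (curvG X A B)
  extD (m := q + 2) rfl starF + wedge (bracket 𝔤) (by omega) A starF
    = wedge κ.sigma rfl starG B ∧
  extD (m := q + 1) rfl starG + wedge X.actBilin (by omega) A starG
    = -mapForm κ.alphaStar starF

variable [IsManifold (𝓡 d) ∞ M] [T2Space M] [SigmaCompactSpace M]

/-- The 2BFYM action over a domain of integration `D`. -/
def action2BFYM (hd : q + 3 = d) (D : Set M) (A : DForm d M 1 𝔤) (B : DForm d M 2 𝔥)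
    (Bbar : DForm d M (q + 1) 𝔤) (Cbar : DForm d M q 𝔥) : ℝ :=
  integral D (lagrangian2BFYM κ g e hd A B Bbar Cbar)

/-- The 2YM action over a domain of integration `D`. -/
def action2YM (hd : q + 3 = d) (D : Set M) (A : DForm d M 1 𝔤) (B : DForm d M 2 𝔥) : ℝ :=
  integral D (lagrangian2YM κ g e hd A B)

/-- `(A, B, B̄, C̄)` is a critical point of the 2BFYM action: the first variation of the action over
each compact set `D` vanishes for all smooth variations of the fields that are supported in `D`. -/
def IsCritical2BFYM (hd : q + 3 = d) (A : DForm d M 1 𝔤) (B : DForm d M 2 𝔥)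
    (Bbar : DForm d M (q + 1) 𝔤) (Cbar : DForm d M q 𝔥) : Prop :=
  ∀ D : Set M, IsCompact D →
    ∀ (δA : DForm d M 1 𝔤) (δB : DForm d M 2 𝔥)
      (δBbar : DForm d M (q + 1) 𝔤) (δCbar : DForm d M q 𝔥),
    IsSmoothForm δA → IsSmoothForm δB → IsSmoothForm δBbar → IsSmoothForm δCbar →
    (∀ x ∉ D, δA x = 0 ∧ δB x = 0 ∧ δBbar x = 0 ∧ δCbar x = 0) →
    HasDerivAt (fun t : ℝ => action2BFYM κ g e hd D (A + t • δA) (B + t • δB)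
      (Bbar + t • δBbar) (Cbar + t • δCbar)) 0 0

/-- `(A, B)` is a critical point of the 2YM action, in the same sense. -/
def IsCritical2YM (hd : q + 3 = d) (A : DForm d M 1 𝔤) (B : DForm d M 2 𝔥) : Prop :=
  ∀ D : Set M, IsCompact D →
    ∀ (δA : DForm d M 1 𝔤) (δB : DForm d M 2 𝔥), IsSmoothForm δA → IsSmoothForm δB →
    (∀ x ∉ D, δA x = 0 ∧ δB x = 0) →
    HasDerivAt (fun t : ℝ => action2YM κ g e hd D (A + t • δA) (B + t • δB)) 0 0

/-- The space of (smooth) solutions `(A, B, B̄, C̄)` of the 2BFYM theory. -/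
def solutions2BFYM (hd : q + 3 = d) :
    Set (DForm d M 1 𝔤 × DForm d M 2 𝔥 × DForm d M (q + 1) 𝔤 × DForm d M q 𝔥) :=
  {φ | IsSmoothForm φ.1 ∧ IsSmoothForm φ.2.1 ∧ IsSmoothForm φ.2.2.1 ∧ IsSmoothForm φ.2.2.2 ∧
    IsCritical2BFYM κ g e hd φ.1 φ.2.1 φ.2.2.1 φ.2.2.2}

/-- The space of (smooth) solutions `(A, B)` of the 2YM theory. -/
def solutions2YM (hd : q + 3 = d) : Set (DForm d M 1 𝔤 × DForm d M 2 𝔥) :=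
  {φ | IsSmoothForm φ.1 ∧ IsSmoothForm φ.2 ∧ IsCritical2YM κ g e hd φ.1 φ.2}

end Theories

end HigherGauge

end

/-! Everything rests on one functional, `∫ ⟨P, 𝓕⟩ + ⟨Q, 𝓖⟩`, varied in `(A, B)` with `P, Q` fixed.
Integration by parts removes the exterior derivatives from `δA, δB`. Invariance of the forms and the
definitions of `α*` and `σ` (the bilinear map) do the same for the algebraic terms. What remains is
`∫ ⟨eulerA, δA⟩ + ⟨eulerB, δB⟩` (`integral_first_variation`). Since the pairings are nondegenerate,
the fundamental lemma `eq_zero_of_integral_wedge_eq_zero` shows that stationarity means `eulerA =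
eulerB = 0` (`first_variation_eq_zero_iff`).

For 2BFYM take `P = B̄`, `Q = C̄`: these are the last two field equations. Varying `B̄, C̄` gives
the first two, because `⟨a, *b⟩` is symmetric. For 2YM the same symmetry turns the first variation
into `-σ/(2e²)` times the same functional's variation at `P = *𝓕`, `Q = (-1)^q *𝓖`, where `d = q +
3`. So the 2YM equations are the same Euler expressions at other arguments.

The two are linked by `** = σ (-1)^(k(d-k))` (`hodge_hodge`). It solves the algebraic equations `𝓕 +
2e² *B̄ = 0`, `𝓖 + 2e² *C̄ = 0` uniquely for `B̄, C̄`, and these are the common multiple `-σ/(2e²)`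
of `(*𝓕, (-1)^q *𝓖)`. The Euler expressions are jointly linear in `(P, Q)`, so the equations agree.
The multipliers are functions of `(A, B)`, which gives the bijection.

The groundwork has three layers. Pointwise, forms are sums of decomposable ones, and identities for
wedge and star become determinant or permutation-sign computations. In charts, wedge, `d` and star
have the expected coordinate expressions; smoothness and derivatives are tested through linear
functionals, since the Lie algebras carry no norm. Globally, a partition of unity reduces integrals
and integration by parts to `ℝᵈ`. Along `A + t δA`, `B + t δB` the integrands are polynomial in `t`,
so first variations are read off as linear coefficients. -/

noncomputable section

namespace HigherGauge

open scoped Manifold ContDiff Topology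

/-! ### Decomposable alternating forms -/

section Decomposable

variable {E F : Type*} [AddCommGroup E] [Module ℝ E] [AddCommGroup F] [Module ℝ F]
  {U V W Z : Type*} [AddCommGroup U] [Module ℝ U] [AddCommGroup V] [Module ℝ V]
  [AddCommGroup W] [Module ℝ W] [AddCommGroup Z] [Module ℝ Z]
  {ι ι' : Type*} [Fintype ι] [DecidableEq ι] [Fintype ι'] [DecidableEq ι']

/-- Evaluation of alternating forms as a linear map. -/
def evalForm {ι : Type*} (v : ι → E) : (E [⋀^ι]→ₗ[ℝ] W) →ₗ[ℝ] W where
  toFun a := a v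
  map_add' _ _ := rfl
  map_smul' _ _ := rfl

@[simp]
theorem form_sum_apply {ι J : Type*} (s : Finset J) (a : J → E [⋀^ι]→ₗ[ℝ] W) (v : ι → E) :
    (∑ j ∈ s, a j) v = ∑ j ∈ s, a j v :=
  map_sum (evalForm v) a s

theorem smulRight_form_apply {ι : Type*} (α : E [⋀^ι]→ₗ[ℝ] ℝ) (u : U) (v : ι → E) :
    α.smulRight u v = α v • u := rfl

theorem smulRight_compLinearMap {ι : Type*} (α : E [⋀^ι]→ₗ[ℝ] ℝ) (u : U) (T : F →ₗ[ℝ] E) :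
    (α.smulRight u).compLinearMap T = (α.compLinearMap T).smulRight u := rfl

/-- The form `φ₁ ∧ ⋯ ∧ φₖ` of a family of covectors. -/
def covecWedge (φ : ι → Module.Dual ℝ E) : E [⋀^ι]→ₗ[ℝ] ℝ :=
  MultilinearMap.alternatization ((MultilinearMap.mkPiAlgebra ℝ ι ℝ).compLinearMap φ)

/-- This fixes the normalization: there is no factor `1/k!`, so wedging decomposable forms just
concatenates the covectors. -/
theorem covecWedge_apply (φ : ι → Module.Dual ℝ E) (v : ι → E) :
    covecWedge φ v = (Matrix.of fun i j => φ i (v j)).det := by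
  rw [← Matrix.det_transpose, Matrix.det_apply]
  simp [covecWedge, MultilinearMap.alternatization_apply]

theorem covecWedge_comp_perm (φ : ι → Module.Dual ℝ E) (s : Equiv.Perm ι) :
    covecWedge (φ ∘ s) = ((Equiv.Perm.sign s : ℤ) : ℝ) • covecWedge φ := by
  ext v
  simp only [covecWedge_apply, AlternatingMap.smul_apply, smul_eq_mul]
  exact Matrix.det_permute s (Matrix.of fun i j => φ i (v j))

theorem covecWedge_domDomCongr (φ : ι → Module.Dual ℝ E) (s : ι ≃ ι') :
    (covecWedge φ).domDomCongr s = covecWedge (φ ∘ s.symm) := by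
  ext v
  simp only [covecWedge_apply, AlternatingMap.domDomCongr_apply]
  rw [← Matrix.det_submatrix_equiv_self s.symm]
  congr 1
  ext i j
  simp

theorem covecWedge_compLinearMap (φ : ι → Module.Dual ℝ E) (T : F →ₗ[ℝ] E) :
    (covecWedge φ).compLinearMap T = covecWedge fun i => φ i ∘ₗ T := by
  ext v
  simp [covecWedge_apply]

/-- An alternating form is the antisymmetrization of its components in a basis. -/
theorem form_eq_sum {n : Type*} [Fintype n] (b : Module.Basis n ℝ E) (a : E [⋀^ι]→ₗ[ℝ] W) :
    a = ∑ r : ι → n, (covecWedge fun i => b.coord (r i)).smulRight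
      ((Nat.factorial (Fintype.card ι) : ℝ)⁻¹ • a fun i => b (r i)) := by
  classical
  have expand : ∀ v : ι → E, a v = ∑ r : ι → n, (∏ i, b.coord (r i) (v i)) • a fun i => b (r i) := by
    intro v
    have hv : v = fun i => ∑ j, b.coord j (v i) • b j := by
      funext i
      exact (b.sum_repr (v i)).symm
    conv_lhs => rw [hv]
    rw [← AlternatingMap.coe_multilinearMap, MultilinearMap.map_sum]
    exact Finset.sum_congr rfl fun r _ => MultilinearMap.map_smul_univ _ _ _
  ext v
  -- Antisymmetrizing an alternating form multiplies it by `k!`, since every permuted term equals `a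
  -- v`. Expanding each term in the basis and exchanging the sums makes the alternatization of the
  -- coordinate product appear.
  have h1 : (Nat.factorial (Fintype.card ι) : ℝ) • a v =
      ∑ s : Equiv.Perm ι, ((Equiv.Perm.sign s : ℤ) : ℝ) • a (v ∘ s) := by
    have : ∀ s : Equiv.Perm ι, ((Equiv.Perm.sign s : ℤ) : ℝ) • a (v ∘ s) = a v := by
      intro s
      rw [a.map_perm, Units.smul_def, ← Int.cast_smul_eq_zsmul ℝ, smul_smul]
      norm_cast
      simp
    simp only [this, Finset.sum_const, Finset.card_univ, Fintype.card_perm]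
    rw [← Nat.cast_smul_eq_nsmul ℝ]
  have h2 : (Nat.factorial (Fintype.card ι) : ℝ) • a v =
      ∑ r : ι → n, (covecWedge fun i => b.coord (r i)) v • a fun i => b (r i) := by
    rw [h1]
    simp only [expand (v ∘ _), Finset.smul_sum]
    rw [Finset.sum_comm]
    refine Finset.sum_congr rfl fun r _ => ?_
    rw [covecWedge, MultilinearMap.alternatization_apply, Finset.sum_smul]
    refine Finset.sum_congr rfl fun s _ => ?_
    simp [smul_smul, Units.smul_def]
  have h0 : (Nat.factorial (Fintype.card ι) : ℝ) ≠ 0 := by positivity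
  have h3 := congrArg (fun w => (Nat.factorial (Fintype.card ι) : ℝ)⁻¹ • w) h2
  simp only [smul_smul, inv_mul_cancel₀ h0, one_smul] at h3
  rw [h3, form_sum_apply, Finset.smul_sum]
  refine Finset.sum_congr rfl fun r _ => ?_
  exact smul_comm _ _ _

/-- Induction on alternating forms, starting from decomposable ones. -/
theorem form_induction [FiniteDimensional ℝ E] {P : (E [⋀^ι]→ₗ[ℝ] W) → Prop}
    (add : ∀ a b, P a → P b → P (a + b))
    (decomposable : ∀ (φ : ι → Module.Dual ℝ E) (w : W), P ((covecWedge φ).smulRight w))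
    (a : E [⋀^ι]→ₗ[ℝ] W) : P a := by
  have h0 : P 0 := by
    convert! decomposable (fun _ => 0) 0
    ext v
    simp [AlternatingMap.smulRight]
  rw [form_eq_sum (Module.finBasis ℝ E) a]
  exact Finset.sum_induction _ P add h0 fun r _ => decomposable _ _

/-- The wedge product of alternating maps induced by a bilinear map. -/
def wedgeSum (β : U →ₗ[ℝ] V →ₗ[ℝ] W) :
    (E [⋀^ι]→ₗ[ℝ] U) →ₗ[ℝ] (E [⋀^ι']→ₗ[ℝ] V) →ₗ[ℝ] (E [⋀^ι ⊕ ι']→ₗ[ℝ] W) :=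
  (TensorProduct.mk ℝ (E [⋀^ι]→ₗ[ℝ] U) (E [⋀^ι']→ₗ[ℝ] V)).compr₂
    ((LinearMap.compAlternatingMapₗ ℝ (TensorProduct.lift β)) ∘ₗ
      AlternatingMap.domCoprod')

theorem covecWedge_smulRight (φ : ι → Module.Dual ℝ E) (u : U) : (covecWedge φ).smulRight u =
    MultilinearMap.alternatization ((LinearMap.toSpanSingleton ℝ U u).compMultilinearMap
      ((MultilinearMap.mkPiAlgebra ℝ ι ℝ).compLinearMap φ)) := by
  rw [LinearMap.compMultilinearMap_alternatization]
  rfl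

/-- Both factors are alternatizations of products of covectors, and `domCoprod` of alternatizations
is the alternatization of the plain product. No shuffle signs have to be computed. -/
theorem wedgeSum_decomposable (β : U →ₗ[ℝ] V →ₗ[ℝ] W) (φ : ι → Module.Dual ℝ E)
    (ψ : ι' → Module.Dual ℝ E) (u : U) (v : V) :
    wedgeSum β ((covecWedge φ).smulRight u) ((covecWedge ψ).smulRight v) =
      (covecWedge (Sum.elim φ ψ)).smulRight (β u v) := by
  change (TensorProduct.lift β).compAlternatingMap
    (AlternatingMap.domCoprod ((covecWedge φ).smulRight u) ((covecWedge ψ).smulRight v)) = _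
  rw [covecWedge_smulRight, covecWedge_smulRight, covecWedge_smulRight, ← MultilinearMap.domCoprod_alternization,
    ← LinearMap.compMultilinearMap_alternatization]
  congr 1
  ext w
  simp [MultilinearMap.domCoprod_apply, smul_smul, mul_comm]

end Decomposable

/-! ### The wedge product of vector-valued alternating forms -/

section WedgeAt

variable {E F : Type*} [AddCommGroup E] [Module ℝ E] [AddCommGroup F] [Module ℝ F]
  {U V W X Y Z : Type*} [AddCommGroup U] [Module ℝ U] [AddCommGroup V] [Module ℝ V]
  [AddCommGroup W] [Module ℝ W] [AddCommGroup X] [Module ℝ X] [AddCommGroup Y] [Module ℝ Y]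
  [AddCommGroup Z] [Module ℝ Z] {k l m n p : ℕ}

/-- The wedge product of vector-valued alternating forms induced by a bilinear map. -/
def wedgeAt (β : U →ₗ[ℝ] V →ₗ[ℝ] W) (h : k + l = m) :
    (E [⋀^Fin k]→ₗ[ℝ] U) →ₗ[ℝ] (E [⋀^Fin l]→ₗ[ℝ] V) →ₗ[ℝ] (E [⋀^Fin m]→ₗ[ℝ] W) :=
  (wedgeSum β).compr₂
    (AlternatingMap.domDomCongrₗ ℝ (finSumFinEquiv.trans (finCongr h))).toLinearMap

theorem wedgeAt_decomposable (β : U →ₗ[ℝ] V →ₗ[ℝ] W) (h : k + l = m)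
    (φ : Fin k → Module.Dual ℝ E) (ψ : Fin l → Module.Dual ℝ E) (u : U) (v : V) :
    wedgeAt β h ((covecWedge φ).smulRight u) ((covecWedge ψ).smulRight v) =
      (covecWedge (Sum.elim φ ψ ∘ (finSumFinEquiv.trans (finCongr h)).symm)).smulRight
        (β u v) := by
  change (wedgeSum β _ _).domDomCongr _ = _
  rw [wedgeSum_decomposable, ← covecWedge_domDomCongr]
  rfl

theorem wedgeAt_decomposable_append (β : U →ₗ[ℝ] V →ₗ[ℝ] W)
    (φ : Fin k → Module.Dual ℝ E) (ψ : Fin l → Module.Dual ℝ E) (u : U) (v : V) :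
    wedgeAt β rfl ((covecWedge φ).smulRight u) ((covecWedge ψ).smulRight v) =
      (covecWedge (Fin.append φ ψ)).smulRight (β u v) := by
  rw [wedgeAt_decomposable]
  congr 2
  funext i
  refine Fin.addCases (fun i => ?_) (fun i => ?_) i <;> simp

/-- The block swap is the `l`-th power of the cyclic rotation of `k + l` letters, so its sign is
`(-1)^((k+l-1)l)`. This agrees with `(-1)^(kl)` because `(2k + l - 1) l` is even. The case `k = l =
0` is separate, as there is no letter to rotate. -/
theorem sign_blockSwap (k l : ℕ) :
    Equiv.Perm.sign ((finAddFlip.trans (finCongr (add_comm l k)) : Equiv.Perm (Fin (k + l)))) =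
      (-1) ^ (k * l) := by
  rcases Nat.eq_zero_or_pos (k + l) with h0 | hpos
  · obtain ⟨rfl, rfl⟩ : k = 0 ∧ l = 0 := by omega
    have : (finAddFlip.trans (finCongr (add_comm 0 0)) : Equiv.Perm (Fin (0 + 0))) = 1 :=
      Equiv.ext fun i => i.elim0
    rw [this]
    simp
  have key : ∀ N, N + 1 = k + l → ∀ (j : ℕ) (i : Fin (k + l)),
      (((finRotate (k + l)) ^ j) i : ℕ) = (i + j) % (k + l) := by
    intro N hN j
    rw [← hN]
    induction j with
    | zero => intro i; simp [Nat.mod_eq_of_lt i.2]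
    | succ j ih =>
      intro i
      rw [pow_succ', Equiv.Perm.mul_apply, finRotate_apply, Fin.val_add, ih, Fin.val_one', ← Nat.add_mod,
        add_assoc]
  have : (finAddFlip.trans (finCongr (add_comm l k)) : Equiv.Perm (Fin (k + l))) =
      finRotate (k + l) ^ l := by
    ext i
    rw [key (k + l - 1) (by omega)]
    refine Fin.addCases (fun i => ?_) (fun i => ?_) i
    · have := i.2
      simp only [Equiv.trans_apply, finAddFlip_apply_castAdd, finCongr_apply, Fin.val_cast,
        Fin.val_castAdd, Fin.val_natAdd]
      rw [Nat.mod_eq_of_lt (by omega), add_comm]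
    · have := i.2
      simp only [Equiv.trans_apply, finAddFlip_apply_natAdd, finCongr_apply, Fin.val_cast,
        Fin.val_castAdd, Fin.val_natAdd]
      rw [show k + (i : ℕ) + l = i + (k + l) by omega, Nat.add_mod_right,
        Nat.mod_eq_of_lt (by omega)]
  rw [this, map_pow, sign_finRotate, ← pow_mul]
  obtain ⟨c, hc⟩ : Even ((k + l - 1) * l + k * l) := by
    rw [← add_mul]
    rcases Nat.even_or_odd l with hl | hl
    · exact hl.mul_left _
    · refine Even.mul_right ?_ _
      rw [show k + l - 1 + k = 2 * k + (l - 1) by have := hl.pos; omega]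
      exact (even_two_mul k).add (Nat.Odd.sub_odd hl odd_one)
  have h1 : ((-1 : ℤˣ) ^ ((k + l - 1) * l)) * (-1) ^ (k * l) = 1 := by
    rw [← pow_add, hc, ← two_mul, pow_mul]; simp
  rwa [mul_eq_one_iff_eq_inv, Int.units_inv_eq_self] at h1

/-- Graded commutativity of the wedge product. -/
theorem wedgeAt_comm (β : U →ₗ[ℝ] V →ₗ[ℝ] W) (h : k + l = m) (h' : l + k = m)
    (a : E [⋀^Fin k]→ₗ[ℝ] U) (b : E [⋀^Fin l]→ₗ[ℝ] V) [FiniteDimensional ℝ E] :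
    wedgeAt β h a b = (-1 : ℝ) ^ (k * l) • wedgeAt β.flip h' b a := by
  subst h
  induction a using form_induction with
  | add a a' ha ha' => simp only [map_add, LinearMap.add_apply, ha, ha', smul_add]
  | decomposable φ u =>
  induction b using form_induction with
  | add b b' hb hb' => simp only [map_add, LinearMap.add_apply, hb, hb', smul_add]
  | decomposable ψ v =>
    rw [wedgeAt_decomposable_append, wedgeAt_decomposable]
    have : Fin.append φ ψ = (Sum.elim ψ φ ∘ (finSumFinEquiv.trans (finCongr h')).symm) ∘
        (finAddFlip.trans (finCongr h') : Equiv.Perm (Fin (k + l))) := by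
      funext i
      refine Fin.addCases (fun i => ?_) (fun i => ?_) i <;> simp
    rw [this, covecWedge_comp_perm, sign_blockSwap]
    ext w
    simp [smul_smul]

/-- Associativity of the wedge product. -/
theorem wedgeAt_assoc [FiniteDimensional ℝ E] (γ : U →ₗ[ℝ] Y →ₗ[ℝ] Z) (β : V →ₗ[ℝ] W →ₗ[ℝ] Y)
    (γ' : X →ₗ[ℝ] W →ₗ[ℝ] Z) (β' : U →ₗ[ℝ] V →ₗ[ℝ] X)
    (H : ∀ u v w, γ u (β v w) = γ' (β' u v) w) {r s : ℕ} (h₁ : k + r = m) (h₂ : l + n = r)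
    (h₃ : s + n = m) (h₄ : k + l = s) (a : E [⋀^Fin k]→ₗ[ℝ] U) (b : E [⋀^Fin l]→ₗ[ℝ] V)
    (c : E [⋀^Fin n]→ₗ[ℝ] W) :
    wedgeAt γ h₁ a (wedgeAt β h₂ b c) = wedgeAt γ' h₃ (wedgeAt β' h₄ a b) c := by
  subst h₂ h₄ h₁
  induction a using form_induction with
  | add a a' ha ha' => simp only [map_add, LinearMap.add_apply, ha, ha']
  | decomposable φ u =>
  induction b using form_induction with
  | add b b' hb hb' => simp only [map_add, LinearMap.add_apply, hb, hb']
  | decomposable ψ v =>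
  induction c using form_induction with
  | add b b' hb hb' => simp only [map_add, hb, hb']
  | decomposable χ w =>
    rw [wedgeAt_decomposable_append, wedgeAt_decomposable_append, wedgeAt_decomposable_append,
      wedgeAt_decomposable, H]
    congr 2
    funext i
    -- Both covector families are the concatenation of `φ`, `ψ`, `χ`; the index bookkeeping is
    -- checked on each of the three blocks.
    refine Fin.addCases (fun i => ?_) (fun i => ?_) i
    · have : (finSumFinEquiv.trans (finCongr h₃)).symm (Fin.castAdd (l + n) i) =
          Sum.inl (Fin.castAdd l i) := by
        rw [Equiv.symm_apply_eq]; ext; simp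
      simp only [Fin.append_left, Function.comp_apply, this, Sum.elim_inl]
    · refine Fin.addCases (fun i => ?_) (fun i => ?_) i
      · have : (finSumFinEquiv.trans (finCongr h₃)).symm (Fin.natAdd k (Fin.castAdd n i)) =
            Sum.inl (Fin.natAdd k i) := by
          rw [Equiv.symm_apply_eq]; ext; simp
        simp only [Fin.append_right, Fin.append_left, Function.comp_apply, this, Sum.elim_inl]
      · have : (finSumFinEquiv.trans (finCongr h₃)).symm (Fin.natAdd k (Fin.natAdd l i)) =
            Sum.inr i := by
          rw [Equiv.symm_apply_eq]; ext; simp [add_assoc]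
        simp only [Fin.append_right, Function.comp_apply, this, Sum.elim_inr]

theorem wedgeAt_compLinearMap [FiniteDimensional ℝ E] (β : U →ₗ[ℝ] V →ₗ[ℝ] W) (h : k + l = m)
    (a : E [⋀^Fin k]→ₗ[ℝ] U) (b : E [⋀^Fin l]→ₗ[ℝ] V) (T : F →ₗ[ℝ] E) :
    (wedgeAt β h a b).compLinearMap T =
      wedgeAt β h (a.compLinearMap T) (b.compLinearMap T) := by
  induction a using form_induction with
  | add a a' ha ha' =>
    simp only [map_add, LinearMap.add_apply, ha, ha', AlternatingMap.add_compLinearMap]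
  | decomposable φ u =>
  induction b using form_induction with
  | add b b' hb hb' =>
    simp only [map_add, hb, hb', AlternatingMap.add_compLinearMap]
  | decomposable ψ v =>
    simp only [wedgeAt_decomposable, smulRight_compLinearMap, covecWedge_compLinearMap]
    congr 2
    funext i
    simp only [Function.comp_apply]
    rcases (finSumFinEquiv.trans (finCongr h)).symm i with j | j <;> rfl

theorem smulRight_map (L : V →ₗ[ℝ] W) {ι : Type*} (α : E [⋀^ι]→ₗ[ℝ] ℝ) (v : V) :
    L.compAlternatingMap (α.smulRight v) = α.smulRight (L v) := by
  ext w
  exact map_smul L _ _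

/-- The form version of an adjunction. It moves `α` across the pairing as `α*`; with `L = c • id`,
`L' = id` it also compares wedge products of proportional bilinear maps. -/
theorem wedgeAt_map_right [FiniteDimensional ℝ E] (β : U →ₗ[ℝ] V →ₗ[ℝ] W)
    (β' : X →ₗ[ℝ] Y →ₗ[ℝ] W) (L : Y →ₗ[ℝ] V) (L' : U →ₗ[ℝ] X)
    (H : ∀ u y, β u (L y) = β' (L' u) y) (h : k + l = m) (a : E [⋀^Fin k]→ₗ[ℝ] U)
    (b : E [⋀^Fin l]→ₗ[ℝ] Y) :
    wedgeAt β h a (L.compAlternatingMap b) = wedgeAt β' h (L'.compAlternatingMap a) b := by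
  induction a using form_induction with
  | add a a' ha ha' =>
    simp only [map_add, LinearMap.add_apply, ha, ha', LinearMap.compAlternatingMap_add]
  | decomposable φ u =>
  induction b using form_induction with
  | add b b' hb hb' =>
    simp only [map_add, hb, hb', LinearMap.compAlternatingMap_add]
  | decomposable ψ v =>
    simp only [wedgeAt_decomposable, smulRight_map, H]

/-- The value of `a ∧ ψ₁ ∧ ⋯ ∧ ψₗ` on vectors `u, w` such that the `ψ` vanish on the `u`. -/
theorem wedgeAt_apply_block [FiniteDimensional ℝ E] (β : U →ₗ[ℝ] V →ₗ[ℝ] W) (h : k + l = m)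
    (a : E [⋀^Fin k]→ₗ[ℝ] U) (ψ : Fin l → Module.Dual ℝ E) (v : V) (u : Fin k → E)
    (w : Fin l → E) (hψ : ∀ i j, ψ i (u j) = 0) :
    wedgeAt β h a ((covecWedge ψ).smulRight v)
      (Sum.elim u w ∘ (finSumFinEquiv.trans (finCongr h)).symm) =
      covecWedge ψ w • β (a u) v := by
  induction a using form_induction with
  | add a a' ha ha' =>
    simp only [map_add, LinearMap.add_apply, AlternatingMap.add_apply, ha, ha', smul_add]
  | decomposable φ x =>
    rw [wedgeAt_decomposable]
    change covecWedge _ _ • β x v = _ • β (covecWedge φ u • x) v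
    rw [map_smul, LinearMap.smul_apply, smul_smul]
    congr 1
    simp only [covecWedge_apply]
    -- The rows of `ψ` vanish in the columns of `u`, so the matrix is block triangular.
    rw [mul_comm, ← Matrix.det_fromBlocks_zero₂₁ _ (Matrix.of fun i j => φ i (w j)) _,
      ← Matrix.det_submatrix_equiv_self (finSumFinEquiv.trans (finCongr h)).symm]
    congr 1
    ext i j
    simp only [Matrix.of_apply, Function.comp_apply, Matrix.submatrix_apply]
    rcases (finSumFinEquiv.trans (finCongr h)).symm i with i | i <;>
    rcases (finSumFinEquiv.trans (finCongr h)).symm j with j | j <;>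
    simp [hψ]

/-- Wedge product with a covector. -/
theorem wedgeAt_covector_apply [FiniteDimensional ℝ E] (h : 1 + k = k + 1) (α : Module.Dual ℝ E)
    (a : E [⋀^Fin k]→ₗ[ℝ] W) (v : Fin (k + 1) → E) :
    wedgeAt (LinearMap.lsmul ℝ W) h (covecWedge fun _ : Fin 1 => α) a v =
      ∑ i : Fin (k + 1), ((-1 : ℝ) ^ (i : ℕ) * α (v i)) • a (i.removeNth v) := by
  induction a using form_induction with
  | add a a' ha ha' =>
    simp only [map_add, AlternatingMap.add_apply, ha, ha', smul_add, Finset.sum_add_distrib]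
  | decomposable φ x =>
    have h1 : covecWedge (fun _ : Fin 1 => α) =
        (covecWedge (fun _ : Fin 1 => α)).smulRight (1 : ℝ) := by
      ext w
      change covecWedge _ w = covecWedge _ w • (1 : ℝ)
      simp
    rw [h1, wedgeAt_decomposable]
    change covecWedge _ v • ((1 : ℝ) • x) = ∑ i : Fin (k + 1), _ • (covecWedge φ (i.removeNth v) • x)
    simp only [one_smul, smul_smul, ← Finset.sum_smul]
    congr 1
    -- Laplace expansion along the row of `α`; deleting column `i` leaves the determinant of `φ` on
    -- `i.removeNth v`.
    rw [covecWedge_apply, Matrix.det_succ_row_zero]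
    refine Finset.sum_congr rfl fun i _ => ?_
    have e0 : (finSumFinEquiv.trans (finCongr h)).symm 0 = Sum.inl 0 := by
      rw [Equiv.symm_apply_eq]; ext; simp
    have e1 : ∀ j : Fin k, (finSumFinEquiv.trans (finCongr h)).symm j.succ = Sum.inr j := by
      intro j
      rw [Equiv.symm_apply_eq]; ext; simp
    simp only [Matrix.of_apply, Function.comp_apply, e0, Sum.elim_inl, covecWedge_apply]
    congr 2
    ext r c
    simp only [Matrix.submatrix_apply, Matrix.of_apply, e1, Sum.elim_inr]
    rfl

end WedgeAt

/-! ### Forms on `ℝᵈ`: nondegeneracy of the wedge pairing and the Hodge star -/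

section Euclidean

/-- The model space `ℝᵈ`. -/
abbrev Eucl (d : ℕ) : Type := EuclideanSpace ℝ (Fin d)

/-- The standard basis of `ℝᵈ`. -/
def stdVec {d : ℕ} (i : Fin d) : Eucl d := EuclideanSpace.single i 1

/-- The dual of the standard basis of `ℝᵈ`. -/
def stdDual {d : ℕ} (i : Fin d) : Module.Dual ℝ (Eucl d) :=
  (EuclideanSpace.basisFun (Fin d) ℝ).toBasis.coord i

/-- The standard volume form of `ℝᵈ`. -/
def stdVol (d : ℕ) : Eucl d [⋀^Fin d]→ₗ[ℝ] ℝ := (EuclideanSpace.basisFun (Fin d) ℝ).toBasis.det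

variable {d k l m : ℕ} {U V W : Type*} [AddCommGroup U] [Module ℝ U] [AddCommGroup V] [Module ℝ V]
  [AddCommGroup W] [Module ℝ W]

theorem basisFun_eq_stdVec (i : Fin d) :
    (EuclideanSpace.basisFun (Fin d) ℝ).toBasis i = stdVec i := by
  simp [stdVec]

theorem stdDual_apply (i : Fin d) (v : Eucl d) : stdDual i v = v i := by
  simp [stdDual]

theorem stdDual_stdVec (i j : Fin d) : stdDual i (stdVec j) = if i = j then 1 else 0 := by
  simp [stdDual_apply, stdVec]

theorem sum_stdDual_smul (v : Eucl d) : ∑ i, stdDual i v • stdVec i = v := by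
  have := (EuclideanSpace.basisFun (Fin d) ℝ).toBasis.sum_repr v
  simp only [basisFun_eq_stdVec] at this
  exact this

theorem form_eq_sum_std {ι : Type*} [Fintype ι] [DecidableEq ι] (a : Eucl d [⋀^ι]→ₗ[ℝ] W) :
    a = ∑ r : ι → Fin d, (covecWedge fun i => stdDual (r i)).smulRight
      ((Nat.factorial (Fintype.card ι) : ℝ)⁻¹ • a fun i => stdVec (r i)) := by
  conv_lhs => rw [form_eq_sum (EuclideanSpace.basisFun (Fin d) ℝ).toBasis a]
  simp only [basisFun_eq_stdVec]
  rfl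

theorem stdVol_eq : stdVol d = covecWedge stdDual := by
  ext v
  rw [covecWedge_apply, stdVol, Module.Basis.det_apply]
  rfl

theorem stdVol_stdVec : stdVol d stdVec = 1 := by
  rw [stdVol, ← Module.Basis.det_self (EuclideanSpace.basisFun (Fin d) ℝ).toBasis]
  congr 1
  ext1 i
  exact (basisFun_eq_stdVec i).symm

/-- Both sides are determinants of Kronecker deltas, and the two matrices are transposes of each
other. -/
theorem covecWedge_std_comm {ι : Type*} [Fintype ι] [DecidableEq ι] (I J : ι → Fin d) :
    covecWedge (fun i => stdDual (I i)) (fun i => stdVec (J i)) =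
      covecWedge (fun i => stdDual (J i)) (fun i => stdVec (I i)) := by
  rw [covecWedge_apply, covecWedge_apply, ← Matrix.det_transpose]
  congr 1
  ext i j
  simp [stdDual_stdVec, eq_comm]

theorem covecWedge_std_self {ι : Type*} [Fintype ι] [DecidableEq ι] {I : ι → Fin d}
    (hI : Function.Injective I) :
    covecWedge (fun i => stdDual (I i)) (fun i => stdVec (I i)) = 1 := by
  rw [covecWedge_apply, ← Matrix.det_one (n := ι)]
  congr 1
  ext i j
  simp [stdDual_stdVec, Matrix.one_apply, hI.eq_iff]

/-- A top-degree form is determined by its value on a permutation of the standard basis. -/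
theorem topForm_ext {a b : Eucl d [⋀^Fin d]→ₗ[ℝ] W} (s : Equiv.Perm (Fin d))
    (h : a (stdVec ∘ s) = b (stdVec ∘ s)) : a = b := by
  have h1 : a stdVec = b stdVec := by
    rw [a.map_perm, b.map_perm] at h
    exact smul_left_cancel _ h
  refine (EuclideanSpace.basisFun (Fin d) ℝ).toBasis.ext_alternating fun v hv => ?_
  simp only [basisFun_eq_stdVec]
  have := (Finite.injective_iff_bijective.1 hv)
  have e : (fun i => stdVec (v i)) = stdVec ∘ (Equiv.ofBijective v this : Equiv.Perm (Fin d)) := rfl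
  rw [e, a.map_perm, b.map_perm, h1]

theorem topForm_ext_std {a b : Eucl d [⋀^Fin d]→ₗ[ℝ] W} (h : a stdVec = b stdVec) : a = b :=
  topForm_ext 1 h

/-- An injective multi-index can be completed to an enumeration of all indices. -/
theorem exists_complement (h : k + l = d) {I : Fin k → Fin d} (hI : Function.Injective I) :
    ∃ p : Fin k ⊕ Fin l ≃ Fin d, ∀ i, p (Sum.inl i) = I i := by
  classical
  have hc : Fintype.card ((Set.range I)ᶜ : Set (Fin d)) = l := by
    rw [Fintype.card_compl_set, Set.card_range_of_injective hI]
    simp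
    omega
  refine ⟨((Equiv.ofInjective I hI).sumCongr (Fintype.equivFinOfCardEq hc).symm).trans
    (Equiv.Set.sumCompl _), fun i => ?_⟩
  simp

/-- The permutation of `1, …, d` given by an enumeration `p` of the indices in two blocks. -/
def blockPerm (h : k + l = d) (p : Fin k ⊕ Fin l ≃ Fin d) : Equiv.Perm (Fin d) :=
  (finSumFinEquiv.trans (finCongr h)).symm.trans p

theorem stdVec_comp_blockPerm (h : k + l = d) (p : Fin k ⊕ Fin l ≃ Fin d) :
    stdVec ∘ blockPerm h p = Sum.elim (fun i => stdVec (p (Sum.inl i)))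
      (fun i => stdVec (p (Sum.inr i))) ∘ (finSumFinEquiv.trans (finCongr h)).symm := by
  funext i
  simp only [blockPerm, Function.comp_apply, Equiv.trans_apply]
  rcases (finSumFinEquiv.trans (finCongr h)).symm i with j | j <;> rfl

theorem stdDual_comp_blockPerm (h : k + l = d) (p : Fin k ⊕ Fin l ≃ Fin d) :
    stdDual ∘ blockPerm h p = Sum.elim (fun i => stdDual (p (Sum.inl i)))
      (fun i => stdDual (p (Sum.inr i))) ∘ (finSumFinEquiv.trans (finCongr h)).symm := by
  funext i
  simp only [blockPerm, Function.comp_apply, Equiv.trans_apply]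
  rcases (finSumFinEquiv.trans (finCongr h)).symm i with j | j <;> rfl

/-- Covectors of the complementary block vanish on the first block, so wedging with them isolates a
single component of `a`. -/
theorem wedgeAt_apply_blockPerm (γ : U →ₗ[ℝ] V →ₗ[ℝ] W) (h : k + l = d)
    (p : Fin k ⊕ Fin l ≃ Fin d) (a : Eucl d [⋀^Fin k]→ₗ[ℝ] U) (v : V) :
    wedgeAt γ h a ((covecWedge fun j => stdDual (p (Sum.inr j))).smulRight v)
      (stdVec ∘ blockPerm h p) = γ (a fun i => stdVec (p (Sum.inl i))) v := by
  rw [stdVec_comp_blockPerm, wedgeAt_apply_block, covecWedge_std_self, one_smul]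
  · exact p.injective.comp Sum.inr_injective
  · intro i j
    simp [stdDual_stdVec]

/-- The wedge pairing of forms of complementary degrees is nondegenerate. -/
theorem wedgeAt_nondegenerate (γ : U →ₗ[ℝ] V →ₗ[ℝ] W) (hγ : ∀ u, (∀ v, γ u v = 0) → u = 0)
    (h : k + l = d) (a : Eucl d [⋀^Fin k]→ₗ[ℝ] U)
    (ha : ∀ (ψ : Fin l → Module.Dual ℝ (Eucl d)) (v : V),
      wedgeAt γ h a ((covecWedge ψ).smulRight v) stdVec = 0) : a = 0 := by
  refine (EuclideanSpace.basisFun (Fin d) ℝ).toBasis.ext_alternating fun I hI => ?_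
  simp only [basisFun_eq_stdVec]
  -- Testing against the covectors complementary to `I` gives the component of `a` at `I` up to
  -- sign, and `γ` detects it.
  obtain ⟨p, hp⟩ := exists_complement h hI
  refine hγ _ fun v => ?_
  have h1 := wedgeAt_apply_blockPerm γ h p a v
  rw [AlternatingMap.map_perm, ha, smul_zero] at h1
  simp only [← hp]
  exact h1.symm

/-- The alternating form `u ↦ f(u₁, …, u_k, v₁, …, v_m)`. -/
def fixLast {E : Type*} [AddCommGroup E] [Module ℝ E] {k m n : ℕ} (h : k + m = n)
    (f : E [⋀^Fin n]→ₗ[ℝ] ℝ) (v : Fin m → E) : E [⋀^Fin k]→ₗ[ℝ] ℝ where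
  toFun u := fixFirst h f u v
  map_update_add' u i x y := by
    classical
    change f.domDomCongr _ _ = f.domDomCongr _ _ + f.domDomCongr _ _
    simp only [← Sum.update_elim_inl]
    convert AlternatingMap.map_update_add _ _ _ _ _
  map_update_smul' u i c x := by
    classical
    change f.domDomCongr _ _ = c • f.domDomCongr _ _
    simp only [← Sum.update_elim_inl]
    convert AlternatingMap.map_update_smul _ _ _ _ _
  map_eq_zero_of_eq' u i j hv hij :=
    (f.domDomCongr (finSumFinEquiv.trans (finCongr h)).symm).map_eq_zero_of_eq (Sum.elim u v) (i := Sum.inl i) (j := Sum.inl j) hv (by simpa using hij)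

theorem fixLast_apply {E : Type*} [AddCommGroup E] [Module ℝ E] {n : ℕ} (h : k + m = n)
    (f : E [⋀^Fin n]→ₗ[ℝ] ℝ) (u : Fin k → E) (v : Fin m → E) :
    fixLast h f v u = fixFirst h f u v := rfl

theorem fixFirst_apply {E : Type*} [AddCommGroup E] [Module ℝ E] {n : ℕ} (h : k + m = n)
    (f : E [⋀^Fin n]→ₗ[ℝ] ℝ) (u : Fin k → E) (v : Fin m → E) :
    fixFirst h f u v = f (Sum.elim u v ∘ (finSumFinEquiv.trans (finCongr h)).symm) := rfl

theorem sign_mul_self_real {α : Type*} [Fintype α] [DecidableEq α] (s : Equiv.Perm α) :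
    ((Equiv.Perm.sign s : ℤ) : ℝ) * ((Equiv.Perm.sign s : ℤ) : ℝ) = 1 := by
  rw [← Int.cast_mul, ← Units.val_mul, Int.units_mul_self]
  simp

/-- Reordering the factors of `dx¹ ∧ ⋯ ∧ dxᵈ` according to `p` costs the sign of `blockPerm h p`.
The evaluation is then block triangular, with identity first block. -/
theorem fixFirst_stdVol_std (h : k + m = d) (p : Fin k ⊕ Fin m ≃ Fin d) :
    fixFirst h (stdVol d) (fun i => stdVec (p (Sum.inl i))) =
      ((Equiv.Perm.sign (blockPerm h p) : ℤ) : ℝ) •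
        covecWedge fun j => stdDual (p (Sum.inr j)) := by
  ext v
  have h1 : stdVol d = ((Equiv.Perm.sign (blockPerm h p) : ℤ) : ℝ) •
      covecWedge (stdDual ∘ blockPerm h p) := by
    rw [covecWedge_comp_perm, smul_smul, sign_mul_self_real, one_smul, stdVol_eq]
  have h2 := wedgeAt_apply_block (LinearMap.lsmul ℝ ℝ) h
    ((covecWedge fun i => stdDual (p (Sum.inl i))).smulRight (1 : ℝ))
    (fun j => stdDual (p (Sum.inr j))) (1 : ℝ) (fun i => stdVec (p (Sum.inl i))) v
    (fun i j => by simp [stdDual_stdVec])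
  rw [wedgeAt_decomposable] at h2
  rw [smulRight_form_apply, smulRight_form_apply, covecWedge_std_self (I := fun i => p (Sum.inl i))
    (p.injective.comp Sum.inl_injective)] at h2
  simp only [LinearMap.lsmul_apply, smul_eq_mul, mul_one] at h2
  rw [fixFirst_apply, h1, stdDual_comp_blockPerm, AlternatingMap.smul_apply, h2,
    AlternatingMap.smul_apply]

/-- If `I` is injective, complete it to an enumeration of all indices and evaluate on the reordered
basis: the same permutation sign appears on both sides. If `I` repeats an index, both sides vanish.
-/
theorem wedgeAt_fixFirst (γ : U →ₗ[ℝ] V →ₗ[ℝ] W) (h : k + m = d) (a : Eucl d [⋀^Fin k]→ₗ[ℝ] U)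
    (I : Fin k → Fin d) (v : V) :
    wedgeAt γ h a ((fixFirst h (stdVol d) fun i => stdVec (I i)).smulRight v) =
      (stdVol d).smulRight (γ (a fun i => stdVec (I i)) v) := by
  by_cases hI : Function.Injective I
  · obtain ⟨p, hp⟩ := exists_complement h hI
    simp only [← hp]
    rw [fixFirst_stdVol_std]
    refine topForm_ext (blockPerm h p) ?_
    have h1 := wedgeAt_apply_blockPerm γ h p a v
    have h2 : ∀ (c : ℝ) (f : Eucl d [⋀^Fin m]→ₗ[ℝ] ℝ),
        (c • f).smulRight v = c • f.smulRight v := by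
      intro c f
      ext w
      exact mul_smul c (f w) v
    rw [h2, map_smul, AlternatingMap.smul_apply, h1]
    rw [smulRight_form_apply, AlternatingMap.map_perm, stdVol_stdVec, Units.smul_def, zsmul_eq_mul, mul_one]
  · have h0 : ¬ Function.Injective (fun i => (stdVec (I i) : Eucl d)) := by
      intro h'
      exact hI (Function.Injective.of_comp (f := stdVec) h')
    have h1 : fixFirst h (stdVol d) (fun i => stdVec (I i)) = 0 := by
      ext v
      exact (fixLast h (stdVol d) v).map_eq_zero_of_not_injective _ h0
    rw [h1, a.map_eq_zero_of_not_injective _ h0]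
    have h2 : (0 : Eucl d [⋀^Fin m]→ₗ[ℝ] ℝ).smulRight v = 0 := by
      ext w
      exact zero_smul ℝ v
    rw [h2]
    ext w
    simp [AlternatingMap.smulRight]

end Euclidean

/-! ### The Hodge star on `ℝᵈ`: change of frame, symmetry, and its square. -/

section HodgeAt

variable {d k l m : ℕ} {U V W : Type*} [AddCommGroup U] [Module ℝ U] [AddCommGroup V] [Module ℝ V]
  [AddCommGroup W] [Module ℝ W]

theorem smul_smulRight {E ι : Type*} [AddCommGroup E] [Module ℝ E] (c : ℝ) (α : E [⋀^ι]→ₗ[ℝ] ℝ)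
    (w : W) : (c • α).smulRight w = c • α.smulRight w := by
  ext v
  exact mul_smul _ _ _

theorem smulRight_smul {E ι : Type*} [AddCommGroup E] [Module ℝ E] (c : ℝ) (α : E [⋀^ι]→ₗ[ℝ] ℝ)
    (w : W) : α.smulRight (c • w) = c • α.smulRight w := by
  ext v
  exact smul_comm _ _ _

theorem fixFirst_smul {E : Type*} [AddCommGroup E] [Module ℝ E] {n : ℕ} (h : k + m = n) (c : ℝ)
    (f : E [⋀^Fin n]→ₗ[ℝ] ℝ) (u : Fin k → E) : fixFirst h (c • f) u = c • fixFirst h f u := rfl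

/-- The contraction of a form `a` with the first indices of `ν`, the indices being raised by `Γ`,
in the frame `b`. -/
def contractForm (h : k + m = d) (Γ : Matrix (Fin d) (Fin d) ℝ) (b : Fin d → Eucl d)
    (ν : Eucl d [⋀^Fin d]→ₗ[ℝ] ℝ) (a : Eucl d [⋀^Fin k]→ₗ[ℝ] W) : Eucl d [⋀^Fin m]→ₗ[ℝ] W :=
  ∑ i : Fin k → Fin d, ∑ j : Fin k → Fin d,
    (∏ r, Γ (i r) (j r)) • (fixFirst h ν fun r => b (j r)).smulRight (a fun r => b (i r))

theorem contractForm_smul (h : k + m = d) (c : ℝ) (Γ : Matrix (Fin d) (Fin d) ℝ)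
    (b : Fin d → Eucl d) (ν : Eucl d [⋀^Fin d]→ₗ[ℝ] ℝ) (a : Eucl d [⋀^Fin k]→ₗ[ℝ] W) :
    contractForm h Γ b (c • ν) a = c • contractForm h Γ b ν a := by
  rw [contractForm, contractForm, Finset.smul_sum]
  refine Finset.sum_congr rfl fun i _ => ?_
  rw [Finset.smul_sum]
  refine Finset.sum_congr rfl fun j _ => ?_
  rw [fixFirst_smul, smul_smulRight, smul_comm]

/-- The Hodge star on `ℝᵈ` for the metric with Gram matrix `G`. -/
def hodgeAt (G : Matrix (Fin d) (Fin d) ℝ) (h : k + m = d) :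
    (Eucl d [⋀^Fin k]→ₗ[ℝ] W) →ₗ[ℝ] (Eucl d [⋀^Fin m]→ₗ[ℝ] W) where
  toFun a := (Nat.factorial k : ℝ)⁻¹ • contractForm h G⁻¹ stdVec (√|G.det| • stdVol d) a
  map_add' a b := by
    ext v
    simp [contractForm, form_sum_apply, smul_add, Finset.sum_add_distrib]
  map_smul' c a := by
    ext v
    simp only [contractForm, form_sum_apply, smulRight_form_apply, AlternatingMap.smul_apply,
      RingHom.id_apply]
    rw [smul_comm c, Finset.smul_sum (r := c)]
    congr 1
    refine Finset.sum_congr rfl fun i _ => ?_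
    rw [Finset.smul_sum (r := c)]
    refine Finset.sum_congr rfl fun j _ => ?_
    rw [smul_comm _ c, smul_comm _ c]

theorem hodgeAt_apply (G : Matrix (Fin d) (Fin d) ℝ) (h : k + m = d)
    (a : Eucl d [⋀^Fin k]→ₗ[ℝ] W) : hodgeAt G h a =
      (Nat.factorial k : ℝ)⁻¹ • contractForm h G⁻¹ stdVec (√|G.det| • stdVol d) a := rfl

theorem form_apply_sum_smul {E ι n : Type*} [AddCommGroup E] [Module ℝ E] [Fintype ι]
    [DecidableEq ι] [Fintype n] (a : E [⋀^ι]→ₗ[ℝ] W) (P : n → n → ℝ) (b : n → E) (i : ι → n) :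
    (a fun r => ∑ l, P l (i r) • b l) = ∑ s : ι → n, (∏ r, P (s r) (i r)) • a fun r => b (s r) := by
  rw [← AlternatingMap.coe_multilinearMap, MultilinearMap.map_sum]
  exact Finset.sum_congr rfl fun r _ => MultilinearMap.map_smul_univ _ _ _

/-- Contraction does not depend on the frame. -/
theorem contractForm_frame (h : k + m = d) (Γ Γ' P : Matrix (Fin d) (Fin d) ℝ)
    (hΓ : P * Γ' * P.transpose = Γ) (b b' : Fin d → Eucl d) (hb : ∀ j, b' j = ∑ l, P l j • b l)
    (ν : Eucl d [⋀^Fin d]→ₗ[ℝ] ℝ) (a : Eucl d [⋀^Fin k]→ₗ[ℝ] W) :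
    contractForm h Γ' b' ν a = contractForm h Γ b ν a := by
  ext v
  simp only [contractForm, form_sum_apply, AlternatingMap.smul_apply, smulRight_form_apply,
    ← fixLast_apply]
  have e1 : ∀ i : Fin k → Fin d, (fun r => b' (i r)) = fun r => ∑ l, P l (i r) • b l :=
    fun i => funext fun r => hb _
  have e4 : ∀ i j : Fin k → Fin d, (∏ r, Γ' (i r) (j r)) •
      (fixLast h ν v fun r => b' (j r)) • (a fun r => b' (i r)) =
      ∑ s : Fin k → Fin d, ∑ t : Fin k → Fin d,
        ((∏ r, P (s r) (i r)) * (∏ r, Γ' (i r) (j r)) * (∏ r, P (t r) (j r))) •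
          (fixLast h ν v fun r => b (t r)) • a fun r => b (s r) := by
    intro i j
    rw [e1, e1, form_apply_sum_smul (fixLast h ν v) P b j, form_apply_sum_smul a P b i,
      Finset.smul_sum, Finset.smul_sum]
    refine Finset.sum_congr rfl fun s _ => ?_
    rw [Finset.sum_smul, Finset.smul_sum]
    refine Finset.sum_congr rfl fun t _ => ?_
    simp only [smul_smul, smul_eq_mul]
    congr 1
    ring
  -- A product over the slots `r` of entries of `P Γ' Pᵀ`, multiplied out, is a sum over pairs of
  -- multi-indices. Its terms are the coefficients produced by expanding the frame `b'` in `e4`.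
  have e2 : ∀ s t : Fin k → Fin d, ∏ r, Γ (s r) (t r) =
      ∑ i : Fin k → Fin d, ∑ j : Fin k → Fin d,
        (∏ r, P (s r) (i r)) * (∏ r, Γ' (i r) (j r)) * (∏ r, P (t r) (j r)) := by
    intro s t
    have : ∀ r, Γ (s r) (t r) =
        ∑ x : Fin d × Fin d, P (s r) x.1 * Γ' x.1 x.2 * P (t r) x.2 := by
      intro r
      rw [← hΓ, Matrix.mul_apply, Fintype.sum_prod_type_right]
      refine Finset.sum_congr rfl fun j _ => ?_
      rw [Matrix.mul_apply, Finset.sum_mul]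
      rfl
    simp only [this]
    rw [Finset.prod_univ_sum, Fintype.piFinset_univ,
      ← (Equiv.arrowProdEquivProdArrow (Fin k) (fun _ => Fin d) (fun _ => Fin d)).symm.sum_comp,
      Fintype.sum_prod_type]
    simp [Equiv.arrowProdEquivProdArrow, Finset.prod_mul_distrib]
  simp only [e4, e2, Finset.sum_smul]
  calc _ = ∑ i : Fin k → Fin d, ∑ s : Fin k → Fin d, ∑ j : Fin k → Fin d, ∑ t : Fin k → Fin d, _ :=
        Finset.sum_congr rfl fun _ _ => Finset.sum_comm
    _ = ∑ s : Fin k → Fin d, ∑ i : Fin k → Fin d, ∑ j : Fin k → Fin d, ∑ t : Fin k → Fin d, _ :=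
        Finset.sum_comm
    _ = ∑ s : Fin k → Fin d, ∑ i : Fin k → Fin d, ∑ t : Fin k → Fin d, ∑ j : Fin k → Fin d, _ :=
        Finset.sum_congr rfl fun _ _ => Finset.sum_congr rfl fun _ _ => Finset.sum_comm
    _ = _ := Finset.sum_congr rfl fun _ _ => Finset.sum_comm

theorem contractForm_compLinearMap (h : k + m = d) (Γ : Matrix (Fin d) (Fin d) ℝ)
    (b : Fin d → Eucl d) (T : Eucl d →ₗ[ℝ] Eucl d)
    (ν : Eucl d [⋀^Fin d]→ₗ[ℝ] ℝ) (a : Eucl d [⋀^Fin k]→ₗ[ℝ] W) :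
    (contractForm h Γ (fun j => T (b j)) ν a).compLinearMap T =
      contractForm h Γ b (ν.compLinearMap T) (a.compLinearMap T) := by
  ext v
  simp only [contractForm, form_sum_apply, AlternatingMap.compLinearMap_apply,
    AlternatingMap.smul_apply, smulRight_form_apply]
  refine Finset.sum_congr rfl fun i _ => Finset.sum_congr rfl fun j _ => ?_
  congr 2
  simp only [fixFirst_apply, AlternatingMap.compLinearMap_apply]
  congr 1
  funext r
  simp only [Function.comp_apply]
  rcases (finSumFinEquiv.trans (finCongr h)).symm r with s | s <;> rfl

theorem stdVol_compLinearMap (P : Matrix (Fin d) (Fin d) ℝ) (T : Eucl d →ₗ[ℝ] Eucl d)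
    (hT : ∀ j, T (stdVec j) = ∑ l, P l j • stdVec l) :
    (stdVol d).compLinearMap T = P.det • stdVol d := by
  apply topForm_ext_std
  rw [AlternatingMap.smul_apply, stdVol_stdVec, stdVol_eq, AlternatingMap.compLinearMap_apply,
    covecWedge_apply, smul_eq_mul, mul_one]
  congr 1
  ext i j
  simp [hT, stdDual_stdVec]

/-- The transformation law of the Hodge star. -/
theorem hodgeAt_compLinearMap (G P : Matrix (Fin d) (Fin d) ℝ) (hP : P.det ≠ 0)
    (T : Eucl d →ₗ[ℝ] Eucl d) (hT : ∀ j, T (stdVec j) = ∑ l, P l j • stdVec l) (h : k + m = d)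
    (a : Eucl d [⋀^Fin k]→ₗ[ℝ] W) :
    P.det • hodgeAt (P.transpose * G * P) h (a.compLinearMap T) =
      |P.det| • (hodgeAt G h a).compLinearMap T := by
  have hPu : IsUnit P.det := hP.isUnit
  -- The inverse metric transforms so that the contraction is the same in the frames `stdVec` and `T
  -- ∘ stdVec`.
  have hΓ : P * (P.transpose * G * P)⁻¹ * P.transpose = G⁻¹ := by
    rw [Matrix.mul_inv_rev, Matrix.mul_inv_rev, ← Matrix.mul_assoc, Matrix.mul_nonsing_inv _ hPu,
      Matrix.one_mul, Matrix.mul_assoc, ← Matrix.transpose_nonsing_inv, ← Matrix.transpose_mul,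
      Matrix.mul_nonsing_inv _ hPu, Matrix.transpose_one, Matrix.mul_one]
  -- The density contributes `|det P|` while `dx¹ ∧ ⋯ ∧ dxᵈ` pulls back with `det P`. The star
  -- therefore commutes with the pullback exactly up to the sign of `det P`.
  have hs : √|(P.transpose * G * P).det| = |P.det| * √|G.det| := by
    rw [Matrix.det_mul, Matrix.det_mul, Matrix.det_transpose, mul_right_comm, abs_mul,
      Real.sqrt_mul (abs_nonneg _), abs_mul, Real.sqrt_mul_self (abs_nonneg _)]
  have h1 := contractForm_compLinearMap h (P.transpose * G * P)⁻¹ stdVec T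
    (√|G.det| • stdVol d) a
  rw [contractForm_frame h G⁻¹ _ P hΓ stdVec _ hT] at h1
  have h3 : ∀ (c : ℝ) (b : Eucl d [⋀^Fin m]→ₗ[ℝ] W),
      (c • b).compLinearMap T = c • b.compLinearMap T := fun _ _ => rfl
  rw [hodgeAt_apply G, h3, h1]
  have h4 : (√|G.det| • stdVol d).compLinearMap T = √|G.det| • P.det • stdVol d := by
    rw [← stdVol_compLinearMap P T hT]
    rfl
  rw [h4]
  rw [hodgeAt_apply, hs]
  simp only [contractForm_smul, smul_smul]
  congr 1
  ring

/-- Each contraction of the volume form, wedged with `a`, returns a component of `a` times the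
volume (`wedgeAt_fixFirst`). The result is the metric inner product of `a` and `b`, whose symmetry
is visible. -/
theorem wedgeAt_hodgeAt (γ : U →ₗ[ℝ] V →ₗ[ℝ] W) (G : Matrix (Fin d) (Fin d) ℝ) (h : k + m = d)
    (a : Eucl d [⋀^Fin k]→ₗ[ℝ] U) (b : Eucl d [⋀^Fin k]→ₗ[ℝ] V) :
    wedgeAt γ h a (hodgeAt G h b) = (Nat.factorial k : ℝ)⁻¹ • √|G.det| •
      ∑ i : Fin k → Fin d, ∑ j : Fin k → Fin d, (∏ r, G⁻¹ (i r) (j r)) •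
        (stdVol d).smulRight (γ (a fun r => stdVec (j r)) (b fun r => stdVec (i r))) := by
  rw [hodgeAt_apply, contractForm_smul, map_smul, map_smul, contractForm, map_sum]
  congr 2
  refine Finset.sum_congr rfl fun i _ => ?_
  rw [map_sum]
  refine Finset.sum_congr rfl fun j _ => ?_
  rw [map_smul, wedgeAt_fixFirst]

/-- The pairing `⟨a, *b⟩` is symmetric. -/
theorem wedgeAt_hodgeAt_symm (γ : U →ₗ[ℝ] V →ₗ[ℝ] W) (G : Matrix (Fin d) (Fin d) ℝ)
    (hG : G.transpose = G) (h : k + m = d) (a : Eucl d [⋀^Fin k]→ₗ[ℝ] U)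
    (b : Eucl d [⋀^Fin k]→ₗ[ℝ] V) :
    wedgeAt γ h a (hodgeAt G h b) = wedgeAt γ.flip h b (hodgeAt G h a) := by
  rw [wedgeAt_hodgeAt, wedgeAt_hodgeAt, Finset.sum_comm]
  have : ∀ i j, G⁻¹ i j = G⁻¹ j i := by
    intro i j
    conv_lhs => rw [← hG, ← Matrix.transpose_nonsing_inv]
    rfl
  simp only [this (_ : Fin d), LinearMap.flip_apply]

/-- The diagonal matrix `diag(σ, 1, …, 1)`. -/
def signatureMatrix (d : ℕ) (σ : ℝ) : Matrix (Fin d) (Fin d) ℝ :=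
  Matrix.diagonal fun i => if (i : ℕ) = 0 then σ else 1

theorem prod_signature {σ : ℝ} (hd : 0 < d) :
    ∏ i : Fin d, (if (i : ℕ) = 0 then σ else 1) = σ := by
  have : ∀ i : Fin d, (i : ℕ) = 0 ↔ i = ⟨0, hd⟩ := fun i => by rw [Fin.ext_iff]
  simp [this]

theorem det_signatureMatrix {σ : ℝ} (hd : 0 < d) : (signatureMatrix d σ).det = σ := by
  rw [signatureMatrix, Matrix.det_diagonal, prod_signature hd]

theorem inv_signatureMatrix {σ : ℝ} (hσ : σ = 1 ∨ σ = -1) :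
    (signatureMatrix d σ)⁻¹ = signatureMatrix d σ := by
  refine Matrix.inv_eq_right_inv ?_
  rw [signatureMatrix, Matrix.diagonal_mul_diagonal, ← Matrix.diagonal_one]
  congr 1
  funext i
  rcases hσ with rfl | rfl <;> split_ifs <;> simp

/-- In an orthonormal frame the star sends `dxᴵ` to plus or minus the product over the complementary
indices. One sign comes from the metric, the other from the ordering of the two blocks. -/
theorem hodgeAt_signature_std {σ : ℝ} (hσ : σ = 1 ∨ σ = -1) (hd : 0 < d) (h : k + m = d)
    (p : Fin k ⊕ Fin m ≃ Fin d) (w : W) :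
    hodgeAt (signatureMatrix d σ) h
      ((covecWedge fun i => stdDual (p (Sum.inl i))).smulRight w) =
      ((∏ i, if (p (Sum.inl i) : ℕ) = 0 then σ else 1) *
        ((Equiv.Perm.sign (blockPerm h p) : ℤ) : ℝ)) •
        (covecWedge fun i => stdDual (p (Sum.inr i))).smulRight w := by
  have hs : √|(signatureMatrix d σ).det| = 1 := by
    rw [det_signatureMatrix hd]
    rcases hσ with rfl | rfl <;> simp
  rw [hodgeAt_apply, hs, one_smul, inv_signatureMatrix hσ]
  ext v
  have h1 : ∀ i j : Fin k → Fin d, ∏ r, signatureMatrix d σ (i r) (j r) =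
      if i = j then ∏ r, (if (i r : ℕ) = 0 then σ else 1) else 0 := by
    intro i j
    simp only [signatureMatrix, Matrix.diagonal_apply, Finset.prod_ite_zero, funext_iff,
      Finset.mem_univ, true_imp_iff]
  -- `T` raises indices. The `1/k!`-weighted sum over `i` is the basis expansion of the `k`-form `u
  -- ↦ vol(T u, v)` evaluated at the vectors of the first block, so it collapses to one value.
  let T : Eucl d →ₗ[ℝ] Eucl d := (EuclideanSpace.basisFun (Fin d) ℝ).toBasis.constr ℝ
    fun i => (if (i : ℕ) = 0 then σ else 1) • stdVec i
  have hT : ∀ i, T (stdVec i) = (if (i : ℕ) = 0 then σ else 1) • stdVec i := by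
    intro i
    rw [← basisFun_eq_stdVec, Module.Basis.constr_basis, basisFun_eq_stdVec]
  have h2 : ∀ i : Fin k → Fin d, ((fixLast h (stdVol d) v).compLinearMap T) (fun r => stdVec (i r)) =
      (∏ r, (if (i r : ℕ) = 0 then σ else 1)) *
        fixFirst h (stdVol d) (fun r => stdVec (i r)) v := by
    intro i
    rw [AlternatingMap.compLinearMap_apply]
    simp only [hT]
    rw [AlternatingMap.map_smul_univ]
    rfl
  have h3 := congrArg (fun f => f fun r => stdVec (p (Sum.inl r)))
    (form_eq_sum_std ((fixLast h (stdVol d) v).compLinearMap T))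
  simp only [form_sum_apply, smulRight_form_apply, Fintype.card_fin, h2] at h3
  simp only [contractForm, AlternatingMap.smul_apply, form_sum_apply, smulRight_form_apply, h1,
    ite_smul, zero_smul, Finset.sum_ite_eq, Finset.mem_univ, if_true]
  rw [fixFirst_stdVol_std, AlternatingMap.smul_apply, smul_eq_mul, ← mul_assoc] at h3
  rw [smul_smul _ _ w, h3, Finset.sum_smul, Finset.smul_sum]
  refine Finset.sum_congr rfl fun i _ => ?_
  rw [covecWedge_std_comm i]
  simp only [smul_smul, smul_eq_mul]
  congr 1
  ring

/-- It suffices to treat `dxᴵ` with distinct indices. The metric signs of the two blocks multiply to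
`σ`, since the index `0` lies in exactly one of them. The two ordering signs differ by the block
swap `(-1)^(km)`. -/
theorem hodgeAt_hodgeAt_signature {σ : ℝ} (hσ : σ = 1 ∨ σ = -1) (hd : 0 < d) (h : k + m = d)
    (h' : m + k = d) (a : Eucl d [⋀^Fin k]→ₗ[ℝ] W) :
    hodgeAt (signatureMatrix d σ) h' (hodgeAt (signatureMatrix d σ) h a) =
      (σ * (-1) ^ (k * m)) • a := by
  rw [form_eq_sum_std a, map_sum, map_sum, Finset.smul_sum]
  refine Finset.sum_congr rfl fun I _ => ?_
  generalize (Nat.factorial (Fintype.card (Fin k)) : ℝ)⁻¹ • (a fun i => stdVec (I i)) = w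
  by_cases hI : Function.Injective I
  · obtain ⟨p, hp⟩ := exists_complement h hI
    simp only [← hp]
    have h1 := hodgeAt_signature_std hσ hd h' ((Equiv.sumComm (Fin m) (Fin k)).trans p) w
    simp only [Equiv.trans_apply, Equiv.sumComm_apply, Sum.swap_inl, Sum.swap_inr] at h1
    rw [hodgeAt_signature_std hσ hd h p, map_smul, h1, smul_smul]
    congr 1
    have h2 : (∏ i, if (p (Sum.inl i) : ℕ) = 0 then σ else 1) *
        (∏ i, if (p (Sum.inr i) : ℕ) = 0 then σ else 1) = σ := by
      rw [← Fintype.prod_sum_type (fun x => if (p x : ℕ) = 0 then σ else 1),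
        p.prod_comp (fun x => if (x : ℕ) = 0 then σ else 1), prod_signature hd]
    have h3 : Equiv.Perm.sign (blockPerm h' ((Equiv.sumComm (Fin m) (Fin k)).trans p)) =
        Equiv.Perm.sign (blockPerm h p) * (-1) ^ (k * m) := by
      subst h'
      rw [mul_comm k m, ← sign_blockSwap m k, ← Equiv.Perm.sign_mul]
      congr 1
      ext i
      refine Fin.addCases (fun i => ?_) (fun i => ?_) i <;> simp [blockPerm]
    have h4 := sign_mul_self_real (blockPerm h p)
    rw [h3]
    push_cast
    linear_combination (σ * (-1) ^ (k * m)) * h4 + (-1) ^ (k * m) *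
      ((Equiv.Perm.sign (blockPerm h p) : ℤ) : ℝ) * ((Equiv.Perm.sign (blockPerm h p) : ℤ) : ℝ) * h2
  · have h0 : covecWedge (fun i => stdDual (I i)) = 0 := by
      simp only [Function.Injective, not_forall] at hI
      obtain ⟨i, j, hij, hne⟩ := hI
      ext v
      rw [covecWedge_apply]
      exact Matrix.det_zero_of_row_eq hne (by ext c; simp [hij])
    have h1 : (covecWedge fun i => stdDual (I i)).smulRight w = 0 := by
      rw [h0]
      ext v
      exact zero_smul ℝ w
    rw [h1]
    simp

/-- The Hodge star is an involution up to sign. -/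
theorem hodgeAt_hodgeAt {σ : ℝ} (hσ : σ = 1 ∨ σ = -1) (hd : 0 < d) (h : k + m = d)
    (h' : m + k = d) (G P : Matrix (Fin d) (Fin d) ℝ) (hP : P.det ≠ 0)
    (hG : P.transpose * G * P = signatureMatrix d σ) (a : Eucl d [⋀^Fin k]→ₗ[ℝ] W) :
    hodgeAt G h' (hodgeAt G h a) = (σ * (-1) ^ (k * m)) • a := by
  let b := (EuclideanSpace.basisFun (Fin d) ℝ).toBasis
  let T : Eucl d →ₗ[ℝ] Eucl d := Matrix.toLin b b P
  have hT : ∀ j, T (stdVec j) = ∑ l, P l j • stdVec l := by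
    intro j
    have := Matrix.toLin_self b b P j
    simpa only [b, basisFun_eq_stdVec] using this
  have hsurj : Function.Surjective T := by
    intro x
    refine ⟨Matrix.toLin b b P⁻¹ x, ?_⟩
    rw [← LinearMap.comp_apply, ← Matrix.toLin_mul, Matrix.mul_nonsing_inv _ hP.isUnit,
      Matrix.toLin_one, LinearMap.id_apply]
  have h1 := hodgeAt_compLinearMap G P hP T hT h a
  have h2 := hodgeAt_compLinearMap G P hP T hT h' (hodgeAt G h a)
  rw [hG] at h1 h2
  apply AlternatingMap.compLinearMap_injective T hsurj
  -- Two applications of the transformation law produce `(det P)² = |det P|²`, so the orthonormal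
  -- frame need not be positively oriented.
  have h3 : (|P.det| * |P.det|) • (hodgeAt G h' (hodgeAt G h a)).compLinearMap T =
      (|P.det| * |P.det|) • ((σ * (-1) ^ (k * m)) • a).compLinearMap T := by
    rw [← smul_smul, ← h2, smul_comm, ← map_smul, ← h1, map_smul, hodgeAt_hodgeAt_signature hσ hd,
      smul_smul, abs_mul_abs_self]
    rfl
  have h0 : |P.det| * |P.det| ≠ 0 := by simpa using hP
  exact smul_right_injective _ h0 h3

end HodgeAt

/-! ### Weakly smooth functions with values in a real vector space -/

section WeaklySmooth

variable {d k l m : ℕ} {U V W : Type*} [AddCommGroup U] [Module ℝ U] [AddCommGroup V] [Module ℝ V]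
  [AddCommGroup W] [Module ℝ W] {s : Set (Eucl d)}

/-- All linear functionals of `f` are smooth on `s`. -/
def WSmoothOn (f : Eucl d → W) (s : Set (Eucl d)) : Prop :=
  ∀ φ : Module.Dual ℝ W, ContDiffOn ℝ ∞ (fun y => φ (f y)) s

theorem WSmoothOn.congr {f g : Eucl d → W} (hf : WSmoothOn f s) (h : ∀ y ∈ s, g y = f y) :
    WSmoothOn g s := fun φ => (hf φ).congr fun y hy => by rw [h y hy]

theorem WSmoothOn.map {f : Eucl d → U} (hf : WSmoothOn f s) (L : U →ₗ[ℝ] W) :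
    WSmoothOn (fun y => L (f y)) s := fun φ => hf (φ ∘ₗ L)

theorem WSmoothOn.add {f g : Eucl d → W} (hf : WSmoothOn f s) (hg : WSmoothOn g s) :
    WSmoothOn (fun y => f y + g y) s := fun φ => by
  simp only [map_add]
  exact (hf φ).add (hg φ)

theorem wsmoothOn_const (w : W) : WSmoothOn (fun _ => w) s := fun _ => contDiffOn_const

theorem WSmoothOn.sum {J : Type*} (t : Finset J) {f : J → Eucl d → W}
    (hf : ∀ j ∈ t, WSmoothOn (f j) s) : WSmoothOn (fun y => ∑ j ∈ t, f j y) s := fun φ => by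
  simp only [map_sum]
  exact ContDiffOn.sum fun j hj => hf j hj φ

theorem WSmoothOn.smul {c : Eucl d → ℝ} {f : Eucl d → W} (hc : ContDiffOn ℝ ∞ c s)
    (hf : WSmoothOn f s) : WSmoothOn (fun y => c y • f y) s := fun φ => by
  simp only [map_smul, smul_eq_mul]
  exact hc.mul (hf φ)

theorem WSmoothOn.const_smul {f : Eucl d → W} (c : ℝ) (hf : WSmoothOn f s) :
    WSmoothOn (fun y => c • f y) s := hf.smul contDiffOn_const

theorem wsmoothOn_real {f : Eucl d → ℝ} : WSmoothOn f s ↔ ContDiffOn ℝ ∞ f s := by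
  refine ⟨fun h => h LinearMap.id, fun h φ => ?_⟩
  have : ∀ y, φ (f y) = f y * φ 1 := fun y => by
    rw [← smul_eq_mul, ← map_smul, smul_eq_mul, mul_one]
  simp only [this]
  exact h.mul contDiffOn_const

theorem bilin_eq_sum [FiniteDimensional ℝ U] [FiniteDimensional ℝ V] (β : U →ₗ[ℝ] V →ₗ[ℝ] W)
    (u : U) (v : V) : β u v = ∑ i, ∑ j, ((Module.finBasis ℝ U).coord i u *
      (Module.finBasis ℝ V).coord j v) • β (Module.finBasis ℝ U i) (Module.finBasis ℝ V j) := by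
  conv_lhs => rw [← (Module.finBasis ℝ U).sum_repr u, ← (Module.finBasis ℝ V).sum_repr v]
  simp only [map_sum, LinearMap.sum_apply, map_smul, LinearMap.smul_apply,
    Module.Basis.coord_apply]
  rw [Finset.sum_comm]
  refine Finset.sum_congr rfl fun i _ => ?_
  rw [Finset.smul_sum]
  refine Finset.sum_congr rfl fun j _ => ?_
  rw [smul_smul, mul_comm]

theorem WSmoothOn.bilin [FiniteDimensional ℝ U] [FiniteDimensional ℝ V] (β : U →ₗ[ℝ] V →ₗ[ℝ] W)
    {f : Eucl d → U} {g : Eucl d → V} (hf : WSmoothOn f s) (hg : WSmoothOn g s) :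
    WSmoothOn (fun y => β (f y) (g y)) s := by
  refine WSmoothOn.congr ?_ fun y _ => bilin_eq_sum β (f y) (g y)
  exact WSmoothOn.sum _ fun i _ => WSmoothOn.sum _ fun j _ =>
    (wsmoothOn_const _).smul ((hf _).mul (hg _))

instance formFiniteDimensional [FiniteDimensional ℝ W] :
    FiniteDimensional ℝ (Eucl d [⋀^Fin k]→ₗ[ℝ] W) :=
  Module.Finite.of_injective
    (AlternatingMap.toMultilinearMapLM (S := ℝ) :
      (Eucl d [⋀^Fin k]→ₗ[ℝ] W) →ₗ[ℝ] MultilinearMap ℝ (fun _ : Fin k => Eucl d) W)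
    AlternatingMap.coe_multilinearMap_injective

/-- The linear map `w ↦ α ⊗ w`. -/
def smulRightₗ {E ι : Type*} [AddCommGroup E] [Module ℝ E] (α : E [⋀^ι]→ₗ[ℝ] ℝ) :
    W →ₗ[ℝ] (E [⋀^ι]→ₗ[ℝ] W) where
  toFun w := α.smulRight w
  map_add' w w' := by
    ext v
    exact smul_add _ _ _
  map_smul' c w := smulRight_smul c α w

/-- A form is a fixed finite linear expression in its components on standard vectors. This links the
componentwise `IsSmoothForm` to smoothness of a map into the space of forms. -/
theorem wsmoothOn_form_iff {Θ : Eucl d → Eucl d [⋀^Fin k]→ₗ[ℝ] W} :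
    WSmoothOn Θ s ↔ ∀ v, WSmoothOn (fun y => Θ y v) s := by
  refine ⟨fun h v => h.map (evalForm v), fun h => ?_⟩
  refine WSmoothOn.congr (f := fun y => ∑ r : Fin k → Fin d,
    smulRightₗ (covecWedge fun i => stdDual (r i))
      ((Nat.factorial (Fintype.card (Fin k)) : ℝ)⁻¹ • Θ y fun i => stdVec (r i))) ?_
      fun y _ => form_eq_sum_std _
  exact WSmoothOn.sum _ fun r _ => ((h _).const_smul _).map _

theorem WSmoothOn.wedgeAt [FiniteDimensional ℝ U] [FiniteDimensional ℝ V]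
    (β : U →ₗ[ℝ] V →ₗ[ℝ] W) (h : k + l = m) {f : Eucl d → Eucl d [⋀^Fin k]→ₗ[ℝ] U}
    {g : Eucl d → Eucl d [⋀^Fin l]→ₗ[ℝ] V} (hf : WSmoothOn f s) (hg : WSmoothOn g s) :
    WSmoothOn (fun y => HigherGauge.wedgeAt β h (f y) (g y)) s :=
  WSmoothOn.bilin (HigherGauge.wedgeAt β h) hf hg

/-- The directional derivative of a function with values in a finite-dimensional space. -/
def wderiv [FiniteDimensional ℝ W] (f : Eucl d → W) (y v : Eucl d) : W :=
  ∑ a, fderiv ℝ (fun z => (Module.finBasis ℝ W).coord a (f z)) y v • Module.finBasis ℝ W a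

theorem dual_eq_sum_coord [FiniteDimensional ℝ W] (φ : Module.Dual ℝ W) (w : W) :
    φ w = ∑ a, φ (Module.finBasis ℝ W a) * (Module.finBasis ℝ W).coord a w := by
  conv_lhs => rw [← (Module.finBasis ℝ W).sum_repr w]
  simp only [map_sum, map_smul, smul_eq_mul, Module.Basis.coord_apply]
  exact Finset.sum_congr rfl fun i _ => mul_comm _ _

/-- Characterizes `wderiv` without the basis in its definition; the calculus rules below follow by
applying functionals. -/
theorem dual_wderiv [FiniteDimensional ℝ W] {f : Eucl d → W} {y : Eucl d}
    (hf : ∀ φ : Module.Dual ℝ W, DifferentiableAt ℝ (fun z => φ (f z)) y) (φ : Module.Dual ℝ W)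
    (v : Eucl d) : φ (wderiv f y v) = fderiv ℝ (fun z => φ (f z)) y v := by
  have h1 : (fun z => φ (f z)) = fun z => ∑ a, φ (Module.finBasis ℝ W a) *
      (Module.finBasis ℝ W).coord a (f z) := funext fun z => dual_eq_sum_coord φ (f z)
  rw [h1, fderiv_fun_sum fun a _ => (hf _).const_mul _, wderiv, map_sum, sum_apply]
  refine Finset.sum_congr rfl fun a _ => ?_
  rw [fderiv_const_mul (hf _)]
  simp [mul_comm]

theorem WSmoothOn.differentiableAt {f : Eucl d → W} (hf : WSmoothOn f s) (hs : IsOpen s)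
    {y : Eucl d} (hy : y ∈ s) (φ : Module.Dual ℝ W) : DifferentiableAt ℝ (fun z => φ (f z)) y :=
  ((hf φ).differentiableOn (by simp)).differentiableAt (hs.mem_nhds hy)

theorem eq_of_forall_dual [FiniteDimensional ℝ W] {w w' : W}
    (h : ∀ φ : Module.Dual ℝ W, φ w = φ w') : w = w' :=
  (Module.finBasis ℝ W).ext_elem fun i => h ((Module.finBasis ℝ W).coord i)

theorem wderiv_map [FiniteDimensional ℝ U] [FiniteDimensional ℝ W] {f : Eucl d → U} {y : Eucl d}
    (hf : ∀ φ : Module.Dual ℝ U, DifferentiableAt ℝ (fun z => φ (f z)) y) (L : U →ₗ[ℝ] W)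
    (v : Eucl d) : wderiv (fun z => L (f z)) y v = L (wderiv f y v) := by
  refine eq_of_forall_dual fun φ => ?_
  rw [dual_wderiv (fun φ => hf (φ ∘ₗ L)), ← LinearMap.comp_apply, dual_wderiv hf]
  rfl

theorem wderiv_smul [FiniteDimensional ℝ W] {f : Eucl d → W} {y : Eucl d}
    (hf : ∀ φ : Module.Dual ℝ W, DifferentiableAt ℝ (fun z => φ (f z)) y) (c : ℝ) (v : Eucl d) :
    wderiv (fun z => c • f z) y v = c • wderiv f y v := by
  refine eq_of_forall_dual fun φ => ?_
  have h1 : ∀ φ : Module.Dual ℝ W, DifferentiableAt ℝ (fun z => φ (c • f z)) y := fun φ => by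
    simp only [map_smul, smul_eq_mul]
    exact (hf φ).const_mul c
  rw [dual_wderiv h1, map_smul, dual_wderiv hf]
  simp only [map_smul, smul_eq_mul]
  rw [fderiv_const_mul (hf φ)]
  rfl

theorem wderiv_add [FiniteDimensional ℝ W] {f g : Eucl d → W} {y : Eucl d}
    (hf : ∀ φ : Module.Dual ℝ W, DifferentiableAt ℝ (fun z => φ (f z)) y)
    (hg : ∀ φ : Module.Dual ℝ W, DifferentiableAt ℝ (fun z => φ (g z)) y) (v : Eucl d) :
    wderiv (fun z => f z + g z) y v = wderiv f y v + wderiv g y v := by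
  refine eq_of_forall_dual fun φ => ?_
  rw [dual_wderiv (fun φ => by simp only [map_add]; exact (hf φ).add (hg φ)), map_add, dual_wderiv hf,
    dual_wderiv hg]
  simp only [map_add]
  rw [fderiv_fun_add (hf φ) (hg φ)]
  rfl

theorem wderiv_bilin [FiniteDimensional ℝ U] [FiniteDimensional ℝ V]
    (β : U →ₗ[ℝ] V →ₗ[ℝ] ℝ) {f : Eucl d → U} {g : Eucl d → V} {y : Eucl d}
    (hf : ∀ φ : Module.Dual ℝ U, DifferentiableAt ℝ (fun z => φ (f z)) y)
    (hg : ∀ φ : Module.Dual ℝ V, DifferentiableAt ℝ (fun z => φ (g z)) y) (v : Eucl d) :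
    fderiv ℝ (fun z => β (f z) (g z)) y v = β (wderiv f y v) (g y) + β (f y) (wderiv g y v) := by
  have h1 : (fun z => β (f z) (g z)) = fun z => ∑ i, ∑ j, ((Module.finBasis ℝ U).coord i (f z) *
      (Module.finBasis ℝ V).coord j (g z)) * β (Module.finBasis ℝ U i) (Module.finBasis ℝ V j) :=
    funext fun z => bilin_eq_sum β _ _
  rw [h1, fderiv_fun_sum fun i _ => DifferentiableAt.fun_sum fun j _ =>
    ((hf _).fun_mul (hg _)).mul_const _, bilin_eq_sum β (wderiv f y v), bilin_eq_sum β (f y),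
    ← Finset.sum_add_distrib, sum_apply]
  refine Finset.sum_congr rfl fun i _ => ?_
  rw [fderiv_fun_sum fun j _ => ((hf _).fun_mul (hg _)).mul_const _, ← Finset.sum_add_distrib,
    sum_apply]
  refine Finset.sum_congr rfl fun j _ => ?_
  rw [fderiv_mul_const ((hf _).fun_mul (hg _)), fderiv_fun_mul (hf _) (hg _), dual_wderiv hf,
    dual_wderiv hg]
  simp
  ring

theorem wderiv_eq_sum [FiniteDimensional ℝ W] (f : Eucl d → W) (y v : Eucl d) :
    wderiv f y v = ∑ j, stdDual j v • wderiv f y (stdVec j) := by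
  conv_lhs => rw [← sum_stdDual_smul v]
  simp only [wderiv, map_sum, map_smul, Finset.sum_smul, Finset.smul_sum, smul_smul, smul_eq_mul]
  exact Finset.sum_comm

theorem WSmoothOn.wderiv [FiniteDimensional ℝ W] {f : Eucl d → W} (hf : WSmoothOn f s)
    (hs : IsOpen s) (v : Eucl d) : WSmoothOn (fun y => HigherGauge.wderiv f y v) s := fun φ => by
  refine ContDiffOn.congr (f := fun y => fderiv ℝ (fun z => φ (f z)) y v) ?_
    fun y hy => dual_wderiv (hf.differentiableAt hs hy) φ v
  exact ((hf φ).fderiv_of_isOpen hs (by simp)).clm_apply contDiffOn_const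

/-- Passes from weak smoothness to genuine smoothness in the normed space of continuous forms, where
`extDeriv` lives. -/
theorem toContinuousForm_contDiffOn {Θ : Eucl d → Eucl d [⋀^Fin k]→ₗ[ℝ] ℝ} (hΘ : WSmoothOn Θ s) :
    ContDiffOn ℝ ∞ (fun y => toContinuousForm (Θ y)) s := by
  have h1 : ∀ y, toContinuousForm (Θ y) = ∑ r : Fin k → Fin d,
      ((Nat.factorial (Fintype.card (Fin k)) : ℝ)⁻¹ • Θ y fun i => stdVec (r i)) •
        toContinuousForm (covecWedge fun i => stdDual (r i)) := by
    intro y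
    ext v
    have := congrArg (fun f => f v) (form_eq_sum_std (Θ y))
    simp only [form_sum_apply, smulRight_form_apply] at this
    change Θ y v = _
    rw [this, ContinuousAlternatingMap.sum_apply]
    refine Finset.sum_congr rfl fun r _ => ?_
    rw [smul_eq_mul, mul_comm]
    rfl
  simp only [h1]
  exact ContDiffOn.sum fun r _ => ((((wsmoothOn_form_iff.1 hΘ _).const_smul _)
    LinearMap.id)).smul contDiffOn_const

theorem extDeriv_toContinuousForm_apply {Θ : Eucl d → Eucl d [⋀^Fin k]→ₗ[ℝ] ℝ}
    (hΘ : WSmoothOn Θ s) (hs : IsOpen s) {y : Eucl d} (hy : y ∈ s) (v : Fin (k + 1) → Eucl d) :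
    extDeriv (fun z => toContinuousForm (Θ z)) y v = ∑ i : Fin (k + 1), (-1 : ℝ) ^ (i : ℕ) *
      fderiv ℝ (fun z => Θ z (i.removeNth v)) y (v i) := by
  rw [extDeriv_apply (((toContinuousForm_contDiffOn hΘ).differentiableOn (by simp)).differentiableAt
    (hs.mem_nhds hy))]
  refine Finset.sum_congr rfl fun i _ => ?_
  simp
  rfl

end WeaklySmooth

/-! ### Differential forms in charts -/

section Charts

variable {d k l m : ℕ} {M : Type*} [TopologicalSpace M] [ChartedSpace (Eucl d) M]
  {U V W : Type*} [AddCommGroup U] [Module ℝ U] [AddCommGroup V] [Module ℝ V]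
  [AddCommGroup W] [Module ℝ W]

/-- The value of a form at a point, as a form on `ℝᵈ`. -/
def formAt (θ : DForm d M k W) (x : M) : Eucl d [⋀^Fin k]→ₗ[ℝ] W := θ x

/-- The derivative at `y` of the inverse of the chart at `x₀`, as an endomorphism of `ℝᵈ`. -/
def chartLin (x₀ : M) (y : Eucl d) : Eucl d →ₗ[ℝ] Eucl d := chartSymmDeriv x₀ y

theorem localRep_eq (x₀ : M) (θ : DForm d M k W) (y : Eucl d) : localRep x₀ θ y =
    (formAt θ ((extChartAt (𝓡 d) x₀).symm y)).compLinearMap (chartLin x₀ y) := rfl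

theorem formAt_extD [FiniteDimensional ℝ W] (θ : DForm d M k W) (x : M) :
    formAt (extD rfl θ) x = ∑ a, (formAt (extDScalar
      (mapForm ((Module.finBasis ℝ W).coord a) θ)) x).smulRight (Module.finBasis ℝ W a) := rfl

theorem isOpen_chart_target (x₀ : M) : IsOpen (extChartAt (𝓡 d) x₀).target :=
  isOpen_extChartAt_target x₀

section

variable [IsManifold (𝓡 d) ∞ M]

/-- The derivative at `x` of the coordinate change from the chart at `x₀` to the chart at `x₁`. -/
def coordChange (x₀ x₁ x : M) : Eucl d →ₗ[ℝ] Eucl d := (tangentCoordChange (𝓡 d) x₀ x₁ x).toLinearMap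

theorem coordChange_self {x₀ x : M} (h : x ∈ (extChartAt (𝓡 d) x₀).source) :
    coordChange x₀ x₀ x = (LinearMap.id : Eucl d →ₗ[ℝ] Eucl d) :=
  LinearMap.ext fun _ => tangentCoordChange_self h

theorem coordChange_comp {x₀ x₁ x₂ x : M} (h₀ : x ∈ (extChartAt (𝓡 d) x₀).source)
    (h₁ : x ∈ (extChartAt (𝓡 d) x₁).source) (h₂ : x ∈ (extChartAt (𝓡 d) x₂).source) :
    coordChange x₁ x₂ x ∘ₗ coordChange x₀ x₁ x = (coordChange x₀ x₂ x : Eucl d →ₗ[ℝ] Eucl d) :=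
  LinearMap.ext fun _ => tangentCoordChange_comp ⟨⟨h₀, h₁⟩, h₂⟩

/-- The coordinate change from the chart at `x₀` to the chart at `x₁`. -/
def transition (x₀ x₁ : M) : Eucl d → Eucl d := extChartAt (𝓡 d) x₁ ∘ (extChartAt (𝓡 d) x₀).symm

theorem coordChange_eq_fderiv (x₀ x₁ x : M) : coordChange x₀ x₁ x =
    (fderiv ℝ (transition x₀ x₁) (extChartAt (𝓡 d) x₀ x)).toLinearMap := by
  rw [coordChange, tangentCoordChange_def, transition, modelWithCornersSelf_coe, Set.range_id,
    fderivWithin_univ]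

theorem contDiffAt_transition {x₀ x₁ : M} {y : Eucl d} (hy : y ∈ (extChartAt (𝓡 d) x₀).target)
    (hy' : (extChartAt (𝓡 d) x₀).symm y ∈ (extChartAt (𝓡 d) x₁).source) :
    ContDiffAt ℝ ∞ (transition x₀ x₁) y := by
  have h := contDiffWithinAt_ext_coord_change (I := 𝓡 d) (n := ∞) x₁ x₀ (y := y)
    (by rw [PartialEquiv.trans_source, PartialEquiv.symm_source]; exact ⟨hy, hy'⟩)
  rwa [modelWithCornersSelf_coe, Set.range_id, contDiffWithinAt_univ] at h

/-- Tangent vectors at a point are expressed in that point's preferred chart. The derivative of an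
inverse chart is therefore a coordinate change into that chart. -/
theorem chartSymmDeriv_eq {x₀ : M} {y : Eucl d} (hy : y ∈ (extChartAt (𝓡 d) x₀).target) :
    chartSymmDeriv x₀ y = coordChange x₀ ((extChartAt (𝓡 d) x₀).symm y)
      ((extChartAt (𝓡 d) x₀).symm y) := by
  rw [coordChange_eq_fderiv, (extChartAt (𝓡 d) x₀).right_inv hy]
  have hm : MDifferentiableAt 𝓘(ℝ, Eucl d) (𝓡 d) (extChartAt (𝓡 d) x₀).symm y :=
    ((contMDiffOn_extChartAt_symm (n := ∞) x₀).contMDiffAt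
      ((isOpen_chart_target x₀).mem_nhds hy)).mdifferentiableAt (by simp)
  have h1 : fderivWithin ℝ (writtenInExtChartAt 𝓘(ℝ, Eucl d) (𝓡 d) y (extChartAt (𝓡 d) x₀).symm)
      (Set.range 𝓘(ℝ, Eucl d)) (extChartAt 𝓘(ℝ, Eucl d) y y) =
      fderiv ℝ (transition x₀ ((extChartAt (𝓡 d) x₀).symm y)) y := by
    rw [modelWithCornersSelf_coe, Set.range_id, fderivWithin_univ]
    rfl
  have : mfderiv 𝓘(ℝ, Eucl d) (𝓡 d) (extChartAt (𝓡 d) x₀).symm y =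
      fderiv ℝ (transition x₀ ((extChartAt (𝓡 d) x₀).symm y)) y := hm.mfderiv.trans h1
  unfold chartSymmDeriv
  rw [this]

theorem localRep_extChartAt {x₀ x : M} (hx : x ∈ (extChartAt (𝓡 d) x₀).source)
    (θ : DForm d M k W) : localRep x₀ θ (extChartAt (𝓡 d) x₀ x) =
      (formAt θ x).compLinearMap (coordChange x₀ x x) := by
  have h1 : localRep x₀ θ (extChartAt (𝓡 d) x₀ x) =
      (formAt θ ((extChartAt (𝓡 d) x₀).symm (extChartAt (𝓡 d) x₀ x))).compLinearMap
        (coordChange x₀ ((extChartAt (𝓡 d) x₀).symm (extChartAt (𝓡 d) x₀ x))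
          ((extChartAt (𝓡 d) x₀).symm (extChartAt (𝓡 d) x₀ x))) := by
    rw [localRep, chartSymmDeriv_eq ((extChartAt (𝓡 d) x₀).map_source hx)]
    rfl
  rw [h1, (extChartAt (𝓡 d) x₀).left_inv hx]

theorem localRep_self (θ : DForm d M k W) (x : M) :
    localRep x θ (extChartAt (𝓡 d) x x) = formAt θ x := by
  rw [localRep_extChartAt (mem_extChartAt_source x), coordChange_self (mem_extChartAt_source x),
    AlternatingMap.compLinearMap_id]

theorem localRep_change {x₀ x₁ x : M} (hx₀ : x ∈ (extChartAt (𝓡 d) x₀).source)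
    (hx₁ : x ∈ (extChartAt (𝓡 d) x₁).source) (θ : DForm d M k W) :
    localRep x₀ θ (extChartAt (𝓡 d) x₀ x) =
      (localRep x₁ θ (extChartAt (𝓡 d) x₁ x)).compLinearMap (coordChange x₀ x₁ x) := by
  rw [localRep_extChartAt hx₀, localRep_extChartAt hx₁, AlternatingMap.compLinearMap_assoc,
    coordChange_comp hx₀ hx₁ (mem_extChartAt_source x)]

theorem localRep_transition {x₀ x₁ : M} {y : Eucl d} (hy : y ∈ (extChartAt (𝓡 d) x₀).target)
    (hy' : (extChartAt (𝓡 d) x₀).symm y ∈ (extChartAt (𝓡 d) x₁).source) (θ : DForm d M k W) :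
    localRep x₀ θ y = (localRep x₁ θ (transition x₀ x₁ y)).compLinearMap
      (fderiv ℝ (transition x₀ x₁) y).toLinearMap := by
  have h := localRep_change ((extChartAt (𝓡 d) x₀).map_target hy) hy' θ
  rw [coordChange_eq_fderiv, (extChartAt (𝓡 d) x₀).right_inv hy] at h
  exact h

theorem localRep_eq_zero_iff {x₀ x : M} (hx : x ∈ (extChartAt (𝓡 d) x₀).source)
    (θ : DForm d M k W) : localRep x₀ θ (extChartAt (𝓡 d) x₀ x) = 0 ↔ θ x = 0 := by
  refine ⟨fun h => ?_, fun h => ?_⟩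
  · change formAt θ x = 0
    rw [← localRep_self, localRep_change (mem_extChartAt_source x) hx, h,
      AlternatingMap.zero_compLinearMap]
  · rw [localRep_extChartAt hx]
    change (θ x).compLinearMap _ = 0
    rw [h]
    rfl

theorem form_ext_localRep {θ η : DForm d M k W}
    (h : ∀ (x₀ : M), ∀ y ∈ (extChartAt (𝓡 d) x₀).target, localRep x₀ θ y = localRep x₀ η y) :
    θ = η := by
  funext x
  change formAt θ x = formAt η x
  rw [← localRep_self, ← localRep_self, h x _ (mem_extChartAt_target x)]

theorem coordChange_det_pos [OrientedAtlas d M] {x₀ x₁ x : M}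
    (hx₀ : x ∈ (extChartAt (𝓡 d) x₀).source) (hx₁ : x ∈ (extChartAt (𝓡 d) x₁).source) :
    0 < LinearMap.det (coordChange x₀ x₁ x : Eucl d →ₗ[ℝ] Eucl d) := by
  rw [coordChange_eq_fderiv]
  rw [extChartAt_source] at hx₀ hx₁
  have h := OrientedAtlas.det_pos (d := d) (M := M) (chartAt (Eucl d) x₀) (chart_mem_atlas _ x₀)
    (chartAt (Eucl d) x₁) (chart_mem_atlas _ x₁) (chartAt (Eucl d) x₀ x) (by simp [hx₀, hx₁])
  have e : transition x₀ x₁ = chartAt (Eucl d) x₁ ∘ (chartAt (Eucl d) x₀).symm := by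
    ext1 y
    simp [transition]
  rw [e]
  simpa using h

end

/-! #### Pointwise operations -/

theorem localRep_wedge (β : U →ₗ[ℝ] V →ₗ[ℝ] W) (h : k + l = m) (θ : DForm d M k U)
    (η : DForm d M l V) (x₀ : M) (y : Eucl d) :
    localRep x₀ (wedge β h θ η) y = wedgeAt β h (localRep x₀ θ y) (localRep x₀ η y) :=
  wedgeAt_compLinearMap β h (formAt θ _) (formAt η _) (chartSymmDeriv x₀ y)

theorem localRep_add (θ η : DForm d M k W) (x₀ : M) (y : Eucl d) :
    localRep x₀ (θ + η) y = localRep x₀ θ y + localRep x₀ η y := rfl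

theorem localRep_smul (c : ℝ) (θ : DForm d M k W) (x₀ : M) (y : Eucl d) :
    localRep x₀ (c • θ) y = c • localRep x₀ θ y := rfl

theorem isSmoothForm_iff {θ : DForm d M k W} : IsSmoothForm θ ↔
    ∀ x₀, WSmoothOn (localRep x₀ θ) (extChartAt (𝓡 d) x₀).target := by
  simp only [wsmoothOn_form_iff]
  rfl

theorem IsSmoothForm.add {θ η : DForm d M k W} (hθ : IsSmoothForm θ) (hη : IsSmoothForm η) :
    IsSmoothForm (θ + η) :=
  isSmoothForm_iff.2 fun x₀ => (isSmoothForm_iff.1 hθ x₀).add (isSmoothForm_iff.1 hη x₀)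

theorem IsSmoothForm.smul {θ : DForm d M k W} (c : ℝ) (hθ : IsSmoothForm θ) :
    IsSmoothForm (c • θ) :=
  isSmoothForm_iff.2 fun x₀ => (isSmoothForm_iff.1 hθ x₀).const_smul c

theorem isSmoothForm_zero : IsSmoothForm (0 : DForm d M k W) :=
  isSmoothForm_iff.2 fun _ => wsmoothOn_const 0

theorem IsSmoothForm.sub {θ η : DForm d M k W} (hθ : IsSmoothForm θ) (hη : IsSmoothForm η) :
    IsSmoothForm (θ - η) := by
  rw [sub_eq_add_neg, ← neg_one_smul ℝ η]
  exact hθ.add (hη.smul _)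

theorem IsSmoothForm.mapForm {θ : DForm d M k U} (L : U →ₗ[ℝ] W) (hθ : IsSmoothForm θ) :
    IsSmoothForm (mapForm L θ) := fun x₀ v φ => hθ x₀ v (φ ∘ₗ L)

theorem IsSmoothForm.wedge [FiniteDimensional ℝ U] [FiniteDimensional ℝ V]
    (β : U →ₗ[ℝ] V →ₗ[ℝ] W) (h : k + l = m) {θ : DForm d M k U} {η : DForm d M l V}
    (hθ : IsSmoothForm θ) (hη : IsSmoothForm η) : IsSmoothForm (wedge β h θ η) := by
  refine isSmoothForm_iff.2 fun x₀ => ?_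
  simp only [funext (localRep_wedge β h θ η x₀)]
  exact (isSmoothForm_iff.1 hθ x₀).wedgeAt β h (isSmoothForm_iff.1 hη x₀)

/-! #### The exterior derivative -/

variable [IsManifold (𝓡 d) ∞ M]

/-- `extDScalar` uses a different chart at each point. Since `extDeriv` commutes with pullback along
the transition maps, every chart computes the same form. -/
theorem localRep_extDScalar {θ : DForm d M k ℝ} (hθ : IsSmoothForm θ) {x₀ : M} {y : Eucl d}
    (hy : y ∈ (extChartAt (𝓡 d) x₀).target) : localRep x₀ (extDScalar θ) y =
      (extDeriv (fun z => toContinuousForm (localRep x₀ θ z)) y).toAlternatingMap := by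
  obtain ⟨x, hx, rfl⟩ : ∃ x ∈ (extChartAt (𝓡 d) x₀).source, extChartAt (𝓡 d) x₀ x = y :=
    ⟨_, (extChartAt (𝓡 d) x₀).map_target hy, (extChartAt (𝓡 d) x₀).right_inv hy⟩
  have hτ : transition x₀ x (extChartAt (𝓡 d) x₀ x) = extChartAt (𝓡 d) x x := by
    rw [transition, Function.comp_apply, (extChartAt (𝓡 d) x₀).left_inv hx]
  have hxs : (extChartAt (𝓡 d) x₀).symm (extChartAt (𝓡 d) x₀ x) ∈ (extChartAt (𝓡 d) x).source := by
    rw [(extChartAt (𝓡 d) x₀).left_inv hx]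
    exact mem_extChartAt_source x
  have h1 : (fun z => toContinuousForm (localRep x₀ θ z)) =ᶠ[𝓝 (extChartAt (𝓡 d) x₀ x)]
      fun z => (toContinuousForm (localRep x θ (transition x₀ x z))).compContinuousLinearMap
        (fderiv ℝ (transition x₀ x) z) := by
    have h2 : ∀ᶠ z in 𝓝 (extChartAt (𝓡 d) x₀ x), z ∈ (extChartAt (𝓡 d) x₀).target ∧
        (extChartAt (𝓡 d) x₀).symm z ∈ (extChartAt (𝓡 d) x).source := by
      refine ((isOpen_chart_target x₀).eventually_mem hy).and ?_
      exact ((continuousOn_extChartAt_symm x₀).continuousAt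
        ((isOpen_chart_target x₀).mem_nhds hy)).eventually_mem
        ((isOpen_extChartAt_source x).mem_nhds hxs)
    filter_upwards [h2] with z hz
    rw [localRep_transition hz.1 hz.2]
    rfl
  have hd : DifferentiableAt ℝ (fun z => toContinuousForm (localRep x θ z))
      (transition x₀ x (extChartAt (𝓡 d) x₀ x)) := by
    rw [hτ]
    exact ((toContinuousForm_contDiffOn (isSmoothForm_iff.1 hθ x)).differentiableOn
      (by simp)).differentiableAt ((isOpen_chart_target x).mem_nhds (mem_extChartAt_target x))
  rw [h1.extDeriv_eq, extDeriv_pullback hd (contDiffAt_transition hy hxs)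
      (by simp only [minSmoothness_of_isRCLikeNormedField]; exact (WithTop.coe_le_coe (b := (2 : ℕ∞)) (a := ⊤)).2 le_top), hτ,
    localRep_extChartAt hx, coordChange_eq_fderiv]
  -- In the preferred chart at `x` the derivative of the chart is the identity, so `extDScalar θ x`
  -- is just the coordinate derivative.
  have hc : chartDeriv x = (LinearMap.id : Eucl d →ₗ[ℝ] Eucl d) := by
    unfold chartDeriv
    rw [mfderiv_extChartAt_self]
    rfl
  have hf : formAt (extDScalar θ) x = (extDeriv (fun z => toContinuousForm (localRep x θ z))
      (extChartAt (𝓡 d) x x)).toAlternatingMap := by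
    have key : ∀ (α : Eucl d [⋀^Fin (k + 1)]→ₗ[ℝ] ℝ) (T : Eucl d →ₗ[ℝ] Eucl d),
        T = LinearMap.id → α.compLinearMap T = α := by
      rintro α T rfl
      rfl
    exact key _ _ hc
  rw [hf]
  rfl

theorem localRep_extD_apply [FiniteDimensional ℝ W] {θ : DForm d M k W} (hθ : IsSmoothForm θ)
    {x₀ : M} {y : Eucl d} (hy : y ∈ (extChartAt (𝓡 d) x₀).target) (v : Fin (k + 1) → Eucl d) :
    localRep x₀ (extD rfl θ) y v = ∑ i : Fin (k + 1), (-1 : ℝ) ^ (i : ℕ) •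
      wderiv (fun z => localRep x₀ θ z (i.removeNth v)) y (v i) := by
  have h1 : localRep x₀ (extD rfl θ) y v = ∑ a, (localRep x₀ (extDScalar
      (mapForm ((Module.finBasis ℝ W).coord a) θ)) y v) • Module.finBasis ℝ W a := by
    rw [localRep_eq, formAt_extD, AlternatingMap.compLinearMap_apply, form_sum_apply]
    rfl
  rw [h1]
  simp only [wderiv, Finset.smul_sum]
  rw [Finset.sum_comm]
  refine Finset.sum_congr rfl fun a _ => ?_
  rw [localRep_extDScalar (hθ.mapForm _) hy, ContinuousAlternatingMap.coe_toAlternatingMap,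
    extDeriv_toContinuousForm_apply (isSmoothForm_iff.1 (hθ.mapForm _) x₀) (isOpen_chart_target x₀)
      hy, Finset.sum_smul]
  refine Finset.sum_congr rfl fun i _ => ?_
  rw [smul_smul]
  rfl

/-- In a chart, `dθ = ∑ⱼ dxʲ ∧ ∂ⱼθ`. -/
theorem localRep_extD [FiniteDimensional ℝ W] (h : k + 1 = m) (h' : 1 + k = m)
    {θ : DForm d M k W} (hθ : IsSmoothForm θ)
    {x₀ : M} {y : Eucl d} (hy : y ∈ (extChartAt (𝓡 d) x₀).target) :
    localRep x₀ (extD h θ) y = ∑ j, wedgeAt (LinearMap.lsmul ℝ W) h'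
      (covecWedge fun _ : Fin 1 => stdDual j) (wderiv (localRep x₀ θ) y (stdVec j)) := by
  subst h
  ext v
  rw [localRep_extD_apply hθ hy, form_sum_apply]
  simp only [wedgeAt_covector_apply]
  rw [Finset.sum_comm]
  refine Finset.sum_congr rfl fun i _ => ?_
  have hs := (isSmoothForm_iff.1 hθ x₀).differentiableAt (isOpen_chart_target x₀) hy
  rw [wderiv_eq_sum, Finset.smul_sum]
  refine Finset.sum_congr rfl fun j _ => ?_
  rw [smul_smul]
  exact congrArg _ (wderiv_map hs (evalForm (i.removeNth v)) _)

theorem IsSmoothForm.extD [FiniteDimensional ℝ W] (h : k + 1 = m) {θ : DForm d M k W}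
    (hθ : IsSmoothForm θ) : IsSmoothForm (extD h θ) := by
  refine isSmoothForm_iff.2 fun x₀ => ?_
  refine WSmoothOn.congr ?_ fun y hy => localRep_extD h (by omega) hθ hy
  refine WSmoothOn.sum _ fun j _ => WSmoothOn.map ?_ _
  exact (isSmoothForm_iff.1 hθ x₀).wderiv (isOpen_chart_target x₀) _

theorem extD_add [FiniteDimensional ℝ W] (h : k + 1 = m) {θ η : DForm d M k W}
    (hθ : IsSmoothForm θ) (hη : IsSmoothForm η) : extD h (θ + η) = extD h θ + extD h η := by
  refine form_ext_localRep fun x₀ y hy => ?_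
  rw [localRep_add, localRep_extD h (by omega) (hθ.add hη) hy, localRep_extD h (by omega) hθ hy,
    localRep_extD h (by omega) hη hy, ← Finset.sum_add_distrib]
  refine Finset.sum_congr rfl fun j _ => ?_
  rw [← map_add]
  congr 1
  exact wderiv_add ((isSmoothForm_iff.1 hθ x₀).differentiableAt (isOpen_chart_target x₀) hy)
    ((isSmoothForm_iff.1 hη x₀).differentiableAt (isOpen_chart_target x₀) hy) _

theorem extD_smul [FiniteDimensional ℝ W] (h : k + 1 = m) (c : ℝ) {θ : DForm d M k W}
    (hθ : IsSmoothForm θ) : extD h (c • θ) = c • extD h θ := by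
  refine form_ext_localRep fun x₀ y hy => ?_
  rw [localRep_smul, localRep_extD h (by omega) (hθ.smul c) hy, localRep_extD h (by omega) hθ hy,
    Finset.smul_sum]
  refine Finset.sum_congr rfl fun j _ => ?_
  have h1 : wderiv (localRep x₀ (c • θ)) y (stdVec j) = c • wderiv (localRep x₀ θ) y (stdVec j) :=
    wderiv_smul ((isSmoothForm_iff.1 hθ x₀).differentiableAt (isOpen_chart_target x₀) hy) c _
  rw [h1, map_smul]

end Charts

/-! ### The Hodge star in charts -/

section HodgeCharts

variable {d k l m : ℕ} {M : Type*} [TopologicalSpace M] [ChartedSpace (Eucl d) M]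
  {U V W : Type*} [AddCommGroup U] [Module ℝ U] [AddCommGroup V] [Module ℝ V]
  [AddCommGroup W] [Module ℝ W] {σ : ℝ} (g : Metric d M σ)

/-- The metric at a point as a bilinear form on `ℝᵈ`. -/
def metricAt (x : M) : LinearMap.BilinForm ℝ (Eucl d) := g.form x

/-- The Gram matrix of the metric in the chart at `x₀`. -/
def gramChart (x₀ : M) (y : Eucl d) : Matrix (Fin d) (Fin d) ℝ :=
  Matrix.of fun i j => metricAt g ((extChartAt (𝓡 d) x₀).symm y) (chartLin x₀ y (stdVec i))
    (chartLin x₀ y (stdVec j))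

theorem gram_eq (x : M) : g.gram x = Matrix.of fun i j => metricAt g x (stdVec i) (stdVec j) := rfl

theorem bilin_matrix (β : LinearMap.BilinForm ℝ (Eucl d)) (v : Fin d → Eucl d) :
    (Matrix.of fun i j => β (v i) (v j)) = (Matrix.of fun l j => stdDual l (v j)).transpose *
      (Matrix.of fun i j => β (stdVec i) (stdVec j)) * Matrix.of fun l j => stdDual l (v j) := by
  ext i j
  simp only [Matrix.of_apply, Matrix.mul_apply, Matrix.transpose_apply]
  conv_lhs => rw [← sum_stdDual_smul (v i), ← sum_stdDual_smul (v j)]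
  simp only [map_sum, LinearMap.sum_apply, map_smul, LinearMap.smul_apply, smul_eq_mul]
  refine Finset.sum_congr rfl fun b _ => ?_
  rw [Finset.mul_sum, Finset.sum_mul]
  refine Finset.sum_congr rfl fun a _ => ?_
  ring

theorem gram_transpose (x : M) : (g.gram x).transpose = g.gram x := by
  ext i j
  exact (g.symm x).eq (frame x j) (frame x i)

theorem exists_orthonormal_matrix (x : M) : ∃ P : Matrix (Fin d) (Fin d) ℝ, P.det ≠ 0 ∧
    P.transpose * g.gram x * P = signatureMatrix d σ := by
  obtain ⟨b, hb⟩ := g.signature x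
  let b' : Module.Basis (Fin d) ℝ (Eucl d) := b
  refine ⟨Matrix.of fun l j => stdDual l (b' j), ?_, ?_⟩
  · have h1 := (EuclideanSpace.basisFun (Fin d) ℝ).toBasis.isUnit_det b'
    rw [Module.Basis.det_apply] at h1
    exact h1.ne_zero
  · rw [gram_eq, ← bilin_matrix (metricAt g x) b']
    ext i j
    rw [signatureMatrix, Matrix.diagonal_apply]
    exact hb i j

theorem det_coords (T : Eucl d →ₗ[ℝ] Eucl d) :
    (Matrix.of fun l j => stdDual l (T (stdVec j))).det = LinearMap.det T := by
  rw [← LinearMap.det_toMatrix (EuclideanSpace.basisFun (Fin d) ℝ).toBasis]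
  congr 1

theorem gramChart_eq (x₀ : M) (y : Eucl d) : gramChart g x₀ y =
    (Matrix.of fun l j => stdDual l (chartLin x₀ y (stdVec j))).transpose *
      g.gram ((extChartAt (𝓡 d) x₀).symm y) *
        Matrix.of fun l j => stdDual l (chartLin x₀ y (stdVec j)) :=
  bilin_matrix (metricAt g ((extChartAt (𝓡 d) x₀).symm y)) fun i => chartLin x₀ y (stdVec i)

variable [OrientedAtlas d M]

theorem hodge_hodge (hσ : σ = 1 ∨ σ = -1) (hd : 0 < d) (h : k + m = d) (h' : m + k = d)
    (θ : DForm d M k W) : hodge g h' (hodge g h θ) = (σ * (-1) ^ (k * m)) • θ := by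
  funext x
  obtain ⟨P, hP, hG⟩ := exists_orthonormal_matrix g x
  exact hodgeAt_hodgeAt hσ hd h h' _ P hP hG (formAt θ x)

theorem hodge_add (h : k + m = d) (θ η : DForm d M k W) :
    hodge g h (θ + η) = hodge g h θ + hodge g h η :=
  funext fun x => map_add (hodgeAt (g.gram x) h) (formAt θ x) (formAt η x)

theorem hodge_smul (h : k + m = d) (c : ℝ) (θ : DForm d M k W) :
    hodge g h (c • θ) = c • hodge g h θ :=
  funext fun x => map_smul (hodgeAt (g.gram x) h) c (formAt θ x)

theorem wedge_hodge_symm (γ : U →ₗ[ℝ] V →ₗ[ℝ] W) (h h' h'' : k + m = d) (θ : DForm d M k U)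
    (η : DForm d M k V) :
    wedge γ h θ (hodge g h' η) = wedge γ.flip h η (hodge g h'' θ) :=
  funext fun x => wedgeAt_hodgeAt_symm γ (g.gram x) (gram_transpose g x) h (formAt θ x) (formAt η x)

variable [IsManifold (𝓡 d) ∞ M]

theorem det_chartLin_pos {x₀ : M} {y : Eucl d} (hy : y ∈ (extChartAt (𝓡 d) x₀).target) :
    0 < LinearMap.det (chartLin x₀ y) := by
  have h1 : chartLin x₀ y = coordChange x₀ ((extChartAt (𝓡 d) x₀).symm y)
      ((extChartAt (𝓡 d) x₀).symm y) := chartSymmDeriv_eq hy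
  rw [h1]
  exact coordChange_det_pos ((extChartAt (𝓡 d) x₀).map_target hy) (mem_extChartAt_source _)

/-- Coordinate changes in the oriented atlas have positive determinant, so the factors `det` and
`|det|` in the transformation law cancel. -/
theorem localRep_hodge (h : k + m = d) (θ : DForm d M k W) {x₀ : M} {y : Eucl d}
    (hy : y ∈ (extChartAt (𝓡 d) x₀).target) :
    localRep x₀ (hodge g h θ) y = hodgeAt (gramChart g x₀ y) h (localRep x₀ θ y) := by
  have hpos := det_chartLin_pos hy
  rw [← det_coords] at hpos
  have h1 := hodgeAt_compLinearMap (g.gram ((extChartAt (𝓡 d) x₀).symm y)) _ hpos.ne'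
    (chartLin x₀ y) (fun j => (sum_stdDual_smul _).symm) h
    (formAt θ ((extChartAt (𝓡 d) x₀).symm y))
  rw [abs_of_pos hpos, ← gramChart_eq] at h1
  exact (smul_right_injective _ hpos.ne' h1).symm

/-- A change of frame multiplies the Gram determinant by a positive square, so its sign is that of
`σ`. Hence `√|det| = √(σ det)` is smooth, as needed for smoothness of the star. -/
theorem det_gramChart_pos (hσ : σ = 1 ∨ σ = -1) (hd : 0 < d) {x₀ : M} {y : Eucl d}
    (hy : y ∈ (extChartAt (𝓡 d) x₀).target) : 0 < σ * (gramChart g x₀ y).det := by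
  have hpos := det_chartLin_pos hy
  rw [← det_coords] at hpos
  obtain ⟨P, hP, hG⟩ := exists_orthonormal_matrix g ((extChartAt (𝓡 d) x₀).symm y)
  have h1 := congrArg Matrix.det hG
  rw [Matrix.det_mul, Matrix.det_mul, Matrix.det_transpose, det_signatureMatrix hd] at h1
  rw [gramChart_eq, Matrix.det_mul, Matrix.det_mul, Matrix.det_transpose]
  have hσ2 : σ * σ = 1 := by rcases hσ with rfl | rfl <;> norm_num
  have h2 : 0 < σ * (g.gram ((extChartAt (𝓡 d) x₀).symm y)).det := by
    have h3 : 0 < P.det * P.det := mul_self_pos.2 hP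
    have h4 : (P.det * P.det) * (σ * (g.gram ((extChartAt (𝓡 d) x₀).symm y)).det) = 1 := by
      rw [← hσ2]
      linear_combination σ * h1
    exact (mul_pos_iff_of_pos_left h3).1 (by rw [h4]; norm_num)
  nlinarith [mul_pos (mul_pos hpos hpos) h2]

theorem contDiffOn_det {n : Type*} [Fintype n] [DecidableEq n] {s : Set (Eucl d)}
    {A : Eucl d → Matrix n n ℝ} (hA : ∀ i j, ContDiffOn ℝ ∞ (fun y => A y i j) s) :
    ContDiffOn ℝ ∞ (fun y => (A y).det) s := by
  simp only [Matrix.det_apply']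
  exact ContDiffOn.sum fun p _ => contDiffOn_const.mul (contDiffOn_prod fun i _ => hA _ _)

theorem contDiffOn_inv_matrix {n : Type*} [Fintype n] [DecidableEq n] {s : Set (Eucl d)}
    {A : Eucl d → Matrix n n ℝ} (hA : ∀ i j, ContDiffOn ℝ ∞ (fun y => A y i j) s)
    (hdet : ∀ y ∈ s, (A y).det ≠ 0) (i j : n) : ContDiffOn ℝ ∞ (fun y => (A y)⁻¹ i j) s := by
  simp only [Matrix.inv_def, Ring.inverse_eq_inv', Matrix.smul_apply, smul_eq_mul,
    Matrix.adjugate_apply]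
  refine ((contDiffOn_det hA).inv hdet).mul (contDiffOn_det fun a b => ?_)
  simp only [Matrix.updateRow_apply]
  split_ifs
  · exact contDiffOn_const
  · exact hA _ _

theorem WSmoothOn.hodgeAt {s : Set (Eucl d)} {G : Eucl d → Matrix (Fin d) (Fin d) ℝ} {c : ℝ}
    (hc : c = 1 ∨ c = -1) (hG : ∀ i j, ContDiffOn ℝ ∞ (fun y => G y i j) s)
    (hdet : ∀ y ∈ s, 0 < c * (G y).det) (h : k + m = d) {Θ : Eucl d → Eucl d [⋀^Fin k]→ₗ[ℝ] W}
    (hΘ : WSmoothOn Θ s) : WSmoothOn (fun y => HigherGauge.hodgeAt (G y) h (Θ y)) s := by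
  simp only [hodgeAt_apply, contractForm_smul]
  refine (WSmoothOn.smul ?_ ?_).const_smul _
  · have h1 : ContDiffOn ℝ ∞ (fun y => √(c * (G y).det)) s :=
      ContDiffOn.sqrt (contDiffOn_const.mul (contDiffOn_det hG)) fun y hy => (hdet y hy).ne'
    refine h1.congr fun y hy => ?_
    congr 1
    rw [← abs_of_pos (hdet y hy), abs_mul]
    rcases hc with rfl | rfl <;> simp
  · unfold contractForm
    refine WSmoothOn.sum _ fun i _ => WSmoothOn.sum _ fun j _ => WSmoothOn.smul ?_ ?_
    · exact contDiffOn_prod fun r _ => contDiffOn_inv_matrix hG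
        (fun y hy h0 => by simpa [h0] using hdet y hy) _ _
    · exact (wsmoothOn_form_iff.1 hΘ _).map (smulRightₗ _)

theorem IsSmoothForm.hodge (hσ : σ = 1 ∨ σ = -1) (hd : 0 < d) (h : k + m = d)
    {θ : DForm d M k W} (hθ : IsSmoothForm θ) : IsSmoothForm (hodge g h θ) := by
  refine isSmoothForm_iff.2 fun x₀ => ?_
  refine WSmoothOn.congr ?_ fun y hy => localRep_hodge g h θ hy
  refine WSmoothOn.hodgeAt hσ (fun i j => ?_) (fun y hy => det_gramChart_pos g hσ hd hy) h
    (isSmoothForm_iff.1 hθ x₀)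
  exact g.smooth x₀ (stdVec i) (stdVec j)

end HodgeCharts

/-! ### Algebra of the wedge product of forms on a manifold -/

section WedgeForms

variable {d k l m n : ℕ} {M : Type*} [TopologicalSpace M] [ChartedSpace (Eucl d) M]
  {U V W X Y Z : Type*} [AddCommGroup U] [Module ℝ U] [AddCommGroup V] [Module ℝ V]
  [AddCommGroup W] [Module ℝ W] [AddCommGroup X] [Module ℝ X] [AddCommGroup Y] [Module ℝ Y]
  [AddCommGroup Z] [Module ℝ Z]

theorem wedge_add_left (β : U →ₗ[ℝ] V →ₗ[ℝ] W) (h : k + l = m) (θ θ' : DForm d M k U)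
    (η : DForm d M l V) : wedge β h (θ + θ') η = wedge β h θ η + wedge β h θ' η :=
  funext fun x => LinearMap.map_add₂ (wedgeAt β h) (formAt θ x) (formAt θ' x) (formAt η x)

theorem wedge_add_right (β : U →ₗ[ℝ] V →ₗ[ℝ] W) (h : k + l = m) (θ : DForm d M k U)
    (η η' : DForm d M l V) : wedge β h θ (η + η') = wedge β h θ η + wedge β h θ η' :=
  funext fun x => map_add (wedgeAt β h (formAt θ x)) (formAt η x) (formAt η' x)

theorem wedge_smul_left (β : U →ₗ[ℝ] V →ₗ[ℝ] W) (h : k + l = m) (c : ℝ) (θ : DForm d M k U)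
    (η : DForm d M l V) : wedge β h (c • θ) η = c • wedge β h θ η :=
  funext fun x => LinearMap.map_smul₂ (wedgeAt β h) c (formAt θ x) (formAt η x)

theorem wedge_smul_right (β : U →ₗ[ℝ] V →ₗ[ℝ] W) (h : k + l = m) (c : ℝ) (θ : DForm d M k U)
    (η : DForm d M l V) : wedge β h θ (c • η) = c • wedge β h θ η :=
  funext fun x => map_smul (wedgeAt β h (formAt θ x)) c (formAt η x)

theorem wedge_comm (β : U →ₗ[ℝ] V →ₗ[ℝ] W) (h : k + l = m) (h' : l + k = m)
    (θ : DForm d M k U) (η : DForm d M l V) :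
    wedge β h θ η = (-1 : ℝ) ^ (k * l) • wedge β.flip h' η θ :=
  funext fun x => wedgeAt_comm β h h' (formAt θ x) (formAt η x)

theorem wedge_assoc (γ : U →ₗ[ℝ] Y →ₗ[ℝ] Z) (β : V →ₗ[ℝ] W →ₗ[ℝ] Y) (γ' : X →ₗ[ℝ] W →ₗ[ℝ] Z)
    (β' : U →ₗ[ℝ] V →ₗ[ℝ] X) (H : ∀ u v w, γ u (β v w) = γ' (β' u v) w) {r s : ℕ}
    (h₁ : k + r = m) (h₂ : l + n = r) (h₃ : s + n = m) (h₄ : k + l = s) (a : DForm d M k U)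
    (b : DForm d M l V) (c : DForm d M n W) :
    wedge γ h₁ a (wedge β h₂ b c) = wedge γ' h₃ (wedge β' h₄ a b) c :=
  funext fun x => wedgeAt_assoc γ β γ' β' H h₁ h₂ h₃ h₄ (formAt a x) (formAt b x) (formAt c x)

theorem wedge_mapForm_right (β : U →ₗ[ℝ] V →ₗ[ℝ] W) (β' : X →ₗ[ℝ] Y →ₗ[ℝ] W) (L : Y →ₗ[ℝ] V)
    (L' : U →ₗ[ℝ] X) (H : ∀ u y, β u (L y) = β' (L' u) y) (h : k + l = m) (a : DForm d M k U)
    (b : DForm d M l Y) : wedge β h a (mapForm L b) = wedge β' h (mapForm L' a) b :=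
  funext fun x => wedgeAt_map_right β β' L L' H h (formAt a x) (formAt b x)

theorem mapForm_add (L : U →ₗ[ℝ] W) (a b : DForm d M k U) :
    mapForm L (a + b) = mapForm L a + mapForm L b :=
  funext fun x => L.compAlternatingMap_add (formAt a x) (formAt b x)

theorem mapForm_smul (L : U →ₗ[ℝ] W) (c : ℝ) (a : DForm d M k U) :
    mapForm L (c • a) = c • mapForm L a :=
  funext fun x => L.compAlternatingMap_smul c (formAt a x)

end WedgeForms

/-! ### Integration by parts on open subsets of `ℝᵈ` -/

section EuclideanIntegration

open MeasureTheory

variable {d : ℕ} {U V W : Type*} [AddCommGroup U] [Module ℝ U] [AddCommGroup V] [Module ℝ V]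
  [AddCommGroup W] [Module ℝ W] {s K : Set (Eucl d)}

theorem integrableOn_of_eq_zero_off_compact {f : Eucl d → ℝ} (hK : IsCompact K)
    (hs : MeasurableSet s) (hf : ContinuousOn f K) (h0 : ∀ y ∈ s, y ∉ K → f y = 0) :
    IntegrableOn f s volume :=
  IntegrableOn.of_forall_sdiff_eq_zero (hf.integrableOn_compact hK) hs fun y hy => h0 y hy.1 hy.2

/-- The extension of `u` by zero is smooth with compact support on all of `ℝᵈ`; integrate it by
parts against the constant `1`. -/
theorem integral_fderiv_eq_zero {u : Eucl d → ℝ} (hs : IsOpen s) (hK : IsCompact K) (hKs : K ⊆ s)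
    (hu : ContDiffOn ℝ ∞ u s) (h0 : ∀ y ∈ s, y ∉ K → u y = 0) (v : Eucl d) :
    ∫ y in s, fderiv ℝ u y v = 0 := by
  classical
  let w : Eucl d → ℝ := s.indicator u
  have hws : ∀ y ∈ s, w =ᶠ[𝓝 y] u := fun y hy =>
    Filter.eventuallyEq_of_mem (hs.mem_nhds hy) fun z hz => Set.indicator_of_mem hz u
  have hw0 : ∀ y ∉ K, w y = 0 := fun y hy => by
    by_cases hy' : y ∈ s
    · exact (Set.indicator_of_mem hy' u).trans (h0 y hy' hy)
    · exact Set.indicator_of_notMem hy' u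
  have hwK : ∀ y ∉ K, w =ᶠ[𝓝 y] fun _ => 0 := fun y hy =>
    Filter.eventuallyEq_of_mem (hK.isClosed.isOpen_compl.mem_nhds hy) fun z hz => hw0 z hz
  have hw : ContDiff ℝ ∞ w := contDiff_iff_contDiffAt.2 fun y => by
    by_cases hy : y ∈ K
    · exact ((hu y (hKs hy)).contDiffAt (hs.mem_nhds (hKs hy))).congr_of_eventuallyEq
        (hws y (hKs hy))
    · exact contDiffAt_const.congr_of_eventuallyEq (hwK y hy)
  have hd0 : ∀ y ∉ K, fderiv ℝ w y v = 0 := fun y hy => by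
    rw [(hwK y hy).fderiv_eq]
    simp
  have hint1 : Integrable (fun y => fderiv ℝ w y v) volume := by
    have := integrableOn_of_eq_zero_off_compact (f := fun y => fderiv ℝ w y v) hK MeasurableSet.univ
      (((hw.continuous_fderiv (by simp)).clm_apply continuous_const).continuousOn)
      fun y _ hy => hd0 y hy
    rwa [integrableOn_univ] at this
  have hint2 : Integrable w volume := by
    have := integrableOn_of_eq_zero_off_compact hK MeasurableSet.univ hw.continuous.continuousOn
      fun y _ hy => hw0 y hy
    rwa [integrableOn_univ] at this
  have h1 := integral_mul_fderiv_eq_neg_fderiv_mul_of_integrable (μ := (volume : Measure (Eucl d)))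
    (f := fun _ => (1 : ℝ)) (g := w)
    (v := v) (by simp) (by simpa using hint1) (by simpa using hint2)
    (fun _ _ => differentiableAt_const _) fun y _ => hw.differentiable (by simp) y
  simp only [one_mul, fderiv_fun_const, Pi.zero_apply, zero_apply, zero_mul,
    integral_zero, neg_zero] at h1
  rw [← h1, ← setIntegral_eq_integral_of_forall_compl_eq_zero (s := s)
    fun y hy => hd0 y fun hy' => hy (hKs hy')]
  refine setIntegral_congr_fun hs.measurableSet fun y hy => ?_
  rw [(hws y hy).fderiv_eq]

theorem wderiv_eq_zero [FiniteDimensional ℝ W] {f : Eucl d → W} {y : Eucl d}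
    (h : f =ᶠ[𝓝 y] fun _ => 0) (v : Eucl d) : wderiv f y v = 0 := by
  unfold wderiv
  refine Finset.sum_eq_zero fun a _ => ?_
  have : (fun z => (Module.finBasis ℝ W).coord a (f z)) =ᶠ[𝓝 y] fun _ => 0 :=
    h.mono fun z hz => by simp only [hz, map_zero]
  rw [this.fderiv_eq]
  simp

theorem WSmoothOn.continuousOn {f : Eucl d → ℝ} (hf : WSmoothOn f s) : ContinuousOn f s :=
  (wsmoothOn_real.1 hf).continuousOn

/-- Integration by parts. -/
theorem integral_bilin_wderiv [FiniteDimensional ℝ U] [FiniteDimensional ℝ V]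
    (β : U →ₗ[ℝ] V →ₗ[ℝ] ℝ) {f : Eucl d → U} {g : Eucl d → V} (hs : IsOpen s) (hK : IsCompact K)
    (hKs : K ⊆ s) (hf : WSmoothOn f s) (hg : WSmoothOn g s) (h0 : ∀ y ∈ s, y ∉ K → g y = 0)
    (v : Eucl d) :
    IntegrableOn (fun y => β (f y) (wderiv g y v)) s ∧
    IntegrableOn (fun y => β (wderiv f y v) (g y)) s ∧
    ∫ y in s, β (f y) (wderiv g y v) = -∫ y in s, β (wderiv f y v) (g y) := by
  have hd0 : ∀ y ∈ s, y ∉ K → wderiv g y v = 0 := fun y hy hyK =>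
    wderiv_eq_zero (Filter.eventuallyEq_of_mem ((hs.sdiff hK.isClosed).mem_nhds ⟨hy, hyK⟩)
      fun z hz => h0 z hz.1 hz.2) v
  have i1 : IntegrableOn (fun y => β (f y) (wderiv g y v)) s :=
    integrableOn_of_eq_zero_off_compact hK hs.measurableSet
      ((hf.bilin β (hg.wderiv hs v)).continuousOn.mono hKs) fun y hy hyK => by
        rw [hd0 y hy hyK, map_zero]
  have i2 : IntegrableOn (fun y => β (wderiv f y v) (g y)) s :=
    integrableOn_of_eq_zero_off_compact hK hs.measurableSet
      (((hf.wderiv hs v).bilin β hg).continuousOn.mono hKs) fun y hy hyK => by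
        rw [h0 y hy hyK, map_zero]
  refine ⟨i1, i2, ?_⟩
  have h1 := integral_fderiv_eq_zero hs hK hKs (wsmoothOn_real.1 (hf.bilin β hg))
    (fun y hy hyK => by rw [h0 y hy hyK, map_zero]) v
  have h2 : ∫ y in s, fderiv ℝ (fun z => β (f z) (g z)) y v =
      ∫ y in s, (β (wderiv f y v) (g y) + β (f y) (wderiv g y v)) :=
    setIntegral_congr_fun hs.measurableSet fun y hy =>
      wderiv_bilin β (hf.differentiableAt hs hy) (hg.differentiableAt hs hy) v
  rw [h2, integral_add i2 i1] at h1
  linarith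

end EuclideanIntegration

/-! ### Properties of the integral -/

section Integral

open MeasureTheory

variable {d k l m : ℕ} {M : Type*} [TopologicalSpace M] [ChartedSpace (Eucl d) M]
  {U V W : Type*} [AddCommGroup U] [Module ℝ U] [AddCommGroup V] [Module ℝ V]
  [AddCommGroup W] [Module ℝ W]

/-- The coefficient of a top-degree form in the chart at `x₀`. -/
def coef (x₀ : M) (θ : DForm d M d ℝ) (y : Eucl d) : ℝ := localRep x₀ θ y stdVec

/-- The product of a function and a form. -/
def funSmul (c : M → ℝ) (θ : DForm d M k W) : DForm d M k W := fun x => c x • θ x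

theorem localRep_eq_zero {θ : DForm d M k W} {x₀ : M} {y : Eucl d}
    (h : θ ((extChartAt (𝓡 d) x₀).symm y) = 0) : localRep x₀ θ y = 0 := by
  unfold localRep
  rw [h]
  rfl

theorem continuousOn_symm (x₀ : M) :
    ContinuousOn (extChartAt (𝓡 d) x₀).symm (extChartAt (𝓡 d) x₀).target :=
  continuousOn_extChartAt_symm x₀

theorem IsSmoothForm.coef {θ : DForm d M d ℝ} (hθ : IsSmoothForm θ) (x₀ : M) :
    ContDiffOn ℝ ∞ (coef x₀ θ) (extChartAt (𝓡 d) x₀).target := hθ x₀ stdVec LinearMap.id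

/-- The image in the chart at `x₀` of a compact subset of the domain of the chart. -/
theorem isCompact_chart_image {x₀ : M} {K : Set M} (hK : IsCompact K)
    (hKx : K ⊆ (extChartAt (𝓡 d) x₀).source) : IsCompact (extChartAt (𝓡 d) x₀ '' K) :=
  hK.image_of_continuousOn ((continuousOn_extChartAt x₀).mono hKx)

theorem chart_image_subset {x₀ : M} {K : Set M}
    (hKx : K ⊆ (extChartAt (𝓡 d) x₀).source) :
    extChartAt (𝓡 d) x₀ '' K ⊆ (extChartAt (𝓡 d) x₀).target := by
  rintro _ ⟨x, hx, rfl⟩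
  exact (extChartAt (𝓡 d) x₀).map_source (hKx hx)

theorem notMem_of_notMem_chart_image {x₀ : M} {K : Set M} {y : Eucl d}
    (hy : y ∈ (extChartAt (𝓡 d) x₀).target) (hyK : y ∉ extChartAt (𝓡 d) x₀ '' K) :
    (extChartAt (𝓡 d) x₀).symm y ∉ K :=
  fun h => hyK ⟨_, h, (extChartAt (𝓡 d) x₀).right_inv hy⟩

theorem measurableSet_chart_preimage (i : M) {D : Set M} (hD : IsClosed D) :
    MeasurableSet ((extChartAt (𝓡 d) i).target ∩ (extChartAt (𝓡 d) i).symm ⁻¹' D) := by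
  have h1 := ((continuousOn_symm (d := d) i).isOpen_inter_preimage (isOpen_chart_target i)
    hD.isOpen_compl).measurableSet
  convert (isOpen_chart_target i).measurableSet.diff h1 using 1
  ext y
  simp +contextual

variable [IsManifold (𝓡 d) ∞ M]

theorem contDiffOn_comp_symm {c : M → ℝ} (hc : ContMDiff (𝓡 d) 𝓘(ℝ, ℝ) ∞ c) (x₀ : M) :
    ContDiffOn ℝ ∞ (fun y => c ((extChartAt (𝓡 d) x₀).symm y)) (extChartAt (𝓡 d) x₀).target :=
  (hc.comp_contMDiffOn (contMDiffOn_extChartAt_symm (n := ∞) x₀)).contDiffOn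

theorem IsSmoothForm.funSmul {c : M → ℝ} (hc : ContMDiff (𝓡 d) 𝓘(ℝ, ℝ) ∞ c)
    {θ : DForm d M k W} (hθ : IsSmoothForm θ) : IsSmoothForm (funSmul c θ) :=
  isSmoothForm_iff.2 fun x₀ => WSmoothOn.smul (contDiffOn_comp_symm hc x₀)
    (isSmoothForm_iff.1 hθ x₀)

section Coef

variable [OrientedAtlas d M]

theorem topForm_compLinearMap (f : Eucl d [⋀^Fin d]→ₗ[ℝ] ℝ) (T : Eucl d →ₗ[ℝ] Eucl d) :
    f.compLinearMap T stdVec = LinearMap.det T * f stdVec := by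
  have h1 : f = f stdVec • (EuclideanSpace.basisFun (Fin d) ℝ).toBasis.det := by
    refine topForm_ext_std ?_
    rw [AlternatingMap.smul_apply]
    change _ = f stdVec • stdVol d stdVec
    rw [stdVol_stdVec, smul_eq_mul, mul_one]
  conv_lhs => rw [h1]
  have h2 : stdVol d (T ∘ stdVec) = LinearMap.det T * stdVol d stdVec :=
    (EuclideanSpace.basisFun (Fin d) ℝ).toBasis.det_comp T stdVec
  change f stdVec • stdVol d (T ∘ stdVec) = _
  rw [h2, stdVol_stdVec, mul_one, smul_eq_mul, mul_comm]

/-- A top form pulls back with the Jacobian determinant; orientation turns it into the absolute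
value that the change of variables formula requires. -/
theorem coef_transition {x₀ x₁ : M} {y : Eucl d} (hy : y ∈ (extChartAt (𝓡 d) x₀).target)
    (hy' : (extChartAt (𝓡 d) x₀).symm y ∈ (extChartAt (𝓡 d) x₁).source) (θ : DForm d M d ℝ) :
    coef x₀ θ y = |(fderiv ℝ (transition x₀ x₁) y).det| * coef x₁ θ (transition x₀ x₁ y) := by
  have h2 := coordChange_det_pos ((extChartAt (𝓡 d) x₀).map_target hy) hy'
  rw [coordChange_eq_fderiv, (extChartAt (𝓡 d) x₀).right_inv hy] at h2
  change 0 < (fderiv ℝ (transition x₀ x₁) y).det at h2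
  rw [abs_of_pos h2, coef, localRep_transition hy hy', topForm_compLinearMap]
  rfl

/-- Change of variables between two charts. -/
theorem setIntegral_chart_change (x₀ x₁ : M) (c : M → ℝ) (θ : DForm d M d ℝ)
    (h₀ : ∀ x ∈ (extChartAt (𝓡 d) x₀).source, x ∉ (extChartAt (𝓡 d) x₁).source → c x = 0)
    (h₁ : ∀ x ∈ (extChartAt (𝓡 d) x₁).source, x ∉ (extChartAt (𝓡 d) x₀).source → θ x = 0) :
    ∫ y in (extChartAt (𝓡 d) x₁).target, c ((extChartAt (𝓡 d) x₁).symm y) * coef x₁ θ y =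
      ∫ y in (extChartAt (𝓡 d) x₀).target, c ((extChartAt (𝓡 d) x₀).symm y) * coef x₀ θ y := by
  let s₀ := (extChartAt (𝓡 d) x₀).target ∩
    (extChartAt (𝓡 d) x₀).symm ⁻¹' (extChartAt (𝓡 d) x₁).source
  have hs₀ : IsOpen s₀ := (continuousOn_symm x₀).isOpen_inter_preimage (isOpen_chart_target x₀)
    (isOpen_extChartAt_source x₁)
  have hinj : Set.InjOn (transition x₀ x₁) s₀ := by
    intro y hy z hz h
    have h2 := (extChartAt (𝓡 d) x₁).injOn hy.2 hz.2 h
    exact (extChartAt (𝓡 d) x₀).symm.injOn hy.1 hz.1 h2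
  have hder : ∀ y ∈ s₀, HasFDerivWithinAt (transition x₀ x₁) (fderiv ℝ (transition x₀ x₁) y) s₀ y :=
    fun y hy => ((contDiffAt_transition hy.1 hy.2).differentiableAt
      (by simp)).hasFDerivAt.hasFDerivWithinAt
  have key := integral_image_eq_integral_abs_det_fderiv_smul volume hs₀.measurableSet hder hinj
    fun y => c ((extChartAt (𝓡 d) x₁).symm y) * coef x₁ θ y
  -- Both integrals reduce to the overlap of the charts: outside it `θ` vanishes in the chart at
  -- `x₁`, and `c` in the chart at `x₀`.
  have e₁ : ∫ y in (extChartAt (𝓡 d) x₁).target, c ((extChartAt (𝓡 d) x₁).symm y) * coef x₁ θ y =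
      ∫ y in transition x₀ x₁ '' s₀, c ((extChartAt (𝓡 d) x₁).symm y) * coef x₁ θ y := by
    refine setIntegral_eq_of_subset_of_forall_sdiff_eq_zero
      (isOpen_chart_target x₁).measurableSet ?_ fun y hy => ?_
    · rintro _ ⟨y, hy, rfl⟩
      exact (extChartAt (𝓡 d) x₁).map_source hy.2
    · have hy' : (extChartAt (𝓡 d) x₁).symm y ∉ (extChartAt (𝓡 d) x₀).source := fun h => by
        refine hy.2 ⟨extChartAt (𝓡 d) x₀ ((extChartAt (𝓡 d) x₁).symm y),
          ⟨(extChartAt (𝓡 d) x₀).map_source h, ?_⟩, ?_⟩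
        · change (extChartAt (𝓡 d) x₀).symm (extChartAt (𝓡 d) x₀ _) ∈ (extChartAt (𝓡 d) x₁).source
          rw [(extChartAt (𝓡 d) x₀).left_inv h]
          exact (extChartAt (𝓡 d) x₁).map_target hy.1
        · change extChartAt (𝓡 d) x₁ ((extChartAt (𝓡 d) x₀).symm (extChartAt (𝓡 d) x₀ _)) = y
          rw [(extChartAt (𝓡 d) x₀).left_inv h, (extChartAt (𝓡 d) x₁).right_inv hy.1]
      rw [coef, localRep_eq_zero (h₁ _ ((extChartAt (𝓡 d) x₁).map_target hy.1) hy')]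
      simp
  have e₀ : ∫ y in (extChartAt (𝓡 d) x₀).target, c ((extChartAt (𝓡 d) x₀).symm y) * coef x₀ θ y =
      ∫ y in s₀, c ((extChartAt (𝓡 d) x₀).symm y) * coef x₀ θ y := by
    refine setIntegral_eq_of_subset_of_forall_sdiff_eq_zero
      (isOpen_chart_target x₀).measurableSet Set.inter_subset_left fun y hy => ?_
    rw [h₀ _ ((extChartAt (𝓡 d) x₀).map_target hy.1) fun h => hy.2 ⟨hy.1, h⟩, zero_mul]
  rw [e₁, e₀, key]
  refine setIntegral_congr_fun hs₀.measurableSet fun y hy => ?_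
  have h3 : (extChartAt (𝓡 d) x₁).symm (transition x₀ x₁ y) = (extChartAt (𝓡 d) x₀).symm y :=
    (extChartAt (𝓡 d) x₁).left_inv hy.2
  rw [h3, coef_transition hy.1 hy.2, smul_eq_mul]
  ring

end Coef

variable [T2Space M] [SigmaCompactSpace M]

theorem tsupport_chartPartition (i : M) :
    tsupport (chartPartition d M i) ⊆ (extChartAt (𝓡 d) i).source := by
  rw [extChartAt_source]
  exact Classical.choose_spec
    (SmoothPartitionOfUnity.exists_isSubordinate_chartAt_source (𝓡 d) M) i

theorem chartPartition_eq_zero {i x : M} (hx : x ∉ tsupport (chartPartition d M i)) :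
    chartPartition d M i x = 0 := image_eq_zero_of_notMem_tsupport hx

/-- Only finitely many members of the partition of unity are needed on a compact set. -/
theorem exists_finite_partition (d : ℕ) {M : Type*} [TopologicalSpace M] [ChartedSpace (Eucl d) M]
    [IsManifold (𝓡 d) ∞ M] [T2Space M] [SigmaCompactSpace M] {D : Set M} (hD : IsCompact D) :
    ∃ t : Finset M, (∀ i ∉ t, ∀ x ∈ D, chartPartition d M i x = 0) ∧
      ∀ x ∈ D, ∑ i ∈ t, chartPartition d M i x = 1 := by
  have hfin := (chartPartition d M).locallyFinite.finite_nonempty_inter_compact hD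
  have h1 : ∀ i ∉ hfin.toFinset, ∀ x ∈ D, chartPartition d M i x = 0 := fun i hi x hx => by
    by_contra h
    exact hi (hfin.mem_toFinset.2 ⟨x, h, hx⟩)
  refine ⟨hfin.toFinset, h1, fun x hx => ?_⟩
  refine (chartPartition d M).sum_finsupport' x (Set.mem_univ x) fun i hi => ?_
  by_contra h
  exact ((chartPartition d M).mem_finsupport x).1 hi (h1 i h x hx)

/-- The part of the integral that belongs to one chart. -/
def chartIntegral (D : Set M) (i : M) (θ : DForm d M d ℝ) : ℝ :=
  ∫ y in (extChartAt (𝓡 d) i).target ∩ (extChartAt (𝓡 d) i).symm ⁻¹' D,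
    chartPartition d M i ((extChartAt (𝓡 d) i).symm y) * coef i θ y

/-- On this domain the integrand lives on the image of `D ∩ tsupport ρᵢ`, a compact subset of the
chart domain, where it is continuous. -/
theorem integrableOn_chart {D : Set M} (hD : IsCompact D) (i : M) {θ : DForm d M d ℝ}
    (hθ : IsSmoothForm θ) :
    IntegrableOn (fun y => chartPartition d M i ((extChartAt (𝓡 d) i).symm y) * coef i θ y)
      ((extChartAt (𝓡 d) i).target ∩ (extChartAt (𝓡 d) i).symm ⁻¹' D) := by
  have hK : IsCompact (D ∩ tsupport (chartPartition d M i)) :=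
    hD.inter_right (isClosed_tsupport _)
  have hKs : D ∩ tsupport (chartPartition d M i) ⊆ (extChartAt (𝓡 d) i).source :=
    fun x hx => tsupport_chartPartition i hx.2
  refine integrableOn_of_eq_zero_off_compact (isCompact_chart_image hK hKs)
    (measurableSet_chart_preimage i hD.isClosed) ?_ fun y hy hyK => ?_
  · exact ((contDiffOn_comp_symm (chartPartition d M i).contMDiff i).mul
      (hθ.coef i)).continuousOn.mono (chart_image_subset hKs)
  · rw [chartPartition_eq_zero fun h => notMem_of_notMem_chart_image hy.1 hyK ⟨hy.2, h⟩, zero_mul]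

variable [OrientedAtlas d M]

theorem integral_eq_tsum (D : Set M) (θ : DForm d M d ℝ) :
    integral D θ = ∑' i : M, chartIntegral D i θ := rfl

/-- One finite index set serves all forms at once, because only finitely many `ρᵢ` are nonzero on
`D`. Linearity of the integral then needs no summability argument. -/
theorem exists_integral_eq_sum {D : Set M} (hD : IsCompact D) : ∃ t : Finset M,
    ∀ θ : DForm d M d ℝ, integral D θ = ∑ i ∈ t, chartIntegral D i θ := by
  obtain ⟨t, ht, -⟩ := exists_finite_partition d hD
  refine ⟨t, fun θ => ?_⟩
  rw [integral_eq_tsum]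
  refine tsum_eq_sum fun i hi => ?_
  rw [chartIntegral]
  refine (setIntegral_congr_fun (measurableSet_chart_preimage i hD.isClosed)
    (g := fun _ => 0) fun y hy => ?_).trans (by simp)
  simp only
  rw [ht i hi _ hy.2, zero_mul]

theorem integral_add {D : Set M} (hD : IsCompact D) {θ η : DForm d M d ℝ}
    (hθ : IsSmoothForm θ) (hη : IsSmoothForm η) :
    integral D (θ + η) = integral D θ + integral D η := by
  obtain ⟨t, ht⟩ := exists_integral_eq_sum (d := d) hD
  rw [ht, ht, ht, ← Finset.sum_add_distrib]
  refine Finset.sum_congr rfl fun i _ => ?_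
  rw [chartIntegral, chartIntegral, chartIntegral,
    ← MeasureTheory.integral_add (integrableOn_chart hD i hθ) (integrableOn_chart hD i hη)]
  refine congrArg _ (funext fun y => ?_)
  rw [← mul_add]
  rfl

theorem integral_smul {D : Set M} (hD : IsCompact D) (c : ℝ) (θ : DForm d M d ℝ) :
    integral D (c • θ) = c * integral D θ := by
  obtain ⟨t, ht⟩ := exists_integral_eq_sum (d := d) hD
  rw [ht, ht, Finset.mul_sum]
  refine Finset.sum_congr rfl fun i _ => ?_
  rw [chartIntegral, chartIntegral, ← MeasureTheory.integral_const_mul]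
  refine congrArg _ (funext fun y => ?_)
  rw [← mul_left_comm]
  rfl

/-- The integral of a form with compact support in the domain of a chart. -/
theorem integral_eq_setIntegral_chart {D K : Set M} (hD : IsCompact D) (hK : IsCompact K)
    (hKD : K ⊆ D) {x₀ : M} (hKx : K ⊆ (extChartAt (𝓡 d) x₀).source) {θ : DForm d M d ℝ}
    (hθ : IsSmoothForm θ) (h0 : ∀ x ∉ K, θ x = 0) :
    integral D θ = ∫ y in (extChartAt (𝓡 d) x₀).target, coef x₀ θ y := by
  obtain ⟨t, ht, hsum⟩ := exists_finite_partition d hD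
  have e1 : integral D θ = ∑ i ∈ t, chartIntegral D i θ := by
    rw [integral_eq_tsum]
    refine tsum_eq_sum fun i hi => ?_
    rw [chartIntegral]
    refine (setIntegral_congr_fun (measurableSet_chart_preimage i hD.isClosed)
      (g := fun _ => 0) fun y hy => ?_).trans (by simp)
    simp only
    rw [ht i hi _ hy.2, zero_mul]
  -- Every piece `ρᵢ θ` is moved into the single chart at `x₀`, where the weights add up to `1` on
  -- `K`.
  have e2 : ∀ i, chartIntegral D i θ = ∫ y in (extChartAt (𝓡 d) x₀).target,
      chartPartition d M i ((extChartAt (𝓡 d) x₀).symm y) * coef x₀ θ y := fun i => by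
    rw [← setIntegral_chart_change x₀ i (chartPartition d M i) θ
      (fun x _ hx => chartPartition_eq_zero fun h => hx (tsupport_chartPartition i h))
      fun x _ hx => h0 x fun h => hx (hKx h), chartIntegral]
    refine (setIntegral_eq_of_subset_of_forall_sdiff_eq_zero (isOpen_chart_target i).measurableSet
      Set.inter_subset_left fun y hy => ?_).symm
    rw [coef, localRep_eq_zero (h0 _ fun h => hy.2 ⟨hy.1, hKD h⟩)]
    simp
  have hint : ∀ i ∈ t, IntegrableOn (fun y =>
      chartPartition d M i ((extChartAt (𝓡 d) x₀).symm y) * coef x₀ θ y)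
        (extChartAt (𝓡 d) x₀).target := fun i _ => by
    refine integrableOn_of_eq_zero_off_compact (isCompact_chart_image hK hKx)
      (isOpen_chart_target x₀).measurableSet ?_ fun y hy hyK => ?_
    · exact ((contDiffOn_comp_symm (chartPartition d M i).contMDiff x₀).mul
        (hθ.coef x₀)).continuousOn.mono (chart_image_subset hKx)
    · rw [coef, localRep_eq_zero (h0 _ (notMem_of_notMem_chart_image hy hyK))]
      simp
  rw [e1, Finset.sum_congr rfl fun i _ => e2 i, ← integral_finsetSum t hint]
  refine setIntegral_congr_fun (isOpen_chart_target x₀).measurableSet fun y hy => ?_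
  change ∑ i ∈ t, _ * coef x₀ θ y = coef x₀ θ y
  rw [← Finset.sum_mul]
  by_cases hyD : (extChartAt (𝓡 d) x₀).symm y ∈ K
  · rw [hsum _ (hKD hyD), one_mul]
  · rw [coef, localRep_eq_zero (h0 _ hyD)]
    simp

end Integral

/-! ### Localization of forms and integration by parts -/

section Localization

open MeasureTheory

variable {d k l m r s : ℕ} {M : Type*} [TopologicalSpace M] [ChartedSpace (Eucl d) M]
  {U V W : Type*} [AddCommGroup U] [Module ℝ U] [AddCommGroup V] [Module ℝ V]
  [AddCommGroup W] [Module ℝ W]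

theorem localRep_eventuallyEq_zero {θ : DForm d M k W} {K : Set M} (hK : IsClosed K)
    (h0 : ∀ x ∉ K, θ x = 0) {x₀ : M} {y : Eucl d} (hy : y ∈ (extChartAt (𝓡 d) x₀).target)
    (hyK : (extChartAt (𝓡 d) x₀).symm y ∉ K) : localRep x₀ θ =ᶠ[𝓝 y] fun _ => 0 := by
  have h1 := (continuousOn_symm (d := d) x₀).isOpen_inter_preimage (isOpen_chart_target x₀)
    hK.isOpen_compl
  exact Filter.eventuallyEq_of_mem (h1.mem_nhds ⟨hy, hyK⟩) fun z hz =>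
    localRep_eq_zero (h0 _ hz.2)

variable [IsManifold (𝓡 d) ∞ M]

theorem extD_eq_zero [FiniteDimensional ℝ W] (h : k + 1 = m) {θ : DForm d M k W}
    (hθ : IsSmoothForm θ) {K : Set M} (hK : IsClosed K)
    (h0 : ∀ x ∉ K, θ x = 0) {x : M} (hx : x ∉ K) : extD h θ x = 0 := by
  rw [← localRep_eq_zero_iff (mem_extChartAt_source x), localRep_extD h (by omega) hθ
    (mem_extChartAt_target x)]
  refine Finset.sum_eq_zero fun j _ => ?_
  rw [wderiv_eq_zero (localRep_eventuallyEq_zero hK h0 (mem_extChartAt_target x)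
    (by rwa [extChartAt_to_inv])), map_zero]

variable [T2Space M] [SigmaCompactSpace M]

/-- A smooth form with compact support is a sum of forms supported in charts. -/
theorem compactSupport_form_induction {D : Set M} (hD : IsCompact D) {P : DForm d M k W → Prop}
    (h0 : P 0) (hadd : ∀ b b', IsSmoothForm b → IsSmoothForm b' → P b → P b' → P (b + b'))
    (hloc : ∀ (x₀ : M) (K : Set M) (b : DForm d M k W), IsCompact K → K ⊆ D →
      K ⊆ (extChartAt (𝓡 d) x₀).source → IsSmoothForm b → (∀ x ∉ K, b x = 0) → P b)
    {b : DForm d M k W} (hb : IsSmoothForm b) (hbD : ∀ x ∉ D, b x = 0) : P b := by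
  classical
  obtain ⟨t, -, ht⟩ := exists_finite_partition d hD
  have h1 : b = ∑ i ∈ t, funSmul (chartPartition d M i) b := by
    funext x
    rw [Finset.sum_apply]
    change b x = ∑ i ∈ t, chartPartition d M i x • b x
    by_cases hx : x ∈ D
    · rw [← Finset.sum_smul, ht x hx, one_smul]
    · simp only [hbD x hx, smul_zero, Finset.sum_const_zero]
  have h2 : ∀ i, IsSmoothForm (funSmul (chartPartition d M i) b) := fun i =>
    hb.funSmul (chartPartition d M i).contMDiff
  have h3 : ∀ i, P (funSmul (chartPartition d M i) b) := fun i => by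
    refine hloc i (D ∩ tsupport (chartPartition d M i)) _ (hD.inter_right (isClosed_tsupport _))
      Set.inter_subset_left (fun x hx => tsupport_chartPartition i hx.2) (h2 i) fun x hx => ?_
    change chartPartition d M i x • b x = 0
    by_cases hxD : x ∈ D
    · rw [chartPartition_eq_zero fun h => hx ⟨hxD, h⟩, zero_smul]
    · rw [hbD x hxD, smul_zero]
  rw [h1]
  -- Smoothness of the partial sums is carried along because `hadd` asks for it.
  have h4 : ∀ t : Finset M, IsSmoothForm (∑ i ∈ t, funSmul (chartPartition d M i) b) ∧
      P (∑ i ∈ t, funSmul (chartPartition d M i) b) := fun t => by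
    induction t using Finset.induction_on with
    | empty => exact ⟨by rw [Finset.sum_empty]; exact isSmoothForm_zero, by rwa [Finset.sum_empty]⟩
    | insert i t hi ih =>
      rw [Finset.sum_insert hi]
      exact ⟨(h2 i).add ih.1, hadd _ _ (h2 i) ih.1 (h3 i) ih.2⟩
  exact (h4 t).2

variable [OrientedAtlas d M]

theorem integral_zero {D : Set M} (hD : IsCompact D) : integral D (0 : DForm d M d ℝ) = 0 := by
  have := integral_smul hD 0 (0 : DForm d M d ℝ)
  rwa [smul_zero, zero_mul] at this

/-- The pairing `(a, b) ↦ (a ∧ (dxʲ ∧ b))₁…ₙ`. -/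
def covecPairing (γ : U →ₗ[ℝ] V →ₗ[ℝ] ℝ) (h₁ : k + r = d) (h : 1 + l = r) (j : Fin d) :
    (Eucl d [⋀^Fin k]→ₗ[ℝ] U) →ₗ[ℝ] (Eucl d [⋀^Fin l]→ₗ[ℝ] V) →ₗ[ℝ] ℝ :=
  ((wedgeAt γ h₁).compl₂ (wedgeAt (LinearMap.lsmul ℝ V) h
    (covecWedge fun _ : Fin 1 => stdDual j))).compr₂ (evalForm stdVec)

theorem covecPairing_apply (γ : U →ₗ[ℝ] V →ₗ[ℝ] ℝ) (h₁ : k + r = d) (h : 1 + l = r) (j : Fin d)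
    (a : Eucl d [⋀^Fin k]→ₗ[ℝ] U) (b : Eucl d [⋀^Fin l]→ₗ[ℝ] V) :
    covecPairing γ h₁ h j a b = wedgeAt γ h₁ a (wedgeAt (LinearMap.lsmul ℝ V) h
      (covecWedge fun _ : Fin 1 => stdDual j) b) stdVec := rfl

/-- Moving `dxʲ` to the left past the `k`-form `a` costs `(-1)^k`, the sign of the graded Leibniz
rule. -/
theorem covecPairing_eq (γ : U →ₗ[ℝ] V →ₗ[ℝ] ℝ) (h₁ : k + r = d) (h : 1 + l = r)
    (h₃ : 1 + k = s) (h₄ : s + l = d) (j : Fin d)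
    (a : Eucl d [⋀^Fin k]→ₗ[ℝ] U) (b : Eucl d [⋀^Fin l]→ₗ[ℝ] V) :
    covecPairing γ h₁ h j a b = (-1) ^ k * wedgeAt γ h₄ (wedgeAt (LinearMap.lsmul ℝ U) h₃
      (covecWedge fun _ : Fin 1 => stdDual j) a) b stdVec := by
  rw [covecPairing_apply, wedgeAt_assoc γ (LinearMap.lsmul ℝ V) γ (LinearMap.lsmul ℝ U).flip
    (fun u c v => by simp) h₁ h h₄ (by omega),
    wedgeAt_comm (LinearMap.lsmul ℝ U).flip (by omega) h₃, mul_one, LinearMap.flip_flip,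
    LinearMap.map_smul₂]
  rfl

/-- Integration by parts: `∫ a ∧ db = (-1)^(k+1) ∫ da ∧ b` if `b` has compact support. -/
theorem integral_wedge_extD [FiniteDimensional ℝ U] [FiniteDimensional ℝ V]
    (γ : U →ₗ[ℝ] V →ₗ[ℝ] ℝ) (h₁ : k + r = d) (h₂ : l + 1 = r) (h₃ : k + 1 = s) (h₄ : s + l = d)
    {a : DForm d M k U} (ha : IsSmoothForm a) {D : Set M} (hD : IsCompact D)
    {b : DForm d M l V} (hb : IsSmoothForm b) (hbD : ∀ x ∉ D, b x = 0) :
    integral D (wedge γ h₁ a (extD h₂ b)) =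
      (-1) ^ (k + 1) * integral D (wedge γ h₄ (extD h₃ a) b) := by
  refine compactSupport_form_induction hD (P := fun b : DForm d M l V =>
    integral D (wedge γ h₁ a (extD h₂ b)) =
      (-1) ^ (k + 1) * integral D (wedge γ h₄ (extD h₃ a) b)) ?_ ?_ ?_ hb hbD
  · have e1 : extD h₂ (0 : DForm d M l V) = 0 := by
      have := extD_smul h₂ 0 (isSmoothForm_zero (d := d) (M := M) (k := l) (W := V))
      rwa [smul_zero, zero_smul] at this
    have e2 : ∀ {k l : ℕ} (h : k + l = d) (a : DForm d M k U),
        wedge γ h a (0 : DForm d M l V) = 0 := fun h a => by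
      have := wedge_smul_right γ h 0 a 0
      rwa [smul_zero, zero_smul] at this
    simp only [e1, e2, integral_zero hD, mul_zero]
  · intro b b' hb hb' e e'
    rw [extD_add h₂ hb hb', wedge_add_right, wedge_add_right,
      integral_add hD (ha.wedge _ _ (hb.extD _)) (ha.wedge _ _ (hb'.extD _)),
      integral_add hD ((ha.extD _).wedge _ _ hb) ((ha.extD _).wedge _ _ hb'), e, e', mul_add]
  · intro x₀ K b hK hKD hKx hb h0
    have hw0 : ∀ {k l : ℕ} (h : k + l = d) (a : DForm d M k U) (b : DForm d M l V) (x : M),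
        b x = 0 → wedge γ h a b x = 0 := fun h a b x hx => by
      have h1 : formAt b x = 0 := hx
      change wedgeAt γ h (formAt a x) (formAt b x) = 0
      rw [h1, map_zero]
    have hdb : ∀ x ∉ K, extD h₂ b x = 0 := fun x hx => extD_eq_zero h₂ hb hK.isClosed h0 hx
    rw [integral_eq_setIntegral_chart hD hK hKD hKx (ha.wedge γ h₁ (hb.extD h₂))
        fun x hx => hw0 _ _ _ _ (hdb x hx),
      integral_eq_setIntegral_chart hD hK hKD hKx ((ha.extD h₃).wedge γ h₄ hb)
        fun x hx => hw0 _ _ _ _ (h0 x hx)]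
    have hs := isOpen_chart_target (d := d) x₀
    have hK' := isCompact_chart_image hK hKx
    have hKs := chart_image_subset hKx
    have ha' := isSmoothForm_iff.1 ha x₀
    have hb' := isSmoothForm_iff.1 hb x₀
    have h0' : ∀ y ∈ (extChartAt (𝓡 d) x₀).target, y ∉ extChartAt (𝓡 d) x₀ '' K →
        localRep x₀ b y = 0 := fun y hy hyK =>
      localRep_eq_zero (h0 _ (notMem_of_notMem_chart_image hy hyK))
    -- With `d = ∑ dxʲ ∧ ∂ⱼ`, the claim is ordinary integration by parts in each direction `j`. Its
    -- minus sign matches `(-1)^(k+1) (-1)^k = -1`.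
    have ibp := fun j => integral_bilin_wderiv (covecPairing γ h₁ (by omega) j) hs hK' hKs ha' hb'
      h0' (stdVec j)
    have e1 : ∫ y in (extChartAt (𝓡 d) x₀).target, coef x₀ (wedge γ h₁ a (extD h₂ b)) y =
        ∫ y in (extChartAt (𝓡 d) x₀).target, ∑ j, covecPairing γ h₁ (by omega) j (localRep x₀ a y)
          (wderiv (localRep x₀ b) y (stdVec j)) :=
      setIntegral_congr_fun hs.measurableSet fun y hy => by
        simp only [coef]
        rw [localRep_wedge, localRep_extD h₂ (by omega) hb hy, map_sum, form_sum_apply]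
        rfl
    have e2 : ∫ y in (extChartAt (𝓡 d) x₀).target, coef x₀ (wedge γ h₄ (extD h₃ a) b) y =
        ∫ y in (extChartAt (𝓡 d) x₀).target, (-1) ^ k * ∑ j, covecPairing γ h₁ (by omega) j
          (wderiv (localRep x₀ a) y (stdVec j)) (localRep x₀ b y) :=
      setIntegral_congr_fun hs.measurableSet fun y hy => by
        simp only [coef]
        rw [localRep_wedge, localRep_extD h₃ (by omega) ha hy, map_sum, LinearMap.sum_apply,
          form_sum_apply, Finset.mul_sum]
        refine Finset.sum_congr rfl fun j _ => ?_
        rw [covecPairing_eq γ h₁ (by omega) (by omega) h₄, ← mul_assoc, ← pow_add,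
          Even.neg_one_pow ⟨k, rfl⟩, one_mul]
    rw [e1, e2, integral_finsetSum _ fun j _ => (ibp j).1, MeasureTheory.integral_const_mul,
      integral_finsetSum _ fun j _ => (ibp j).2.1, ← mul_assoc, ← pow_add,
      Odd.neg_one_pow ⟨k, by ring⟩, neg_one_mul, ← Finset.sum_neg_distrib]
    exact Finset.sum_congr rfl fun j _ => (ibp j).2.2

end Localization

/-! ### The fundamental lemma of the calculus of variations -/

section Fundamental

open MeasureTheory

variable {d k l : ℕ} {M : Type*} [TopologicalSpace M] [ChartedSpace (Eucl d) M]
  {U V W : Type*} [AddCommGroup U] [Module ℝ U] [AddCommGroup V] [Module ℝ V]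
  [AddCommGroup W] [Module ℝ W]

theorem isCompact_symm_image {x₀ : M} {K : Set (Eucl d)} (hK : IsCompact K)
    (hKs : K ⊆ (extChartAt (𝓡 d) x₀).target) : IsCompact ((extChartAt (𝓡 d) x₀).symm '' K) :=
  hK.image_of_continuousOn ((continuousOn_symm x₀).mono hKs)

variable [IsManifold (𝓡 d) ∞ M]

open Classical in
/-- The form that is `χ β` in the chart at `x₀`, extended by zero. -/
def chartForm (x₀ : M) (χ : Eucl d → ℝ) (β : Eucl d [⋀^Fin l]→ₗ[ℝ] W) : DForm d M l W := fun x =>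
  if x ∈ (extChartAt (𝓡 d) x₀).source then
    (χ (extChartAt (𝓡 d) x₀ x) • β.compLinearMap (coordChange x x₀ x) : Eucl d [⋀^Fin l]→ₗ[ℝ] W)
  else 0

theorem formAt_chartForm {x₀ x : M} (hx : x ∈ (extChartAt (𝓡 d) x₀).source) (χ : Eucl d → ℝ)
    (β : Eucl d [⋀^Fin l]→ₗ[ℝ] W) : formAt (chartForm x₀ χ β) x =
      χ (extChartAt (𝓡 d) x₀ x) • β.compLinearMap (coordChange x x₀ x) := by
  unfold formAt chartForm
  exact if_pos hx

theorem localRep_chartForm {x₀ : M} {y : Eucl d} (hy : y ∈ (extChartAt (𝓡 d) x₀).target)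
    (χ : Eucl d → ℝ) (β : Eucl d [⋀^Fin l]→ₗ[ℝ] W) :
    localRep x₀ (chartForm x₀ χ β) y = χ y • β := by
  have hx := (extChartAt (𝓡 d) x₀).map_target hy
  have h1 := localRep_extChartAt hx (chartForm x₀ χ β)
  rw [formAt_chartForm hx, (extChartAt (𝓡 d) x₀).right_inv hy] at h1
  rw [h1]
  have h2 : (β.compLinearMap (coordChange ((extChartAt (𝓡 d) x₀).symm y) x₀
      ((extChartAt (𝓡 d) x₀).symm y))).compLinearMap (coordChange x₀
        ((extChartAt (𝓡 d) x₀).symm y) ((extChartAt (𝓡 d) x₀).symm y)) = β := by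
    rw [AlternatingMap.compLinearMap_assoc, coordChange_comp hx (mem_extChartAt_source _) hx,
      coordChange_self hx, AlternatingMap.compLinearMap_id]
  conv_rhs => rw [← h2]
  rfl

theorem chartForm_eq_zero {x₀ : M} {χ : Eucl d → ℝ} (β : Eucl d [⋀^Fin l]→ₗ[ℝ] W) {x : M}
    (hx : x ∉ (extChartAt (𝓡 d) x₀).symm '' tsupport χ) : chartForm x₀ χ β x = 0 := by
  by_cases h : x ∈ (extChartAt (𝓡 d) x₀).source
  · change formAt (chartForm x₀ χ β) x = 0
    rw [formAt_chartForm h, image_eq_zero_of_notMem_tsupport fun h' =>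
      hx ⟨_, h', (extChartAt (𝓡 d) x₀).left_inv h⟩, zero_smul]
  · unfold chartForm
    exact if_neg h

/-- Over the chart domain the coefficients are `χ` composed with a transition map, times a
determinant in its derivative. At any other point the form vanishes nearby: the image of the compact
support of `χ` is closed, as `M` is Hausdorff. -/
theorem isSmoothForm_chartForm [T2Space M] (x₀ : M) {χ : Eucl d → ℝ} (hχ : ContDiff ℝ ∞ χ)
    (hc : HasCompactSupport χ) (hs : tsupport χ ⊆ (extChartAt (𝓡 d) x₀).target)
    (ψ : Fin l → Module.Dual ℝ (Eucl d)) (w : W) :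
    IsSmoothForm (chartForm x₀ χ ((covecWedge ψ).smulRight w) : DForm d M l W) := by
  intro x₁ v φ y hy
  refine ContDiffAt.contDiffWithinAt ?_
  by_cases hx : (extChartAt (𝓡 d) x₁).symm y ∈ (extChartAt (𝓡 d) x₀).source
  · have hS : IsOpen ((extChartAt (𝓡 d) x₁).target ∩
        (extChartAt (𝓡 d) x₁).symm ⁻¹' (extChartAt (𝓡 d) x₀).source) :=
      (continuousOn_symm x₁).isOpen_inter_preimage (isOpen_chart_target x₁)
        (isOpen_extChartAt_source x₀)
    refine ContDiffOn.contDiffAt (s := (extChartAt (𝓡 d) x₁).target ∩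
      (extChartAt (𝓡 d) x₁).symm ⁻¹' (extChartAt (𝓡 d) x₀).source) ?_ (hS.mem_nhds ⟨hy, hx⟩)
    have hτ : ContDiffOn ℝ ∞ (transition x₁ x₀) ((extChartAt (𝓡 d) x₁).target ∩
        (extChartAt (𝓡 d) x₁).symm ⁻¹' (extChartAt (𝓡 d) x₀).source) := fun z hz =>
      (contDiffAt_transition hz.1 hz.2).contDiffWithinAt
    have h1 : ContDiffOn ℝ ∞ (fun z => χ (transition x₁ x₀ z) *
        (Matrix.of fun a b => ψ a (fderiv ℝ (transition x₁ x₀) z (v b))).det * φ w)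
        ((extChartAt (𝓡 d) x₁).target ∩
          (extChartAt (𝓡 d) x₁).symm ⁻¹' (extChartAt (𝓡 d) x₀).source) := by
      refine ((hχ.comp_contDiffOn hτ).mul (contDiffOn_det fun a b => ?_)).mul contDiffOn_const
      exact (ψ a).toContinuousLinearMap.contDiff.comp_contDiffOn
        ((hτ.fderiv_of_isOpen hS (by simp)).clm_apply contDiffOn_const)
    refine h1.congr fun z hz => ?_
    have hz' : transition x₁ x₀ z ∈ (extChartAt (𝓡 d) x₀).target :=
      (extChartAt (𝓡 d) x₀).map_source hz.2
    rw [localRep_transition hz.1 hz.2, localRep_chartForm hz',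
      AlternatingMap.compLinearMap_apply, AlternatingMap.smul_apply, smulRight_form_apply,
      map_smul, map_smul, covecWedge_apply, smul_eq_mul, smul_eq_mul, mul_assoc]
    rfl
  · have hx' : (extChartAt (𝓡 d) x₁).symm y ∉ (extChartAt (𝓡 d) x₀).symm '' tsupport χ := by
      rintro ⟨z, hz, e⟩
      rw [← e] at hx
      exact hx ((extChartAt (𝓡 d) x₀).map_target (hs hz))
    have h1 := localRep_eventuallyEq_zero (isCompact_symm_image hc hs).isClosed
      (fun x hx => chartForm_eq_zero ((covecWedge ψ).smulRight w) hx) hy hx'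
    have h2 : (fun z => φ (localRep x₁ (chartForm x₀ χ ((covecWedge ψ).smulRight w)) z v))
        =ᶠ[𝓝 y] fun _ => (0 : ℝ) := h1.mono fun z hz => by
      simp only [hz]
      exact map_zero φ
    exact contDiffAt_const.congr_of_eventuallyEq h2

variable [T2Space M] [SigmaCompactSpace M] [OrientedAtlas d M]

/-- Test with `b = χ ψ ⊗ v` in a chart, for `χ` an arbitrary bump function. The coefficient of `a ∧
(ψ ⊗ v)` then vanishes almost everywhere, hence everywhere by continuity, and the pointwise wedge
pairing is nondegenerate. -/
theorem eq_zero_of_integral_wedge_eq_zero [FiniteDimensional ℝ U] [FiniteDimensional ℝ V]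
    (γ : U →ₗ[ℝ] V →ₗ[ℝ] ℝ) (hγ : ∀ u, (∀ v, γ u v = 0) → u = 0) (h : k + l = d)
    {a : DForm d M k U} (ha : IsSmoothForm a)
    (H : ∀ D : Set M, IsCompact D → ∀ b : DForm d M l V, IsSmoothForm b → (∀ x ∉ D, b x = 0) →
      integral D (wedge γ h a b) = 0) : a = 0 := by
  refine form_ext_localRep fun x₀ y hy => ?_
  change _ = (0 : Eucl d [⋀^Fin k]→ₗ[ℝ] U)
  refine wedgeAt_nondegenerate γ hγ h _ fun ψ v => ?_
  have hs := isOpen_chart_target (d := d) x₀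
  let f : Eucl d → ℝ := fun z => wedgeAt γ h (localRep x₀ a z) ((covecWedge ψ).smulRight v) stdVec
  have hf : ContinuousOn f (extChartAt (𝓡 d) x₀).target :=
    ((isSmoothForm_iff.1 ha x₀).map
      (evalForm stdVec ∘ₗ (wedgeAt γ h).flip ((covecWedge ψ).smulRight v))).continuousOn
  have hae : ∀ᵐ z, z ∈ (extChartAt (𝓡 d) x₀).target → f z = 0 := by
    refine hs.ae_eq_zero_of_integral_contDiff_smul_eq_zero
      (hf.locallyIntegrableOn hs.measurableSet) fun χ hχ hc hsupp => ?_
    have hK := isCompact_symm_image hc hsupp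
    have hKx : (extChartAt (𝓡 d) x₀).symm '' tsupport χ ⊆ (extChartAt (𝓡 d) x₀).source := by
      rintro _ ⟨z, hz, rfl⟩
      exact (extChartAt (𝓡 d) x₀).map_target (hsupp hz)
    have hb := isSmoothForm_chartForm x₀ hχ hc hsupp ψ v
    have hb0 : ∀ x ∉ (extChartAt (𝓡 d) x₀).symm '' tsupport χ,
        chartForm x₀ χ ((covecWedge ψ).smulRight v) x = 0 := fun x hx => chartForm_eq_zero _ hx
    have h1 := H _ hK _ hb hb0
    rw [integral_eq_setIntegral_chart hK hK subset_rfl hKx (ha.wedge γ h hb) fun x hx => by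
      have h2 : formAt (chartForm x₀ χ ((covecWedge ψ).smulRight v)) x = 0 := hb0 x hx
      change wedgeAt γ h (formAt a x) (formAt (chartForm x₀ χ _) x) = 0
      rw [h2, map_zero]] at h1
    rw [← h1, ← setIntegral_eq_integral_of_forall_compl_eq_zero
      (s := (extChartAt (𝓡 d) x₀).target) fun z hz => by
        rw [image_eq_zero_of_notMem_tsupport fun h' => hz (hsupp h'), zero_smul]]
    refine setIntegral_congr_fun hs.measurableSet fun z hz => ?_
    simp only [coef]
    rw [localRep_wedge, localRep_chartForm hz, map_smul]
    rfl
  exact Measure.eqOn_open_of_ae_eq ((ae_restrict_iff' hs.measurableSet).2 hae) hs hf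
    continuousOn_const hy

end Fundamental

/-! ### Derivatives of integrals of polynomial families of forms -/

section Variation

variable {d k l m : ℕ} {M : Type*} [TopologicalSpace M] [ChartedSpace (Eucl d) M]
  {U V W : Type*} [AddCommGroup U] [Module ℝ U] [AddCommGroup V] [Module ℝ V]
  [AddCommGroup W] [Module ℝ W]

/-- A quadratic family of forms. -/
def quadForm (a₀ a₁ a₂ : DForm d M k W) (t : ℝ) : DForm d M k W := a₀ + t • a₁ + t ^ 2 • a₂

theorem IsSmoothForm.quadForm {a₀ a₁ a₂ : DForm d M k W} (h₀ : IsSmoothForm a₀)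
    (h₁ : IsSmoothForm a₁) (h₂ : IsSmoothForm a₂) (t : ℝ) : IsSmoothForm (quadForm a₀ a₁ a₂ t) :=
  (h₀.add (h₁.smul t)).add (h₂.smul _)

theorem wedge_zero_left (β : U →ₗ[ℝ] V →ₗ[ℝ] W)
    (h : k + l = m) (b : DForm d M l V) : wedge β h (0 : DForm d M k U) b = 0 := by
  have := wedge_smul_left β h 0 (0 : DForm d M k U) b
  rwa [smul_zero, zero_smul] at this

theorem wedge_zero_right (β : U →ₗ[ℝ] V →ₗ[ℝ] W)
    (h : k + l = m) (a : DForm d M k U) : wedge β h a (0 : DForm d M l V) = 0 := by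
  have := wedge_smul_right β h 0 a (0 : DForm d M l V)
  rwa [smul_zero, zero_smul] at this

theorem add_smul_eq_quadForm (a b : DForm d M k W) (t : ℝ) : a + t • b = quadForm a b 0 t := by
  rw [quadForm, smul_zero, add_zero]

theorem hodge_quadForm [OrientedAtlas d M] {σ : ℝ} (g : Metric d M σ) (h : k + m = d) (a b c : DForm d M k W) (t : ℝ) :
    hodge g h (quadForm a b c t) = quadForm (hodge g h a) (hodge g h b) (hodge g h c) t := by
  rw [quadForm, quadForm, hodge_add, hodge_add, hodge_smul, hodge_smul]

variable [IsManifold (𝓡 d) ∞ M] [T2Space M] [SigmaCompactSpace M] [OrientedAtlas d M]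

/-- By bilinearity the integral is a polynomial in `t` of degree at most four, and its linear
coefficient is the derivative. No differentiation under the integral sign is involved. -/
theorem hasDerivAt_integral_wedge_quadForm [FiniteDimensional ℝ U] [FiniteDimensional ℝ V]
    (γ : U →ₗ[ℝ] V →ₗ[ℝ] ℝ) (h : k + l = d) {D : Set M} (hD : IsCompact D)
    {a₀ a₁ a₂ : DForm d M k U} {b₀ b₁ b₂ : DForm d M l V} (ha₀ : IsSmoothForm a₀)
    (ha₁ : IsSmoothForm a₁) (ha₂ : IsSmoothForm a₂) (hb₀ : IsSmoothForm b₀)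
    (hb₁ : IsSmoothForm b₁) (hb₂ : IsSmoothForm b₂) :
    HasDerivAt (fun t => integral D (wedge γ h (quadForm a₀ a₁ a₂ t) (quadForm b₀ b₁ b₂ t)))
      (integral D (wedge γ h a₀ b₁) + integral D (wedge γ h a₁ b₀)) 0 := by
  have hsm : ∀ {a : DForm d M k U} {b : DForm d M l V}, IsSmoothForm a → IsSmoothForm b →
    IsSmoothForm (wedge γ h a b) := fun ha hb => ha.wedge γ h hb
  have right : ∀ {a : DForm d M k U}, IsSmoothForm a → ∀ t,
      integral D (wedge γ h a (quadForm b₀ b₁ b₂ t)) = integral D (wedge γ h a b₀) +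
        t * integral D (wedge γ h a b₁) + t ^ 2 * integral D (wedge γ h a b₂) := fun ha t => by
    unfold quadForm
    rw [wedge_add_right, wedge_add_right, wedge_smul_right, wedge_smul_right,
      integral_add hD ((hsm ha hb₀).add ((hsm ha hb₁).smul t)) ((hsm ha hb₂).smul _),
      integral_add hD (hsm ha hb₀) ((hsm ha hb₁).smul t), integral_smul hD, integral_smul hD]
  have left : ∀ {b : DForm d M l V}, IsSmoothForm b → ∀ t,
      integral D (wedge γ h (quadForm a₀ a₁ a₂ t) b) = integral D (wedge γ h a₀ b) +
        t * integral D (wedge γ h a₁ b) + t ^ 2 * integral D (wedge γ h a₂ b) := fun hb t => by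
    unfold quadForm
    rw [wedge_add_left, wedge_add_left, wedge_smul_left, wedge_smul_left,
      integral_add hD ((hsm ha₀ hb).add ((hsm ha₁ hb).smul t)) ((hsm ha₂ hb).smul _),
      integral_add hD (hsm ha₀ hb) ((hsm ha₁ hb).smul t), integral_smul hD, integral_smul hD]
  have quad : ∀ A B C : ℝ, HasDerivAt (fun t : ℝ => A + t * B + t ^ 2 * C) B 0 := fun A B C => by
    have h1 := (((hasDerivAt_id (0 : ℝ)).mul_const B).const_add A).fun_add
      (((hasDerivAt_id (0 : ℝ)).pow 2).mul_const C)
    simpa using h1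
  have e : (fun t => integral D (wedge γ h (quadForm a₀ a₁ a₂ t) (quadForm b₀ b₁ b₂ t))) =
      fun t => (integral D (wedge γ h a₀ b₀) + t * integral D (wedge γ h a₀ b₁) +
          t ^ 2 * integral D (wedge γ h a₀ b₂)) +
        t * (integral D (wedge γ h a₁ b₀) + t * integral D (wedge γ h a₁ b₁) +
          t ^ 2 * integral D (wedge γ h a₁ b₂)) +
        t ^ 2 * (integral D (wedge γ h a₂ b₀) + t * integral D (wedge γ h a₂ b₁) +
          t ^ 2 * integral D (wedge γ h a₂ b₂)) := by
    funext t
    rw [left (hb₀.quadForm hb₁ hb₂ t), right ha₀, right ha₁, right ha₂]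
  rw [e]
  have h1 := ((quad (integral D (wedge γ h a₀ b₀)) (integral D (wedge γ h a₀ b₁))
      (integral D (wedge γ h a₀ b₂))).fun_add ((hasDerivAt_id (0 : ℝ)).fun_mul
        (quad (integral D (wedge γ h a₁ b₀)) (integral D (wedge γ h a₁ b₁))
      (integral D (wedge γ h a₁ b₂))))).fun_add (((hasDerivAt_id (0 : ℝ)).pow 2).fun_mul
        (quad (integral D (wedge γ h a₂ b₀)) (integral D (wedge γ h a₂ b₁))
      (integral D (wedge γ h a₂ b₂))))
  refine h1.congr_deriv ?_
  simp

end Variation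

/-! ### The first variation of the curvatures -/

section CurvatureVariation

variable {d q k l m : ℕ} {M : Type*} [TopologicalSpace M] [ChartedSpace (Eucl d) M]
  {U V W : Type*} [AddCommGroup U] [Module ℝ U] [AddCommGroup V] [Module ℝ V]
  [AddCommGroup W] [Module ℝ W]

theorem wedgeAt_of_bilin_eq_smul {β β' : U →ₗ[ℝ] V →ₗ[ℝ] W} {c : ℝ}
    (H : ∀ u v, β u v = c • β' u v) (h : k + l = m) (a : Eucl d [⋀^Fin k]→ₗ[ℝ] U)
    (b : Eucl d [⋀^Fin l]→ₗ[ℝ] V) : wedgeAt β h a b = c • wedgeAt β' h a b := by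
  have h1 := wedgeAt_map_right β' β (c • LinearMap.id) LinearMap.id (fun u y => by simp [H]) h a b
  have h2 : (c • LinearMap.id : V →ₗ[ℝ] V).compAlternatingMap b = c • b := rfl
  rw [h2, map_smul] at h1
  exact h1.symm

theorem wedge_of_bilin_eq_smul {β β' : U →ₗ[ℝ] V →ₗ[ℝ] W} {c : ℝ}
    (H : ∀ u v, β u v = c • β' u v) (h : k + l = m) (a : DForm d M k U) (b : DForm d M l V) :
    wedge β h a b = c • wedge β' h a b :=
  funext fun x => wedgeAt_of_bilin_eq_smul H h (formAt a x) (formAt b x)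

variable {𝔤 𝔥 : Type*} [LieRing 𝔤] [LieAlgebra ℝ 𝔤] [LieRing 𝔥] [LieAlgebra ℝ 𝔥]

theorem bracket_apply (x y : 𝔤) : bracket 𝔤 x y = ⁅x, y⁆ := rfl

/-- The extra sign, beyond graded commutativity, is the antisymmetry of the bracket. -/
theorem wedge_bracket_comm (h : k + l = m) (h' : l + k = m) (a : DForm d M k 𝔤)
    (b : DForm d M l 𝔤) :
    wedge (bracket 𝔤) h a b = (-1 : ℝ) ^ (k * l + 1) • wedge (bracket 𝔤) h' b a := by
  rw [wedge_comm _ h h', wedge_of_bilin_eq_smul (β := (bracket 𝔤).flip) (β' := bracket 𝔤)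
    (c := -1) (fun u v => by simp [bracket_apply]), smul_smul, pow_succ]

section

theorem actBilin_apply (X : DifferentialCrossedModule 𝔤 𝔥) (x : 𝔤) (y : 𝔥) : X.actBilin x y = X.act x y := rfl

variable {X : DifferentialCrossedModule 𝔤 𝔥} (κ : X.InvariantForms)

theorem formG_left_nondegenerate (u : 𝔤) (h : ∀ v, κ.formG u v = 0) : u = 0 :=
  κ.nondegenerateG.1 u h

theorem formH_left_nondegenerate (u : 𝔥) (h : ∀ v, κ.formH u v = 0) : u = 0 :=
  κ.nondegenerateH.1 u h

theorem flip_formG : LinearMap.flip κ.formG = κ.formG :=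
  LinearMap.ext fun x => LinearMap.ext fun y => (κ.symmG.eq x y).symm

theorem flip_formH : LinearMap.flip κ.formH = κ.formH :=
  LinearMap.ext fun x => LinearMap.ext fun y => (κ.symmH.eq x y).symm

/-- Invariance gives `⟨P, [A, δA]⟩ = ⟨[P, A], δA⟩`. Reordering `P` and `A` costs `(-1)^(q+1)` from
the degrees and `-1` from the bracket. -/
theorem wedge_formG_bracket (h : q + 1 + 2 = d) (h' : q + 2 + 1 = d) (A δA : DForm d M 1 𝔤)
    (P : DForm d M (q + 1) 𝔤) :
    wedge κ.formG h P (wedge (bracket 𝔤) rfl A δA) =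
      (-1 : ℝ) ^ q • wedge κ.formG h' (wedge (bracket 𝔤) (by omega) A P) δA := by
  rw [wedge_assoc κ.formG (bracket 𝔤) κ.formG (bracket 𝔤) (fun u v w => ?_) h rfl h' rfl,
    wedge_bracket_comm rfl (by omega), wedge_smul_left]
  · congr 1
    rw [mul_one, add_assoc, pow_add]
    norm_num
  · rw [bracket_apply, bracket_apply, ← lie_skew u v, map_neg, LinearMap.neg_apply, κ.invariantG,
      neg_neg]

theorem wedge_formG_alpha [FiniteDimensional ℝ 𝔥] (h : q + 1 + 2 = d) (P : DForm d M (q + 1) 𝔤) (δB : DForm d M 2 𝔥) :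
    wedge κ.formG h P (mapForm (X.α : 𝔥 →ₗ[ℝ] 𝔤) δB) =
      wedge κ.formH h (mapForm κ.alphaStar P) δB :=
  wedge_mapForm_right _ _ _ _ (fun u y => (κ.symmG.eq _ _).trans
    ((κ.formH_alphaStar y u).symm.trans (κ.symmH.eq _ _))) h P δB

/-- The minus sign is the skewness of the action, and `(-1)^q` comes from moving `A` past `Q`. -/
theorem wedge_formH_act (h : q + 3 = d) (h' : q + 1 + 2 = d) (A : DForm d M 1 𝔤)
    (Q : DForm d M q 𝔥) (δB : DForm d M 2 𝔥) :
    wedge κ.formH h Q (wedge X.actBilin rfl A δB) =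
      -((-1 : ℝ) ^ q • wedge κ.formH h' (wedge X.actBilin (by omega) A Q) δB) := by
  rw [wedge_assoc κ.formH X.actBilin (-κ.formH) X.actBilin.flip (fun u v w => ?_) h rfl h' rfl,
    wedge_comm X.actBilin.flip rfl (by omega), wedge_smul_left, LinearMap.flip_flip, mul_one,
    wedge_of_bilin_eq_smul (β := -κ.formH) (β' := κ.formH) (c := -1) (fun u v => by simp)]
  · module
  · rw [LinearMap.flip_apply, LinearMap.neg_apply, LinearMap.neg_apply, actBilin_apply,
      actBilin_apply, κ.invariantH, neg_neg]

/-- The 2-form `B` passes `δA` without a sign, so only the minus sign defining `σ` remains. -/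
theorem wedge_formH_sigma [FiniteDimensional ℝ 𝔤] (h : q + 3 = d) (h' : q + 2 + 1 = d) (δA : DForm d M 1 𝔤)
    (Q : DForm d M q 𝔥) (B : DForm d M 2 𝔥) :
    wedge κ.formH h Q (wedge X.actBilin rfl δA B) =
      -wedge κ.formG h' (wedge κ.sigma rfl Q B) δA := by
  rw [wedge_comm X.actBilin (m := 3) rfl rfl, wedge_smul_right,
    wedge_assoc κ.formH X.actBilin.flip (-κ.formG) κ.sigma (fun u v w => ?_) h rfl h' rfl,
    wedge_of_bilin_eq_smul (β := -κ.formG) (β' := κ.formG) (c := -1) (fun u v => by simp)]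
  · module
  · rw [LinearMap.flip_apply, LinearMap.neg_apply, LinearMap.neg_apply, actBilin_apply,
      κ.formG_sigma, neg_neg]

/-- The variational derivative of `∫ ⟨P, 𝓕⟩ + ⟨Q, 𝓖⟩` with respect to `A`. -/
def eulerA [FiniteDimensional ℝ 𝔤] (A : DForm d M 1 𝔤) (B : DForm d M 2 𝔥) (P : DForm d M (q + 1) 𝔤)
    (Q : DForm d M q 𝔥) : DForm d M (q + 2) 𝔤 :=
  (-1 : ℝ) ^ q • (extD rfl P + wedge (bracket 𝔤) (by omega) A P) - wedge κ.sigma rfl Q B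

/-- The variational derivative of `∫ ⟨P, 𝓕⟩ + ⟨Q, 𝓖⟩` with respect to `B`. -/
def eulerB [FiniteDimensional ℝ 𝔥] (A : DForm d M 1 𝔤) (P : DForm d M (q + 1) 𝔤)
    (Q : DForm d M q 𝔥) : DForm d M (q + 1) 𝔥 :=
  -((-1 : ℝ) ^ q • (extD rfl Q + wedge X.actBilin (by omega) A Q)) - mapForm κ.alphaStar P

theorem smul_sub_eq_zero_iff {E : Type*} [AddCommGroup E] [Module ℝ E] {s : ℝ} (hs : s * s = 1)
    (x y : E) : s • x - y = 0 ↔ x = s • y := by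
  rw [sub_eq_zero]
  constructor
  · rintro rfl
    rw [smul_smul, hs, one_smul]
  · rintro rfl
    rw [smul_smul, hs, one_smul]

theorem neg_one_pow_mul_self (q : ℕ) : (-1 : ℝ) ^ q * (-1) ^ q = 1 := by
  rw [← pow_add, Even.neg_one_pow ⟨q, rfl⟩]

theorem eulerA_eq_zero_iff [FiniteDimensional ℝ 𝔤]  (A : DForm d M 1 𝔤) (B : DForm d M 2 𝔥) (P : DForm d M (q + 1) 𝔤)
    (Q : DForm d M q 𝔥) : eulerA κ A B P Q = 0 ↔
      extD (m := q + 2) rfl P + wedge (bracket 𝔤) (by omega) A P =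
        (-1 : ℝ) ^ q • wedge κ.sigma rfl Q B :=
  smul_sub_eq_zero_iff (neg_one_pow_mul_self q) _ _

theorem eulerB_eq_zero_iff [FiniteDimensional ℝ 𝔥]  (A : DForm d M 1 𝔤) (P : DForm d M (q + 1) 𝔤)
    (Q : DForm d M q 𝔥) : eulerB κ A P Q = 0 ↔
      extD (m := q + 1) rfl Q + wedge X.actBilin (by omega) A Q =
        (-(-1 : ℝ) ^ q) • mapForm κ.alphaStar P := by
  rw [← smul_sub_eq_zero_iff (by rw [neg_mul_neg, neg_one_pow_mul_self]), neg_smul]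
  rfl

end

variable (X : DifferentialCrossedModule 𝔤 𝔥)

/-- The linear part of the variation of `𝓕`. -/
def curvF₁ [FiniteDimensional ℝ 𝔤] (A δA : DForm d M 1 𝔤) (δB : DForm d M 2 𝔥) : DForm d M 2 𝔤 :=
  extD rfl δA + wedge (bracket 𝔤) rfl A δA - mapForm (X.α : 𝔥 →ₗ[ℝ] 𝔤) δB

/-- The linear part of the variation of `𝓖`. -/
def curvG₁ [FiniteDimensional ℝ 𝔥] (A δA : DForm d M 1 𝔤) (B δB : DForm d M 2 𝔥) : DForm d M 3 𝔥 :=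
  extD rfl δB + wedge X.actBilin rfl δA B + wedge X.actBilin rfl A δB

variable [IsManifold (𝓡 d) ∞ M]
variable {A δA : DForm d M 1 𝔤} {B δB : DForm d M 2 𝔥}

theorem curvF_variation [FiniteDimensional ℝ 𝔤] (hA : IsSmoothForm A) (hδA : IsSmoothForm δA) (t : ℝ) :
    curvF X (A + t • δA) (B + t • δB) = quadForm (curvF X A B) (curvF₁ X A δA δB)
      ((1 / 2 : ℝ) • wedge (bracket 𝔤) rfl δA δA) t := by
  -- On 1-forms the bracket wedge is symmetric, so the two cross terms cancel the factor `1/2`.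
  have h1 : wedge (bracket 𝔤) rfl δA A = wedge (bracket 𝔤) (m := 2) rfl A δA := by
    rw [wedge_bracket_comm rfl rfl]
    norm_num
  rw [quadForm, curvF, curvF, curvF₁, extD_add rfl hA (hδA.smul t), extD_smul rfl t hδA,
    mapForm_add, mapForm_smul, wedge_add_right, wedge_add_left, wedge_add_left, wedge_smul_left,
    wedge_smul_left, wedge_smul_right, wedge_smul_right, h1]
  module

theorem curvG_variation [FiniteDimensional ℝ 𝔥] (hB : IsSmoothForm B) (hδB : IsSmoothForm δB) (t : ℝ) :
    curvG X (A + t • δA) (B + t • δB) = quadForm (curvG X A B) (curvG₁ X A δA B δB)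
      (wedge X.actBilin rfl δA δB) t := by
  rw [quadForm, curvG, curvG, curvG₁, extD_add rfl hB (hδB.smul t), extD_smul rfl t hδB,
    wedge_add_right, wedge_add_left, wedge_add_left, wedge_smul_left,
    wedge_smul_left, wedge_smul_right, wedge_smul_right]
  module

theorem isSmoothForm_curvF [FiniteDimensional ℝ 𝔤] (hA : IsSmoothForm A) (hB : IsSmoothForm B) :
    IsSmoothForm (curvF X A B) :=
  ((hA.extD rfl).add ((hA.wedge _ rfl hA).smul _)).sub (hB.mapForm _)

theorem isSmoothForm_curvG [FiniteDimensional ℝ 𝔤] [FiniteDimensional ℝ 𝔥] (hA : IsSmoothForm A) (hB : IsSmoothForm B) :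
    IsSmoothForm (curvG X A B) :=
  (hB.extD rfl).add (hA.wedge _ rfl hB)

theorem isSmoothForm_curvF₁ [FiniteDimensional ℝ 𝔤] (hA : IsSmoothForm A) (hδA : IsSmoothForm δA) (hδB : IsSmoothForm δB) :
    IsSmoothForm (curvF₁ X A δA δB) :=
  ((hδA.extD rfl).add (hA.wedge _ rfl hδA)).sub (hδB.mapForm _)

theorem isSmoothForm_curvG₁ [FiniteDimensional ℝ 𝔤] [FiniteDimensional ℝ 𝔥] (hA : IsSmoothForm A) (hδA : IsSmoothForm δA) (hB : IsSmoothForm B)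
    (hδB : IsSmoothForm δB) : IsSmoothForm (curvG₁ X A δA B δB) :=
  ((hδB.extD rfl).add (hδA.wedge _ rfl hB)).add (hA.wedge _ rfl hδB)

variable {X}

/-- Homogeneity in the pair `(P, Q)` later removes the common factor `-σ/(2e²)` of the two
multipliers. -/
theorem eulerA_smul [FiniteDimensional ℝ 𝔤] (κ : X.InvariantForms)  (A : DForm d M 1 𝔤) (B : DForm d M 2 𝔥) {P : DForm d M (q + 1) 𝔤}
    (Q : DForm d M q 𝔥) (c : ℝ) (hP : IsSmoothForm P) :
    eulerA κ A B (c • P) (c • Q) = c • eulerA κ A B P Q := by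
  rw [eulerA, eulerA, extD_smul _ c hP, wedge_smul_right, wedge_smul_left]
  module

theorem eulerB_smul [FiniteDimensional ℝ 𝔥] (κ : X.InvariantForms)  (A : DForm d M 1 𝔤) (P : DForm d M (q + 1) 𝔤)
    {Q : DForm d M q 𝔥} (c : ℝ) (hQ : IsSmoothForm Q) :
    eulerB κ A (c • P) (c • Q) = c • eulerB κ A P Q := by
  rw [eulerB, eulerB, extD_smul _ c hQ, wedge_smul_right, mapForm_smul]
  module

theorem isSmoothForm_eulerA [FiniteDimensional ℝ 𝔤] [FiniteDimensional ℝ 𝔥] (κ : X.InvariantForms) {A : DForm d M 1 𝔤} {B : DForm d M 2 𝔥} {P : DForm d M (q + 1) 𝔤}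
    {Q : DForm d M q 𝔥} (hA : IsSmoothForm A) (hB : IsSmoothForm B) (hP : IsSmoothForm P)
    (hQ : IsSmoothForm Q) : IsSmoothForm (eulerA κ A B P Q) :=
  (((hP.extD _).add (hA.wedge _ _ hP)).smul _).sub (hQ.wedge _ _ hB)

theorem isSmoothForm_eulerB [FiniteDimensional ℝ 𝔤] [FiniteDimensional ℝ 𝔥] (κ : X.InvariantForms) {A : DForm d M 1 𝔤} {P : DForm d M (q + 1) 𝔤}
    {Q : DForm d M q 𝔥} (hA : IsSmoothForm A) (hP : IsSmoothForm P)
    (hQ : IsSmoothForm Q) : IsSmoothForm (eulerB κ A P Q) := by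
  have h1 := (((hQ.extD (m := q + 1) rfl).add (hA.wedge X.actBilin (by omega) hQ)).smul
    (-(-1 : ℝ) ^ q)).sub (hP.mapForm κ.alphaStar)
  rw [neg_smul] at h1
  exact h1

end CurvatureVariation

/-! ### Equations of motion -/

section EquationsOfMotion

variable {d q k l m : ℕ} {M : Type*} [TopologicalSpace M] [ChartedSpace (Eucl d) M]
  [IsManifold (𝓡 d) ∞ M] [T2Space M] [SigmaCompactSpace M] [OrientedAtlas d M]
  {U V : Type*} [AddCommGroup U] [Module ℝ U] [FiniteDimensional ℝ U]
  [AddCommGroup V] [Module ℝ V] [FiniteDimensional ℝ V]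
  {𝔤 𝔥 : Type*} [LieRing 𝔤] [LieAlgebra ℝ 𝔤] [LieRing 𝔥] [LieAlgebra ℝ 𝔥]
  [FiniteDimensional ℝ 𝔤] [FiniteDimensional ℝ 𝔥]
  {X : DifferentialCrossedModule 𝔤 𝔥} (κ : X.InvariantForms)

theorem integral_neg {D : Set M} (hD : IsCompact D) (θ : DForm d M d ℝ) :
    integral D (-θ) = -integral D θ := by
  have h1 : -θ = (-1 : ℝ) • θ := by module
  rw [h1, integral_smul hD]
  ring

/-- Every term linear in `δA` or `δB` is brought to the form "something paired with the bare
variation": derivatives by integration by parts, algebraic terms by the adjunctions above. -/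
theorem integral_first_variation (hd : q + 3 = d) {A δA : DForm d M 1 𝔤} {B δB : DForm d M 2 𝔥}
    {P : DForm d M (q + 1) 𝔤} {Q : DForm d M q 𝔥} (hA : IsSmoothForm A) (hB : IsSmoothForm B)
    (hP : IsSmoothForm P) (hQ : IsSmoothForm Q) (hδA : IsSmoothForm δA) (hδB : IsSmoothForm δB)
    {D : Set M} (hD : IsCompact D) (hAD : ∀ x ∉ D, δA x = 0) (hBD : ∀ x ∉ D, δB x = 0) :
    integral D (wedge κ.formG (by omega) P (curvF₁ X A δA δB)) +
        integral D (wedge κ.formH (by omega) Q (curvG₁ X A δA B δB)) =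
      integral D (wedge κ.formG (by omega) (eulerA κ A B P Q) δA) +
        integral D (wedge κ.formH (by omega) (eulerB κ A P Q) δB) := by
  have g1 : q + 1 + 2 = d := by omega
  have g2 : q + 2 + 1 = d := by omega
  have g3 : 1 + (q + 1) = q + 2 := by omega
  have g4 : 1 + q = q + 1 := by omega
  have hdP : IsSmoothForm (extD (m := q + 2) rfl P) := hP.extD rfl
  have hAP : IsSmoothForm (wedge (bracket 𝔤) g3 A P) := hA.wedge _ _ hP
  have hdQ : IsSmoothForm (extD (m := q + 1) rfl Q) := hQ.extD rfl
  have hAQ : IsSmoothForm (wedge X.actBilin g4 A Q) := hA.wedge _ _ hQ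
  have hs : IsSmoothForm (wedge κ.sigma rfl Q B) := hQ.wedge _ rfl hB
  have ha := hP.mapForm κ.alphaStar
  -- The degree of `P` is `q + 1`, so parts gives `(-1)^(q+2) = (-1)^q`. For `Q`, of degree `q`, it
  -- gives the opposite sign.
  have e1 : integral D (wedge κ.formG g1 P (extD rfl δA)) =
      (-1) ^ q * integral D (wedge κ.formG g2 (extD rfl P) δA) := by
    rw [integral_wedge_extD κ.formG g1 rfl rfl g2 hP hD hδA hAD, pow_add, pow_add]
    norm_num
  have e2 : integral D (wedge κ.formH hd Q (extD rfl δB)) =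
      -((-1) ^ q * integral D (wedge κ.formH g1 (extD rfl Q) δB)) := by
    rw [integral_wedge_extD κ.formH hd rfl rfl g1 hQ hD hδB hBD, pow_succ]
    ring
  have l1 : integral D (wedge κ.formG g1 P (curvF₁ X A δA δB)) =
      (-1) ^ q * integral D (wedge κ.formG g2 (extD rfl P) δA) +
      (-1) ^ q * integral D (wedge κ.formG g2 (wedge (bracket 𝔤) g3 A P) δA) -
      integral D (wedge κ.formH g1 (mapForm κ.alphaStar P) δB) := by
    have h1 : curvF₁ X A δA δB = extD rfl δA + wedge (bracket 𝔤) rfl A δA +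
      (-1 : ℝ) • mapForm (X.α : 𝔥 →ₗ[ℝ] 𝔤) δB := by
      rw [curvF₁]
      module
    rw [h1, wedge_add_right, wedge_add_right, wedge_smul_right, wedge_formG_bracket κ g1 g2,
      wedge_formG_alpha, integral_add hD ((hP.wedge _ g1 (hδA.extD rfl)).add
        ((hAP.wedge _ g2 hδA).smul _)) ((ha.wedge _ g1 hδB).smul _),
      integral_add hD (hP.wedge _ g1 (hδA.extD rfl)) ((hAP.wedge _ g2 hδA).smul _),
      integral_smul hD, integral_smul hD, e1]
    ring
  have l2 : integral D (wedge κ.formH hd Q (curvG₁ X A δA B δB)) =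
      -((-1) ^ q * integral D (wedge κ.formH g1 (extD rfl Q) δB)) -
      integral D (wedge κ.formG g2 (wedge κ.sigma rfl Q B) δA) -
      (-1) ^ q * integral D (wedge κ.formH g1 (wedge X.actBilin g4 A Q) δB) := by
    have s1 := hQ.wedge κ.formH hd (hδB.extD (m := 3) rfl)
    have s2 := hQ.wedge κ.formH hd (hδA.wedge X.actBilin (m := 3) rfl hB)
    have s3 := hQ.wedge κ.formH hd (hA.wedge X.actBilin (m := 3) rfl hδB)
    rw [curvG₁, wedge_add_right, wedge_add_right, integral_add hD (s1.add s2) s3,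
      integral_add hD s1 s2, e2, wedge_formH_sigma κ hd g2, wedge_formH_act κ hd g1,
      integral_neg hD, integral_neg hD, integral_smul hD]
    ring
  have r1 : integral D (wedge κ.formG g2 (eulerA κ A B P Q) δA) =
      (-1) ^ q * (integral D (wedge κ.formG g2 (extD rfl P) δA) +
        integral D (wedge κ.formG g2 (wedge (bracket 𝔤) g3 A P) δA)) -
      integral D (wedge κ.formG g2 (wedge κ.sigma rfl Q B) δA) := by
    have h1 : eulerA κ A B P Q = (-1 : ℝ) ^ q • (extD rfl P + wedge (bracket 𝔤) g3 A P) +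
        (-1 : ℝ) • wedge κ.sigma rfl Q B := by
      rw [eulerA]
      module
    have s1 := hdP.wedge κ.formG g2 hδA
    have s2 := hAP.wedge κ.formG g2 hδA
    have s3 := hs.wedge κ.formG g2 hδA
    rw [h1, wedge_add_left, wedge_smul_left, wedge_smul_left, wedge_add_left,
      integral_add hD ((s1.add s2).smul _) (s3.smul _), integral_smul hD, integral_smul hD,
      integral_add hD s1 s2]
    ring
  have r2 : integral D (wedge κ.formH g1 (eulerB κ A P Q) δB) =
      -((-1) ^ q * (integral D (wedge κ.formH g1 (extD rfl Q) δB) +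
        integral D (wedge κ.formH g1 (wedge X.actBilin g4 A Q) δB))) -
      integral D (wedge κ.formH g1 (mapForm κ.alphaStar P) δB) := by
    have h1 : eulerB κ A P Q = (-(-1 : ℝ) ^ q) • (extD rfl Q + wedge X.actBilin g4 A Q) +
        (-1 : ℝ) • mapForm κ.alphaStar P := by
      rw [eulerB]
      module
    have s1 := hdQ.wedge κ.formH g1 hδB
    have s2 := hAQ.wedge κ.formH g1 hδB
    have s3 := ha.wedge κ.formH g1 hδB
    rw [h1, wedge_add_left, wedge_smul_left, wedge_smul_left, wedge_add_left,
      integral_add hD ((s1.add s2).smul _) (s3.smul _), integral_smul hD, integral_smul hD,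
      integral_add hD s1 s2]
    ring
  rw [l1, l2, r1, r2]
  ring

/-- The condition that `∫ ⟨P, 𝓕⟩ + ⟨Q, 𝓖⟩` be stationary in `(A, B)`. -/
theorem first_variation_eq_zero_iff (hd : q + 3 = d) {A : DForm d M 1 𝔤} {B : DForm d M 2 𝔥}
    {P : DForm d M (q + 1) 𝔤} {Q : DForm d M q 𝔥} (hA : IsSmoothForm A) (hB : IsSmoothForm B)
    (hP : IsSmoothForm P) (hQ : IsSmoothForm Q) :
    (∀ D : Set M, IsCompact D → ∀ (δA : DForm d M 1 𝔤) (δB : DForm d M 2 𝔥), IsSmoothForm δA →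
      IsSmoothForm δB → (∀ x ∉ D, δA x = 0 ∧ δB x = 0) →
      integral D (wedge κ.formG (by omega) P (curvF₁ X A δA δB)) +
        integral D (wedge κ.formH (by omega) Q (curvG₁ X A δA B δB)) = 0) ↔
      eulerA κ A B P Q = 0 ∧ eulerB κ A P Q = 0 := by
  refine ⟨fun H => ⟨?_, ?_⟩, fun H D hD δA δB hδA hδB h0 => ?_⟩
  · refine eq_zero_of_integral_wedge_eq_zero κ.formG (formG_left_nondegenerate κ)
      (by omega : q + 2 + 1 = d)
      (isSmoothForm_eulerA κ hA hB hP hQ) fun D hD δA hδA h0 => ?_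
    have h1 := H D hD δA 0 hδA isSmoothForm_zero fun x hx => ⟨h0 x hx, rfl⟩
    rwa [integral_first_variation κ hd hA hB hP hQ hδA isSmoothForm_zero hD h0 fun _ _ => rfl,
      wedge_zero_right, integral_zero hD, add_zero] at h1
  · refine eq_zero_of_integral_wedge_eq_zero κ.formH (formH_left_nondegenerate κ)
      (by omega : q + 1 + 2 = d)
      (isSmoothForm_eulerB κ hA hP hQ) fun D hD δB hδB h0 => ?_
    have h1 := H D hD 0 δB isSmoothForm_zero hδB fun x hx => ⟨rfl, h0 x hx⟩
    rwa [integral_first_variation κ hd hA hB hP hQ isSmoothForm_zero hδB hD (fun _ _ => rfl) h0,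
      wedge_zero_right, integral_zero hD, zero_add] at h1
  · rw [integral_first_variation κ hd hA hB hP hQ hδA hδB hD (fun x hx => (h0 x hx).1)
      (fun x hx => (h0 x hx).2), H.1, H.2, wedge_zero_left, wedge_zero_left, integral_zero hD,
      add_zero]

variable {σ : ℝ} (g : Metric d M σ) (e : ℝ)

/-- The product rule for each of the four terms. By symmetry of the star pairing, `⟨P, *δP⟩ + ⟨δP,
*P⟩ = 2⟨δP, *P⟩`, which is the source of the coefficient `2e²`. -/
theorem hasDerivAt_action2BFYM (hσ : σ = 1 ∨ σ = -1) (hd : q + 3 = d) {A δA : DForm d M 1 𝔤}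
    {B δB : DForm d M 2 𝔥} {P δP : DForm d M (q + 1) 𝔤} {Q δQ : DForm d M q 𝔥}
    (hA : IsSmoothForm A) (hB : IsSmoothForm B)
    (hP : IsSmoothForm P) (hQ : IsSmoothForm Q) (hδA : IsSmoothForm δA) (hδB : IsSmoothForm δB)
    (hδP : IsSmoothForm δP) (hδQ : IsSmoothForm δQ) {D : Set M} (hD : IsCompact D) :
    HasDerivAt (fun t : ℝ => action2BFYM κ g e hd D (A + t • δA) (B + t • δB)
      (P + t • δP) (Q + t • δQ))
      (integral D (wedge κ.formG (by omega) P (curvF₁ X A δA δB)) +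
        integral D (wedge κ.formH (by omega) Q (curvG₁ X A δA B δB)) +
        integral D (wedge κ.formG (by omega) δP
          (curvF X A B + (2 * e ^ 2) • hodge g (m := 2) (by omega) P)) +
        integral D (wedge κ.formH (by omega) δQ
          (curvG X A B + (2 * e ^ 2) • hodge g (m := 3) (by omega) Q))) 0 := by
  have d0 : 0 < d := by omega
  have g1 : q + 1 + 2 = d := by omega
  have hF := isSmoothForm_curvF X hA hB
  have hG := isSmoothForm_curvG X hA hB
  have hF₁ := isSmoothForm_curvF₁ X hA hδA hδB
  have hG₁ := isSmoothForm_curvG₁ X hA hδA hB hδB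
  have hF₂ := (hδA.wedge (bracket 𝔤) (m := 2) rfl hδA).smul (1 / 2)
  have hG₂ := hδA.wedge X.actBilin (m := 3) rfl hδB
  have hsP := hP.hodge g hσ d0 g1
  have hsQ := hQ.hodge g hσ d0 hd
  have hsδP := hδP.hodge g hσ d0 g1
  have hsδQ := hδQ.hodge g hσ d0 hd
  have z1 : IsSmoothForm (0 : DForm d M (q + 1) 𝔤) := isSmoothForm_zero
  have z2 : IsSmoothForm (0 : DForm d M q 𝔥) := isSmoothForm_zero
  have z3 := z1.hodge g hσ d0 g1
  have z4 := z2.hodge g hσ d0 hd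
  have t1 := hasDerivAt_integral_wedge_quadForm κ.formG g1 hD hP hδP z1 hF hF₁ hF₂
  have t2 := hasDerivAt_integral_wedge_quadForm κ.formG g1 hD hP hδP z1 hsP hsδP z3
  have t3 := hasDerivAt_integral_wedge_quadForm κ.formH hd hD hQ hδQ z2 hG hG₁ hG₂
  have t4 := hasDerivAt_integral_wedge_quadForm κ.formH hd hD hQ hδQ z2 hsQ hsδQ z4
  have key := ((t1.fun_add (t2.const_mul (e ^ 2))).fun_add t3).fun_add (t4.const_mul (e ^ 2))
  have e1 : (fun t : ℝ => action2BFYM κ g e hd D (A + t • δA) (B + t • δB)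
      (P + t • δP) (Q + t • δQ)) = fun t =>
        integral D (wedge κ.formG g1 (quadForm P δP 0 t) (quadForm (curvF X A B)
          (curvF₁ X A δA δB) ((1 / 2 : ℝ) • wedge (bracket 𝔤) rfl δA δA) t)) +
        e ^ 2 * integral D (wedge κ.formG g1 (quadForm P δP 0 t)
          (quadForm (hodge g g1 P) (hodge g g1 δP) (hodge g g1 0) t)) +
        integral D (wedge κ.formH hd (quadForm Q δQ 0 t) (quadForm (curvG X A B)
          (curvG₁ X A δA B δB) (wedge X.actBilin rfl δA δB) t)) +
        e ^ 2 * integral D (wedge κ.formH hd (quadForm Q δQ 0 t)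
          (quadForm (hodge g hd Q) (hodge g hd δQ) (hodge g hd 0) t)) := by
    funext t
    have hPt := hP.quadForm hδP z1 t
    have hQt := hQ.quadForm hδQ z2 t
    have s1 := hPt.wedge κ.formG g1 (hF.quadForm hF₁ hF₂ t)
    have s2 := hPt.wedge κ.formG g1 (hsP.quadForm hsδP z3 t)
    have s3 := hQt.wedge κ.formH hd (hG.quadForm hG₁ hG₂ t)
    have s4 := hQt.wedge κ.formH hd (hsQ.quadForm hsδQ z4 t)
    rw [action2BFYM, lagrangian2BFYM, curvF_variation X hA hδA, curvG_variation X hB hδB,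
      add_smul_eq_quadForm P, add_smul_eq_quadForm Q, hodge_quadForm, hodge_quadForm,
      integral_add hD ((s1.add (s2.smul _)).add s3) (s4.smul _),
      integral_add hD (s1.add (s2.smul _)) s3, integral_add hD s1 (s2.smul _),
      integral_smul hD, integral_smul hD]
  rw [e1]
  refine key.congr_deriv ?_
  have w1 := hδP.wedge κ.formG g1 hF
  have w2 := hδP.wedge κ.formG g1 hsP
  have w3 := hδQ.wedge κ.formH hd hG
  have w4 := hδQ.wedge κ.formH hd hsQ
  have c1 : wedge κ.formG g1 P (hodge g g1 δP) = wedge κ.formG g1 δP (hodge g g1 P) := by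
    rw [wedge_hodge_symm g κ.formG g1 g1 g1, flip_formG]
  have c2 : wedge κ.formH hd Q (hodge g hd δQ) = wedge κ.formH hd δQ (hodge g hd Q) := by
    rw [wedge_hodge_symm g κ.formH hd hd hd, flip_formH]
  rw [wedge_add_right, wedge_add_right, wedge_smul_right, wedge_smul_right,
    integral_add hD w1 (w2.smul _), integral_add hD w3 (w4.smul _), integral_smul hD,
    integral_smul hD, c1, c2]
  ring

end EquationsOfMotion

/-! ### Elimination of the multipliers and the Euler–Lagrange equations of both theories. -/

section Equivalence

variable {d q k l m : ℕ} {M : Type*} [TopologicalSpace M] [ChartedSpace (Eucl d) M]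
  [OrientedAtlas d M]
  {𝔤 𝔥 : Type*} [LieRing 𝔤] [LieAlgebra ℝ 𝔤] [LieRing 𝔥] [LieAlgebra ℝ 𝔥]
  [FiniteDimensional ℝ 𝔤] [FiniteDimensional ℝ 𝔥]
  {X : DifferentialCrossedModule 𝔤 𝔥} (κ : X.InvariantForms) {σ : ℝ} (g : Metric d M σ) (e : ℝ)

theorem neg_one_pow_of_add_three (hd : q + 3 = d) : (-1 : ℝ) ^ d = -(-1) ^ q := by
  rw [← hd, pow_add]
  norm_num

theorem fieldEquations2BFYM_iff (hd : q + 3 = d) (A : DForm d M 1 𝔤) (B : DForm d M 2 𝔥)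
    (P : DForm d M (q + 1) 𝔤) (Q : DForm d M q 𝔥) :
    FieldEquations2BFYM κ g e hd A B P Q ↔
      (curvF X A B + (2 * e ^ 2) • hodge g (m := 2) (by omega) P = 0 ∧
        curvG X A B + (2 * e ^ 2) • hodge g (m := 3) (by omega) Q = 0) ∧
      (eulerA κ A B P Q = 0 ∧ eulerB κ A P Q = 0) := by
  rw [eulerA_eq_zero_iff, eulerB_eq_zero_iff, FieldEquations2BFYM, pow_succ (-1) d,
    neg_one_pow_of_add_three hd, neg_mul_neg, mul_one, and_assoc]

section

variable [IsManifold (𝓡 d) ∞ M]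

/-- The factor `(-1)^q` on `*𝓖` is the one produced by the variation of the 2YM action. It cancels
the sign in the first equation and divides out of the second. -/
theorem fieldEquations2YM_iff (hσ : σ = 1 ∨ σ = -1) (hd : q + 3 = d) {A : DForm d M 1 𝔤}
    {B : DForm d M 2 𝔥} (hA : IsSmoothForm A) (hB : IsSmoothForm B) :
    FieldEquations2YM κ g hd A B ↔
      eulerA κ A B (hodge g (m := q + 1) (by omega) (curvF X A B))
        ((-1 : ℝ) ^ q • hodge g (m := q) (by omega) (curvG X A B)) = 0 ∧
      eulerB κ A (hodge g (m := q + 1) (by omega) (curvF X A B))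
        ((-1 : ℝ) ^ q • hodge g (m := q) (by omega) (curvG X A B)) = 0 := by
  have hsG : IsSmoothForm (hodge g (m := q) (by omega) (curvG X A B)) :=
    (isSmoothForm_curvG X hA hB).hodge g hσ (by omega) (by omega)
  rw [eulerA_eq_zero_iff, eulerB_eq_zero_iff, wedge_smul_left, smul_smul, neg_one_pow_mul_self,
    one_smul, extD_smul _ _ hsG, wedge_smul_right, ← smul_add]
  refine and_congr Iff.rfl ?_
  rw [neg_smul, ← smul_neg]
  exact (smul_right_injective _ (pow_ne_zero q (by norm_num : (-1 : ℝ) ≠ 0))).eq_iff.symm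

end

/-- Apply the star to `F = -2e² *P` and use `** = σ (-1)^(km)` together with `σ² = 1`. -/
theorem multiplier_eq_of_fieldEquations (hσ : σ = 1 ∨ σ = -1) (he : e ≠ 0) (hd : 0 < d)
    {W : Type*} [AddCommGroup W] [Module ℝ W] (h : k + m = d) (h' : m + k = d)
    {F : DForm d M m W} {P : DForm d M k W} (H : F + (2 * e ^ 2) • hodge g h P = 0) :
    P = (-((-1) ^ (k * m) * (σ / (2 * e ^ 2)))) • hodge g h' F := by
  have hσ2 : σ * σ = 1 := by rcases hσ with rfl | rfl <;> norm_num
  rw [eq_neg_of_add_eq_zero_left H, ← neg_smul, hodge_smul, hodge_hodge g hσ hd, smul_smul,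
    smul_smul]
  have h1 : -((-1) ^ (k * m) * (σ / (2 * e ^ 2))) * -(2 * e ^ 2) * (σ * (-1) ^ (k * m)) =
      (((-1) ^ (k * m) * (-1) ^ (k * m)) * (σ * σ)) * (e ^ 2 / e ^ 2) := by ring
  rw [h1, neg_one_pow_mul_self, hσ2, div_self (pow_ne_zero 2 he), one_mul, one_mul, one_smul]

/-- The converse computation: the prescribed multiplier does solve `F + 2e² *P = 0`. -/
theorem two_smul_hodge_multiplier (hσ : σ = 1 ∨ σ = -1) (he : e ≠ 0) (hd : 0 < d)
    {W : Type*} [AddCommGroup W] [Module ℝ W] (h : k + m = d) (h' : m + k = d)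
    (F : DForm d M m W) {c : ℝ} (hc : c = -((-1) ^ (k * m) * (σ / (2 * e ^ 2)))) :
    (2 * e ^ 2) • hodge g h (c • hodge g h' F) = -F := by
  have hσ2 : σ * σ = 1 := by rcases hσ with rfl | rfl <;> norm_num
  rw [hodge_smul, hodge_hodge g hσ hd, smul_smul, smul_smul, hc, mul_comm m k]
  have h1 : 2 * e ^ 2 * -((-1) ^ (k * m) * (σ / (2 * e ^ 2))) * (σ * (-1) ^ (k * m)) =
      -((((-1) ^ (k * m) * (-1) ^ (k * m)) * (σ * σ)) * (e ^ 2 / e ^ 2)) := by ring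
  rw [h1, neg_one_pow_mul_self, hσ2, div_self (pow_ne_zero 2 he), one_mul, one_mul, neg_smul,
    one_smul]

theorem neg_one_pow_multiplierG (q : ℕ) : (-1 : ℝ) ^ ((q + 1) * 2) = 1 :=
  Even.neg_one_pow ⟨q + 1, by ring⟩

theorem neg_one_pow_multiplierH (q : ℕ) : (-1 : ℝ) ^ (q * 3) = (-1) ^ q := by
  have : q * 3 = q + q + q := by ring
  rw [this, pow_add, pow_add, neg_one_pow_mul_self, one_mul]

/-- Eliminating a Lagrange multiplier from `⟨P, F⟩ + e² ⟨P, *P⟩`. -/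
theorem wedge_multiplier (hσ : σ = 1 ∨ σ = -1) (he : e ≠ 0) (hd : 0 < d)
    {W : Type*} [AddCommGroup W] [Module ℝ W] (γ : W →ₗ[ℝ] W →ₗ[ℝ] ℝ) (hγ : γ.flip = γ)
    (h : k + m = d) (h' : m + k = d) (F : DForm d M m W) {c : ℝ}
    (hc : c = -((-1) ^ (k * m) * (σ / (2 * e ^ 2)))) :
    wedge γ h (c • hodge g h' F) F +
      e ^ 2 • wedge γ h (c • hodge g h' F) (hodge g h (c • hodge g h' F)) =
      (-(σ / (4 * e ^ 2))) • wedge γ h' F (hodge g h' F) := by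
  -- For the multiplier `P`, `e²⟨P, *P⟩ = ½⟨P, 2e² *P⟩ = -½⟨P, F⟩`. Half of `⟨P, F⟩` survives, which
  -- turns `σ/(2e²)` into `σ/(4e²)`.
  have h1 : e ^ 2 • wedge γ h (c • hodge g h' F) (hodge g h (c • hodge g h' F)) =
      (1 / 2 : ℝ) • wedge γ h (c • hodge g h' F) ((2 * e ^ 2) • hodge g h (c • hodge g h' F)) := by
    rw [wedge_smul_right γ h (2 * e ^ 2), smul_smul]
    congr 1
    ring
  have h2 : -F = (-1 : ℝ) • F := by module
  rw [h1, two_smul_hodge_multiplier g e hσ he hd h h' F hc, h2, wedge_smul_right, wedge_smul_left,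
    wedge_comm γ h h', hγ, hc, smul_smul, smul_smul, smul_smul, ← add_smul]
  congr 1
  have h3 := neg_one_pow_mul_self (k * m)
  linear_combination (-(σ / (4 * e ^ 2))) * h3

variable {κ} in
theorem lagrangian_multiplier (hσ : σ = 1 ∨ σ = -1) (he : e ≠ 0) (hd : q + 3 = d)
    (A : DForm d M 1 𝔤) (B : DForm d M 2 𝔥) :
    lagrangian2BFYM κ g e hd A B ((-(σ / (2 * e ^ 2))) • hodge g (by omega) (curvF X A B))
      (((-1) ^ d * (σ / (2 * e ^ 2))) • hodge g (by omega) (curvG X A B)) =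
      lagrangian2YM κ g e hd A B := by
  have h1 := wedge_multiplier g e hσ he (by omega) κ.formG (flip_formG κ) (k := q + 1) (m := 2)
    (by omega) (by omega) (curvF X A B) (c := -(σ / (2 * e ^ 2)))
    (by rw [neg_one_pow_multiplierG, one_mul])
  have h2 := wedge_multiplier g e hσ he (by omega) κ.formH (flip_formH κ) (k := q) (m := 3)
    (by omega) (by omega) (curvG X A B) (c := (-1) ^ d * (σ / (2 * e ^ 2)))
    (by rw [neg_one_pow_multiplierH, neg_one_pow_of_add_three hd, neg_mul])
  rw [lagrangian2BFYM, lagrangian2YM, smul_add, ← h1, ← h2]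
  abel

variable [IsManifold (𝓡 d) ∞ M]

/-- The first two equations become identities. The other two are the Euler expressions at `-σ/(2e²)`
times `(*𝓕, (-1)^q *𝓖)`, and the nonzero scalar drops out. -/
theorem fieldEquations_multiplier_iff (hσ : σ = 1 ∨ σ = -1) (he : e ≠ 0) (hd : q + 3 = d)
    {A : DForm d M 1 𝔤} {B : DForm d M 2 𝔥} (hA : IsSmoothForm A) (hB : IsSmoothForm B) :
    FieldEquations2BFYM κ g e hd A B ((-(σ / (2 * e ^ 2))) • hodge g (by omega) (curvF X A B))
      (((-1) ^ d * (σ / (2 * e ^ 2))) • hodge g (by omega) (curvG X A B)) ↔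
      FieldEquations2YM κ g hd A B := by
  have hsF : IsSmoothForm (hodge g (m := q + 1) (by omega) (curvF X A B)) :=
    (isSmoothForm_curvF X hA hB).hodge g hσ (by omega) (by omega)
  have hsG : IsSmoothForm (hodge g (m := q) (by omega) (curvG X A B)) :=
    (isSmoothForm_curvG X hA hB).hodge g hσ (by omega) (by omega)
  have h1 := two_smul_hodge_multiplier g e hσ he (by omega) (k := q + 1) (m := 2)
    (by omega) (by omega) (curvF X A B) (c := -(σ / (2 * e ^ 2)))
    (by rw [neg_one_pow_multiplierG, one_mul])
  have h2 := two_smul_hodge_multiplier g e hσ he (by omega) (k := q) (m := 3)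
    (by omega) (by omega) (curvG X A B) (c := (-1) ^ d * (σ / (2 * e ^ 2)))
    (by rw [neg_one_pow_multiplierH, neg_one_pow_of_add_three hd, neg_mul])
  rw [fieldEquations2BFYM_iff, fieldEquations2YM_iff κ g hσ hd hA hB, h1, h2, add_neg_cancel,
    add_neg_cancel]
  have h3 : (-1) ^ d * (σ / (2 * e ^ 2)) = -(σ / (2 * e ^ 2)) * (-1) ^ q := by
    rw [neg_one_pow_of_add_three hd]
    ring
  have hc : -(σ / (2 * e ^ 2)) ≠ 0 := by
    rcases hσ with rfl | rfl <;> simp [he]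
  rw [h3, ← smul_smul, eulerA_smul κ A B _ _ hsF, eulerB_smul κ A _ _ (hsG.smul _),
    smul_eq_zero_iff_right hc, smul_eq_zero_iff_right hc]
  simp

variable [T2Space M] [SigmaCompactSpace M]

/-- The derivative always exists and is known, so criticality says that it vanishes. Varying `B̄`
alone, `C̄` alone, and `(A, B)` together separates the equations. -/
theorem isCritical2BFYM_iff (hσ : σ = 1 ∨ σ = -1) (hd : q + 3 = d) {A : DForm d M 1 𝔤}
    {B : DForm d M 2 𝔥} {P : DForm d M (q + 1) 𝔤} {Q : DForm d M q 𝔥} (hA : IsSmoothForm A)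
    (hB : IsSmoothForm B) (hP : IsSmoothForm P) (hQ : IsSmoothForm Q) :
    IsCritical2BFYM κ g e hd A B P Q ↔ FieldEquations2BFYM κ g e hd A B P Q := by
  have g1 : q + 1 + 2 = d := by omega
  have g1' : 2 + (q + 1) = d := by omega
  have g2 : 3 + q = d := by omega
  have hEF : IsSmoothForm (curvF X A B + (2 * e ^ 2) • hodge g g1 P) :=
    (isSmoothForm_curvF X hA hB).add ((hP.hodge g hσ (by omega) g1).smul _)
  have hEG : IsSmoothForm (curvG X A B + (2 * e ^ 2) • hodge g hd Q) :=
    (isSmoothForm_curvG X hA hB).add ((hQ.hodge g hσ (by omega) hd).smul _)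
  rw [fieldEquations2BFYM_iff, ← first_variation_eq_zero_iff κ hd hA hB hP hQ]
  refine ⟨fun H => ⟨⟨?_, ?_⟩, fun D hD δA δB hδA hδB h0 => ?_⟩,
    fun H D hD δA δB δP δQ hδA hδB hδP hδQ h0 => ?_⟩
  · refine eq_zero_of_integral_wedge_eq_zero κ.formG (formG_left_nondegenerate κ) g1' hEF
      fun D hD b hb h0 => ?_
    have h1 := (H D hD 0 0 b 0 isSmoothForm_zero isSmoothForm_zero hb isSmoothForm_zero
      fun x hx => ⟨rfl, rfl, h0 x hx, rfl⟩).unique (hasDerivAt_action2BFYM κ g e hσ hd hA hB hP hQ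
        isSmoothForm_zero isSmoothForm_zero hb isSmoothForm_zero hD)
    rw [integral_first_variation κ hd hA hB hP hQ isSmoothForm_zero isSmoothForm_zero hD
      (fun _ _ => rfl) (fun _ _ => rfl), wedge_zero_right, wedge_zero_right, wedge_zero_left,
      integral_zero hD, add_zero, add_zero, zero_add] at h1
    -- The fundamental lemma has the test form on the right, whereas the variation has it on the
    -- left; graded commutativity exchanges them.
    rw [wedge_comm κ.formG g1' g1, flip_formG, integral_smul hD, ← h1, mul_zero]
  · refine eq_zero_of_integral_wedge_eq_zero κ.formH (formH_left_nondegenerate κ) g2 hEG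
      fun D hD b hb h0 => ?_
    have h1 := (H D hD 0 0 0 b isSmoothForm_zero isSmoothForm_zero isSmoothForm_zero hb
      fun x hx => ⟨rfl, rfl, rfl, h0 x hx⟩).unique (hasDerivAt_action2BFYM κ g e hσ hd hA hB hP hQ
        isSmoothForm_zero isSmoothForm_zero isSmoothForm_zero hb hD)
    rw [integral_first_variation κ hd hA hB hP hQ isSmoothForm_zero isSmoothForm_zero hD
      (fun _ _ => rfl) (fun _ _ => rfl), wedge_zero_right, wedge_zero_right, wedge_zero_left,
      integral_zero hD, add_zero, add_zero, zero_add] at h1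
    rw [wedge_comm κ.formH g2 hd, flip_formH, integral_smul hD, ← h1, mul_zero]
  · have h1 := (H D hD δA δB 0 0 hδA hδB isSmoothForm_zero isSmoothForm_zero
      fun x hx => ⟨(h0 x hx).1, (h0 x hx).2, rfl, rfl⟩).unique
      (hasDerivAt_action2BFYM κ g e hσ hd hA hB hP hQ
        hδA hδB isSmoothForm_zero isSmoothForm_zero hD)
    rw [wedge_zero_left, wedge_zero_left, integral_zero hD, add_zero, add_zero] at h1
    exact h1.symm
  · have h1 := hasDerivAt_action2BFYM κ g e hσ hd hA hB hP hQ hδA hδB hδP hδQ hD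
    rw [H.2 D hD δA δB hδA hδB fun x hx => ⟨(h0 x hx).1, (h0 x hx).2.1⟩, H.1.1, H.1.2,
      wedge_zero_right, wedge_zero_right, integral_zero hD, add_zero, add_zero] at h1
    exact h1

/-- Symmetry of the star pairing makes the two product-rule terms equal, which turns `σ/(4e²)` into
`σ/(2e²)`. Moving the starred form to the left costs `(-1)^(2(q+1)) = 1` for `𝓕` and `(-1)^(3q) =
(-1)^q` for `𝓖`. -/
theorem hasDerivAt_action2YM (hσ : σ = 1 ∨ σ = -1) (hd : q + 3 = d) {A δA : DForm d M 1 𝔤}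
    {B δB : DForm d M 2 𝔥} (hA : IsSmoothForm A) (hB : IsSmoothForm B) (hδA : IsSmoothForm δA)
    (hδB : IsSmoothForm δB) {D : Set M} (hD : IsCompact D) :
    HasDerivAt (fun t : ℝ => action2YM κ g e hd D (A + t • δA) (B + t • δB))
      (-(σ / (2 * e ^ 2)) *
        (integral D (wedge κ.formG (by omega) (hodge g (m := q + 1) (by omega) (curvF X A B))
          (curvF₁ X A δA δB)) +
        integral D (wedge κ.formH (by omega)
          ((-1 : ℝ) ^ q • hodge g (m := q) (by omega) (curvG X A B)) (curvG₁ X A δA B δB)))) 0 := by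
  have d0 : 0 < d := by omega
  have g1 : q + 1 + 2 = d := by omega
  have g1' : 2 + (q + 1) = d := by omega
  have g2 : 3 + q = d := by omega
  have hF := isSmoothForm_curvF X hA hB
  have hG := isSmoothForm_curvG X hA hB
  have hF₁ := isSmoothForm_curvF₁ X hA hδA hδB
  have hG₁ := isSmoothForm_curvG₁ X hA hδA hB hδB
  have hF₂ := (hδA.wedge (bracket 𝔤) (m := 2) rfl hδA).smul (1 / 2)
  have hG₂ := hδA.wedge X.actBilin (m := 3) rfl hδB
  have hsF := hF.hodge g hσ d0 g1'
  have hsG := hG.hodge g hσ d0 g2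
  have hsF₁ := hF₁.hodge g hσ d0 g1'
  have hsG₁ := hG₁.hodge g hσ d0 g2
  have hsF₂ := hF₂.hodge g hσ d0 g1'
  have hsG₂ := hG₂.hodge g hσ d0 g2
  have t1 := hasDerivAt_integral_wedge_quadForm κ.formG g1' hD hF hF₁ hF₂ hsF hsF₁ hsF₂
  have t2 := hasDerivAt_integral_wedge_quadForm κ.formH g2 hD hG hG₁ hG₂ hsG hsG₁ hsG₂
  have key := (t1.fun_add t2).const_mul (-(σ / (4 * e ^ 2)))
  have e1 : (fun t : ℝ => action2YM κ g e hd D (A + t • δA) (B + t • δB)) = fun t =>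
      -(σ / (4 * e ^ 2)) * (integral D (wedge κ.formG g1' (quadForm (curvF X A B)
          (curvF₁ X A δA δB) ((1 / 2 : ℝ) • wedge (bracket 𝔤) rfl δA δA) t)
          (quadForm (hodge g g1' (curvF X A B)) (hodge g g1' (curvF₁ X A δA δB))
            (hodge g g1' ((1 / 2 : ℝ) • wedge (bracket 𝔤) rfl δA δA)) t)) +
        integral D (wedge κ.formH g2 (quadForm (curvG X A B)
          (curvG₁ X A δA B δB) (wedge X.actBilin rfl δA δB) t)
          (quadForm (hodge g g2 (curvG X A B)) (hodge g g2 (curvG₁ X A δA B δB))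
            (hodge g g2 (wedge X.actBilin rfl δA δB)) t))) := by
    funext t
    rw [action2YM, lagrangian2YM, curvF_variation X hA hδA, curvG_variation X hB hδB,
      hodge_quadForm, hodge_quadForm, integral_smul hD, integral_add hD
        ((hF.quadForm hF₁ hF₂ t).wedge κ.formG g1' (hsF.quadForm hsF₁ hsF₂ t))
        ((hG.quadForm hG₁ hG₂ t).wedge κ.formH g2 (hsG.quadForm hsG₁ hsG₂ t))]
  rw [e1]
  refine key.congr_deriv ?_
  rw [wedge_hodge_symm g κ.formG g1' g1' g1' (curvF X A B), flip_formG,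
    wedge_hodge_symm g κ.formH g2 g2 g2 (curvG X A B), flip_formH,
    wedge_comm κ.formG g1' g1 (curvF₁ X A δA δB), flip_formG, mul_comm 2 (q + 1),
    neg_one_pow_multiplierG, one_smul, wedge_comm κ.formH g2 hd (curvG₁ X A δA B δB), flip_formH,
    mul_comm 3 q, neg_one_pow_multiplierH, wedge_smul_left]
  ring

theorem isCritical2YM_iff (hσ : σ = 1 ∨ σ = -1) (he : e ≠ 0) (hd : q + 3 = d)
    {A : DForm d M 1 𝔤} {B : DForm d M 2 𝔥} (hA : IsSmoothForm A) (hB : IsSmoothForm B) :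
    IsCritical2YM κ g e hd A B ↔ FieldEquations2YM κ g hd A B := by
  have hsF : IsSmoothForm (hodge g (m := q + 1) (by omega) (curvF X A B)) :=
    (isSmoothForm_curvF X hA hB).hodge g hσ (by omega) (by omega)
  have hsG : IsSmoothForm (hodge g (m := q) (by omega) (curvG X A B)) :=
    (isSmoothForm_curvG X hA hB).hodge g hσ (by omega) (by omega)
  have hc : -(σ / (2 * e ^ 2)) ≠ 0 := by
    rcases hσ with rfl | rfl <;> simp [he]
  rw [fieldEquations2YM_iff κ g hσ hd hA hB,
    ← first_variation_eq_zero_iff κ hd hA hB hsF (hsG.smul _)]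
  refine ⟨fun H D hD δA δB hδA hδB h0 => ?_, fun H D hD δA δB hδA hδB h0 => ?_⟩
  · have h1 := (H D hD δA δB hδA hδB h0).unique
      (hasDerivAt_action2YM κ g e hσ hd hA hB hδA hδB hD)
    exact (mul_eq_zero.1 h1.symm).resolve_left hc
  · have h1 := hasDerivAt_action2YM κ g e hσ hd hA hB hδA hδB hD
    rwa [H D hD δA δB hδA hδB h0, mul_zero] at h1

end Equivalence

end HigherGauge

end

open HigherGauge in
open scoped Manifold ContDiff in
theorem mainTheorem1 {d q : ℕ} (hd : q + 3 = d)
    {M : Type*} [TopologicalSpace M] [ChartedSpace (EuclideanSpace ℝ (Fin d)) M]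
    [IsManifold (𝓡 d) ∞ M] [T2Space M] [SigmaCompactSpace M] [OrientedAtlas d M]
    {𝔤 𝔥 : Type*} [LieRing 𝔤] [LieAlgebra ℝ 𝔤] [FiniteDimensional ℝ 𝔤]
    [LieRing 𝔥] [LieAlgebra ℝ 𝔥] [FiniteDimensional ℝ 𝔥]
    (X : DifferentialCrossedModule 𝔤 𝔥) (κ : X.InvariantForms)
    {σ : ℝ} (hσ : σ = 1 ∨ σ = -1) (g : Metric d M σ) {e : ℝ} (he : e ≠ 0) :
    -- the Euler–Lagrange equations of the 2BFYM action
    (∀ (A : DForm d M 1 𝔤) (B : DForm d M 2 𝔥) (Bbar : DForm d M (q + 1) 𝔤) (Cbar : DForm d M q 𝔥),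
      IsSmoothForm A → IsSmoothForm B → IsSmoothForm Bbar → IsSmoothForm Cbar →
      (IsCritical2BFYM κ g e hd A B Bbar Cbar ↔ FieldEquations2BFYM κ g e hd A B Bbar Cbar)) ∧
    -- they force the values of the Lagrange multipliers
    (∀ (A : DForm d M 1 𝔤) (B : DForm d M 2 𝔥) (Bbar : DForm d M (q + 1) 𝔤) (Cbar : DForm d M q 𝔥),
      FieldEquations2BFYM κ g e hd A B Bbar Cbar →
      Bbar = (-(σ / (2 * e ^ 2))) • hodge g (by omega) (curvF X A B) ∧
      Cbar = ((-1) ^ d * (σ / (2 * e ^ 2))) • hodge g (by omega) (curvG X A B)) ∧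
    -- substituting these values gives the 2YM field equations, Lagrangian and action
    (∀ (A : DForm d M 1 𝔤) (B : DForm d M 2 𝔥) (Bbar : DForm d M (q + 1) 𝔤) (Cbar : DForm d M q 𝔥),
      IsSmoothForm A → IsSmoothForm B →
      Bbar = (-(σ / (2 * e ^ 2))) • hodge g (by omega) (curvF X A B) →
      Cbar = ((-1) ^ d * (σ / (2 * e ^ 2))) • hodge g (by omega) (curvG X A B) →
      (FieldEquations2BFYM κ g e hd A B Bbar Cbar ↔ FieldEquations2YM κ g hd A B) ∧
      lagrangian2BFYM κ g e hd A B Bbar Cbar = lagrangian2YM κ g e hd A B ∧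
      ∀ D : Set M, IsClosed D →
        action2BFYM κ g e hd D A B Bbar Cbar = action2YM κ g e hd D A B) ∧
    -- the 2YM field equations are the Euler–Lagrange equations of the 2YM action
    (∀ (A : DForm d M 1 𝔤) (B : DForm d M 2 𝔥), IsSmoothForm A → IsSmoothForm B →
      (IsCritical2YM κ g e hd A B ↔ FieldEquations2YM κ g hd A B)) ∧
    -- the solution spaces of the two theories correspond bijectively
    Set.BijOn (fun φ => (φ.1, φ.2.1)) (solutions2BFYM κ g e hd) (solutions2YM κ g e hd) := by
  have h₁ : ∀ (A : DForm d M 1 𝔤) (B : DForm d M 2 𝔥) (Bbar : DForm d M (q + 1) 𝔤)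
      (Cbar : DForm d M q 𝔥), IsSmoothForm A → IsSmoothForm B → IsSmoothForm Bbar →
      IsSmoothForm Cbar →
      (IsCritical2BFYM κ g e hd A B Bbar Cbar ↔ FieldEquations2BFYM κ g e hd A B Bbar Cbar) :=
    fun A B P Q hA hB hP hQ => isCritical2BFYM_iff κ g e hσ hd hA hB hP hQ
  have h₂ : ∀ (A : DForm d M 1 𝔤) (B : DForm d M 2 𝔥) (Bbar : DForm d M (q + 1) 𝔤)
      (Cbar : DForm d M q 𝔥), FieldEquations2BFYM κ g e hd A B Bbar Cbar →
      Bbar = (-(σ / (2 * e ^ 2))) • hodge g (by omega) (curvF X A B) ∧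
      Cbar = ((-1) ^ d * (σ / (2 * e ^ 2))) • hodge g (by omega) (curvG X A B) := by
    intro A B P Q H
    have hP := multiplier_eq_of_fieldEquations g e hσ he (by omega) (by omega) (by omega) H.1
    have hQ := multiplier_eq_of_fieldEquations g e hσ he (by omega) (by omega) (by omega) H.2.1
    rw [neg_one_pow_multiplierG, one_mul] at hP
    rw [neg_one_pow_multiplierH, ← neg_mul, ← neg_one_pow_of_add_three hd] at hQ
    exact ⟨hP, hQ⟩
  have h₄ : ∀ (A : DForm d M 1 𝔤) (B : DForm d M 2 𝔥), IsSmoothForm A → IsSmoothForm B →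
      (IsCritical2YM κ g e hd A B ↔ FieldEquations2YM κ g hd A B) :=
    fun A B hA hB => isCritical2YM_iff κ g e hσ he hd hA hB
  refine ⟨h₁, h₂, ?_, h₄, ?_, ?_, ?_⟩
  · rintro A B P Q hA hB rfl rfl
    have hL := lagrangian_multiplier (κ := κ) g e hσ he hd A B
    refine ⟨fieldEquations_multiplier_iff κ g e hσ he hd hA hB, hL, fun D _ => ?_⟩
    rw [action2BFYM, action2YM, hL]
  · rintro ⟨A, B, P, Q⟩ ⟨hA, hB, hP, hQ, hcrit⟩
    have hE := (h₁ A B P Q hA hB hP hQ).1 hcrit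
    obtain ⟨rfl, rfl⟩ := h₂ A B P Q hE
    exact ⟨hA, hB, (h₄ A B hA hB).2 ((fieldEquations_multiplier_iff κ g e hσ he hd hA hB).1 hE)⟩
  -- Injectivity: the field equations express both multipliers through `(A, B)`.
  · rintro ⟨A, B, P, Q⟩ ⟨hA, hB, hP, hQ, hcrit⟩ ⟨A', B', P', Q'⟩ ⟨hA', hB', hP', hQ', hcrit'⟩ heq
    obtain ⟨rfl, rfl⟩ := Prod.mk.inj heq
    obtain ⟨rfl, rfl⟩ := h₂ A B P Q ((h₁ A B P Q hA hB hP hQ).1 hcrit)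
    obtain ⟨rfl, rfl⟩ := h₂ A B P' Q' ((h₁ A B P' Q' hA hB hP' hQ').1 hcrit')
    rfl
  -- Surjectivity: the preimage takes the forced values of the multipliers, which are smooth because
  -- the star preserves smoothness.
  · rintro ⟨A, B⟩ ⟨hA, hB, hcrit⟩
    have hE := (fieldEquations_multiplier_iff κ g e hσ he hd hA hB).2 ((h₄ A B hA hB).1 hcrit)
    have hP := ((isSmoothForm_curvF X hA hB).hodge g hσ (by omega)
      (show 2 + (q + 1) = d by omega)).smul (-(σ / (2 * e ^ 2)))
    have hQ := ((isSmoothForm_curvG X hA hB).hodge g hσ (by omega)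
      (show 3 + q = d by omega)).smul ((-1) ^ d * (σ / (2 * e ^ 2)))
    exact ⟨⟨A, B, _, _⟩, ⟨hA, hB, hP, hQ, (h₁ A B _ _ hA hB hP hQ).2 hE⟩, rfl⟩
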